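/- Let $SE(2)$ be the Lie group of the matrices $$g(\varphi,x,y)=\begin{pmatrix}\cos\varphi&-\sin\varphi&x\\ \sin\varphi&\cos\varphi&y\\0&0&1\end{pmatrix},\qquad \varphi,x,y\in\mathbb R,$$ with unit $e$, and let $$e_1=\begin{pmatrix}0&-1&0\\1&0&0\\0&0&0\end{pmatrix},\quad e_2=\begin{pmatrix}0&0&1\\0&0&0\\0&0&0\end{pmatrix},\quad e_3=\begin{pmatrix}0&0&0\\0&0&1\\0&0&0\end{pmatrix}$$ be the basis of its Lie algebra $\mathfrak{se}(2)$, orthonormal for the scalar product $\langle\cdot,\cdot\rangle$. Let $\mathfrak p=\operatorname{span}(e_1,e_2)$, and let $d$ be the left-invariant sub-Riemannian metric on $SE(2)$ defined by $\mathfrak p$ and $\langle\cdot,\cdot\rangle|_{\mathfrak p}$: $d(g,h)$ is the infimum of the lengths $\int_0^T|\gamma^{-1}\dot\gamma|\,dt$ of the piecewise smooth paths $\gamma:[0,T]\to SE(2)$ from $g$ to $h$ with $\gamma^{-1}\dot\gamma\in\mathfrak p$. A geodesic (parametrized by arc length) is a curve $g:\mathbb R\to SE(2)$ that is locally shortest,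 i.e. every $t_0\in\mathbb R$ has a neighbourhood on which $d(g(s),g(t))=|t-s|$. For $\alpha,\beta\in\mathbb R$ put $\psi_0=\cos\alpha\,e_1+\sin\alpha\,e_2+\beta e_3$, let $u(g)\in\mathfrak p$ be the vector with $\langle u(g),w\rangle=\langle\psi_0,gwg^{-1}\rangle$ for all $w\in\mathfrak p$, and let $v(g)=g\,u(g)$ be the corresponding vector field on $SE(2)$. Then: 1. For all $\alpha,\beta\in\mathbb R$ there is exactly one integral curve $g:\mathbb R\to SE(2)$ of $v$ with $g(0)=e$. 2. The geodesics $g$ with $g(0)=e$ are exactly the curves in 1, for all $\alpha,\beta\in\mathbb R$. 3. For all $\alpha,\beta\in\mathbb R$, the curve in 1 has the form $g(t)=g(\varphi(t),x(t),y(t))$ with differentiable functions $\varphi,x,y:\mathbb R\to\mathbb R$, $\varphi(0)=x(0)=y(0)=0$, and there is a twice differentiable function $\omega:\mathbb R\to\mathbb R$ such that for all $t$ $$\sin\frac{\omega}{2}=\sin\alpha\cos\varphi+\beta\sin\varphi,\qquad \cos\frac{\omega}{2}=\cos\alpha+y\sin\alpha-\beta x,$$ $$\dot\varphi=\cos\frac{\omega}{2},\qquad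 \dot x=\sin\frac{\omega}{2}\cos\varphi,\qquad \dot y=\sin\frac{\omega}{2}\sin\varphi,$$ and $\omega$ satisfies the pendulum equation $\ddot\omega=-\sin\omega$ with $\omega(0)=2\alpha$ and $\dot\omega(0)=2\beta$. -/

import Mathlib

open Set MeasureTheory
open scoped ENNReal

namespace SE2Geo

/-- The matrix of the rigid motion of the plane with rotation angle `φ` and translation `(x, y)`. -/
noncomputable def mat (φ x y : ℝ) : Matrix (Fin 3) (Fin 3) ℝ :=
  !![Real.cos φ, -Real.sin φ, x; Real.sin φ, Real.cos φ, y; 0, 0, 1]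

theorem mat_mul (φ x y φ' x' y' : ℝ) :
    mat φ x y * mat φ' x' y' =
      mat (φ + φ') (Real.cos φ * x' - Real.sin φ * y' + x)
        (Real.sin φ * x' + Real.cos φ * y' + y) := by
  ext i j
  fin_cases i <;> fin_cases j <;>
    simp [mat, Matrix.mul_apply, Fin.sum_univ_three, Real.cos_add, Real.sin_add] <;> ring

theorem mat_zero : mat 0 0 0 = 1 := by
  ext i j
  fin_cases i <;> fin_cases j <;> simp [mat]

theorem mat_mul_inv (φ x y : ℝ) :
    mat φ x y * mat (-φ) (-(Real.cos φ * x + Real.sin φ * y)) (Real.sin φ * x - Real.cos φ * y)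
      = 1 := by
  rw [mat_mul, ← mat_zero]
  have h := Real.sin_sq_add_cos_sq φ
  congr 1
  · ring
  · linear_combination -x * h
  · linear_combination -y * h

/-- The Lie group `SE(2)`, as the closed group of matrices `mat φ x y` in `GL(3, ℝ)`. -/
noncomputable def SE2 : Subgroup (GL (Fin 3) ℝ) where
  carrier := {g | ∃ φ x y : ℝ, (g : Matrix (Fin 3) (Fin 3) ℝ) = mat φ x y}
  mul_mem' := by
    rintro g h ⟨φ, x, y, hg⟩ ⟨φ', x', y', hh⟩
    exact ⟨_, _, _, by rw [Units.val_mul, hg, hh, mat_mul]⟩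
  one_mem' := ⟨0, 0, 0, by rw [Units.val_one, mat_zero]⟩
  inv_mem' := by
    rintro g ⟨φ, x, y, hg⟩
    exact ⟨-φ, -(Real.cos φ * x + Real.sin φ * y), Real.sin φ * x - Real.cos φ * y,
      Units.inv_eq_of_mul_eq_one_right (by rw [hg, mat_mul_inv])⟩

/-- The matrix of an element of `SE(2)`. -/
def toMat (g : SE2) : Matrix (Fin 3) (Fin 3) ℝ := ((g : GL (Fin 3) ℝ) : Matrix (Fin 3) (Fin 3) ℝ)

/-- The basis `e1, e2, e3` of the Lie algebra `se(2)`. -/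
def e1 : Matrix (Fin 3) (Fin 3) ℝ := !![0, -1, 0; 1, 0, 0; 0, 0, 0]

def e2 : Matrix (Fin 3) (Fin 3) ℝ := !![0, 0, 1; 0, 0, 0; 0, 0, 0]

def e3 : Matrix (Fin 3) (Fin 3) ℝ := !![0, 0, 0; 0, 0, 1; 0, 0, 0]

/-- The scalar product on `se(2)` with orthonormal basis `e1, e2, e3`: the coordinates of
`w = w₁ e1 + w₂ e2 + w₃ e3` are `w₁ = w 1 0`, `w₂ = w 0 2`, `w₃ = w 1 2`. It is only applied to
elements of `se(2)`. -/
def ip (v w : Matrix (Fin 3) (Fin 3) ℝ) : ℝ :=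
  v 1 0 * w 1 0 + v 0 2 * w 0 2 + v 1 2 * w 1 2

/-- The subspace `𝔭` of `se(2)` spanned by `e1, e2`. -/
def horizontal : Submodule ℝ (Matrix (Fin 3) (Fin 3) ℝ) := Submodule.span ℝ {e1, e2}

/-- The velocity at time `t` of the curve `g` in `SE(2)` is `g(t) u`, the left translate of
`u ∈ se(2)`. -/
def HasLeftVelocity (g : ℝ → SE2) (u : Matrix (Fin 3) (Fin 3) ℝ) (t : ℝ) : Prop :=
  ∀ i j, HasDerivAt (fun s => toMat (g s) i j) ((toMat (g t) * u) i j) t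

/-- `g`, restricted to `[0, T]`, is a piecewise smooth path that is tangent to the left-invariant
distribution defined by `𝔭`, with left velocity `u`. `P` is the set of break points; the path is
smooth, up to the end points, on each closed interval without a break point inside. -/
structure IsHorizontalPath (T : ℝ) (g : ℝ → SE2) (u : ℝ → Matrix (Fin 3) (Fin 3) ℝ) : Prop where
  nonneg : 0 ≤ T
  continuousOn : ∀ i j, ContinuousOn (fun t => toMat (g t) i j) (Icc 0 T)
  mem_horizontal : ∀ t, u t ∈ horizontal
  piecewise_smooth : ∃ P : Finset ℝ,
    (∀ a b, 0 ≤ a → a < b → b ≤ T → (∀ t ∈ Ioo a b, t ∉ P) →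
      ∀ i j, ContDiffOn ℝ ((⊤ : ℕ∞) : WithTop ℕ∞) (fun t => toMat (g t) i j) (Icc a b)) ∧
    (∀ t ∈ Ioo 0 T, t ∉ P → HasLeftVelocity g (u t) t)

/-- The length `∫₀ᵀ |u(t)| dt`, where `|u| = √⟨u, u⟩`. -/
noncomputable def pathLength (T : ℝ) (u : ℝ → Matrix (Fin 3) (Fin 3) ℝ) : ℝ≥0∞ :=
  ∫⁻ t in Icc 0 T, ENNReal.ofReal (Real.sqrt (ip (u t) (u t)))

/-- The left-invariant sub-Riemannian distance on `SE(2)` defined by `𝔭` and the scalar product on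
`𝔭` with orthonormal basis `e1, e2`: the infimum of the lengths of piecewise smooth horizontal
paths. -/
noncomputable def subRiemannianDist (g h : SE2) : ℝ≥0∞ :=
  ⨅ (T : ℝ) (γ : ℝ → SE2) (u : ℝ → Matrix (Fin 3) (Fin 3) ℝ)
    (_ : IsHorizontalPath T γ u ∧ γ 0 = g ∧ γ T = h), pathLength T u

/-- A geodesic parametrized by arc length: a curve, defined on the whole line, that is locally
shortest. -/
def IsGeodesic (g : ℝ → SE2) : Prop :=
  ∀ t₀ : ℝ, ∃ ε > 0, ∀ s ∈ Ioo (t₀ - ε) (t₀ + ε), ∀ t ∈ Ioo (t₀ - ε) (t₀ + ε),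
    subRiemannianDist (g s) (g t) = ENNReal.ofReal |t - s|

/-- The (co)vector `ψ₀ = cos α e1 + sin α e2 + β e3`. -/
noncomputable def psi0 (α β : ℝ) : Matrix (Fin 3) (Fin 3) ℝ :=
  Real.cos α • e1 + Real.sin α • e2 + β • e3

/-- The adjoint representation `Ad(g) w = g w g⁻¹`. -/
noncomputable def Ad (g : SE2) (w : Matrix (Fin 3) (Fin 3) ℝ) : Matrix (Fin 3) (Fin 3) ℝ :=
  toMat g * w * toMat g⁻¹

/-- The vector `u(g) ∈ 𝔭` with `⟨u(g), w⟩ = ⟨ψ₀, Ad(g) w⟩` for all `w ∈ 𝔭`. -/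
noncomputable def geodesicControl (α β : ℝ) (g : SE2) : Matrix (Fin 3) (Fin 3) ℝ :=
  ip (psi0 α β) (Ad g e1) • e1 + ip (psi0 α β) (Ad g e2) • e2

/-- `g` is an integral curve, on the whole line, of the geodesic vector field `v(g) = g u(g)`. -/
def IsFieldCurve (α β : ℝ) (g : ℝ → SE2) : Prop :=
  ∀ t, HasLeftVelocity g (geodesicControl α β (g t)) t

end SE2Geo

/-! Existence is obtained backwards: one solves the pendulum, whose vector field is globally
Lipschitz, and integrates `φ`, `x`, `y` from it. The pair `(sin (ω/2), ω'/2)` turns with angle `-φ`,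
so turning it back gives the constants `(sin α, β)`. This yields the first displayed identity, and
the second follows by integration. The two identities say that the curve follows the geodesic field
(`exists_extremal`). In the matrix entries the field is polynomial, which gives uniqueness.

Field curves are locally shortest by a calibration. For `a = sin α`, `b = β`, `c = φ'`, consider the
function `a X + b Y + S(σ) + c(σ) (ψ - φ(σ)) - K (σ - t₀) (ψ - φ(σ))²` of time `σ` and position `(ψ,
X, Y)`, where `S' = c² - 1/2`. For `σ` near `t₀` it is a subsolution of the Hamilton-Jacobi equation
of the Hamiltonian `(A² + B²)/2` (`hamilton_jacobi_le`). Hence it grows at most by half the length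
along any horizontal path, with `σ` advancing by arc length. Along the extremal it grows by exactly
half the time, so no path is shorter (`le_subRiemannianDist_of_extremal`).

Conversely, a locally shortest curve is only a map realizing distances. Comparison with short
horizontal paths makes its coordinates Lipschitz, with velocity horizontal almost everywhere
(`exists_coord_of_dist_eq`, `exists_velocity`). The distance is an infimum over piecewise smooth
paths, so before varying such a curve one shows that competitors with bounded measurable velocity
are not shorter either (`le_integral_of_le_subRiemannianDist`). Their smooth approximations must
reach the same end point. This is arranged by adding a combination of `cos ψ` and `sin ψ` to the
translational velocity, whose coefficients solve a Gram system, solvable as soon as the angle is not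
constant. The same correction makes angle variations admissible; minimality then forces `w = a cos φ
+ b sin φ` and an integrated Euler-Lagrange equation for `φ'`, hence the field equation with unit
speed. If the angle is constant the variational argument breaks down, but the curve is a straight
line, which satisfies the field equation as well.

Finally, the parameters of the field are determined by the curve on any interval, so they are
locally constant and therefore constant on the line. -/

namespace SE2Geo

/-! ### Global solutions of the pendulum equation and the normal extremals built from them. -/

open scoped Manifold in
/-- A vector field of class `C¹` that is globally Lipschitz has global integral curves. -/
theorem exists_global_solution {E : Type*} [NormedAddCommGroup E] [NormedSpace ℝ E]
    [CompleteSpace E] {f : E → E} (hf : ContDiff ℝ 1 f) {K : NNReal} (hK : LipschitzWith K f)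
    (x₀ : E) : ∃ γ : ℝ → E, γ 0 = x₀ ∧ ∀ t, HasDerivAt γ (f (γ t)) t := by
  have hloc : ∀ x : E, ∃ γ : ℝ → E, γ 0 = x ∧
      IsMIntegralCurveOn (I := 𝓘(ℝ, E)) γ f (Ioo (-(1 / (K + 1) : ℝ)) (1 / (K + 1))) := by
    intro x
    -- On the ball of radius `‖f x‖` around `x` the field is bounded by `(K + 1) ‖f x‖`. The
    -- solution therefore stays inside for time `1 / (K + 1)`, which does not depend on `x`; local
    -- solutions of uniform duration glue to a global one.
    have hpl : IsPicardLindelof (fun _ : ℝ => f) (tmin := -(1 / (K + 1))) (tmax := 1 / (K + 1))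
        ⟨0, by constructor <;> simp <;> positivity⟩ x (‖f x‖₊) 0 ((K + 1) * ‖f x‖₊) K := by
      refine .of_time_independent (fun y hy => ?_) hK.lipschitzOnWith ?_
      · have h1 := hK.norm_sub_le y x
        have h2 : ‖y - x‖ ≤ ‖f x‖ := by simpa [dist_eq_norm] using hy
        have h3 := norm_le_norm_sub_add (f y) (f x)
        have h4 : (K : ℝ) * ‖y - x‖ ≤ K * ‖f x‖ := by gcongr
        simp only [NNReal.coe_mul, NNReal.coe_add, NNReal.coe_one, coe_nnnorm]
        linarith
      · have : (K : ℝ) + 1 ≠ 0 := by positivity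
        simp
        field_simp
        rfl
    obtain ⟨γ, h0, hγ⟩ := hpl.exists_eq_forall_mem_Icc_hasDerivWithinAt₀
    refine ⟨γ, h0, fun t ht => ?_⟩
    exact ((hγ t (Ioo_subset_Icc_self ht)).hasDerivAt
      (Icc_mem_nhds ht.1 ht.2)).hasDerivWithinAt.hasFDerivWithinAt.hasMFDerivWithinAt
  obtain ⟨γ, h0, hγ⟩ := exists_isMIntegralCurve_of_isMIntegralCurveOn (I := 𝓘(ℝ, E)) (M := E)
    (v := f) (contMDiff_vectorSpace_iff_contDiff.2 hf) (ε := 1 / (K + 1)) (by positivity) hloc x₀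
  exact ⟨γ, h0, fun t => hasDerivAt_iff_hasFDerivAt.2 (hasMFDerivAt_iff_hasFDerivAt.1 (hγ t))⟩

/-- The pendulum equation has global solutions for all initial values. -/
theorem exists_pendulum (ω₀ p₀ : ℝ) : ∃ ω p : ℝ → ℝ, ω 0 = ω₀ ∧ p 0 = p₀ ∧
    (∀ t, HasDerivAt ω (p t) t) ∧ ∀ t, HasDerivAt p (-Real.sin (ω t)) t := by
  have hs : LipschitzWith 1 Real.sin := by
    refine lipschitzWith_of_nnnorm_deriv_le Real.differentiable_sin fun x => ?_
    rw [Real.deriv_sin, ← NNReal.coe_le_coe]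
    simpa using Real.abs_cos_le_one x
  have hl : LipschitzWith 1 (fun z : ℝ × ℝ => (z.2, -Real.sin z.1)) := by
    have h := LipschitzWith.prod_snd (α := ℝ) (β := ℝ) |>.prodMk
      (hs.comp (LipschitzWith.prod_fst (α := ℝ) (β := ℝ))).neg
    simpa [Function.comp_def] using h
  obtain ⟨γ, h0, hγ⟩ := exists_global_solution
    (f := fun z : ℝ × ℝ => (z.2, -Real.sin z.1)) (by fun_prop) hl (ω₀, p₀)
  refine ⟨fun t => (γ t).1, fun t => (γ t).2, by simp [h0], by simp [h0], fun t => ?_, fun t => ?_⟩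
  · exact (hasFDerivAt_fst.comp_hasDerivAt t (hγ t) : )
  · exact (hasFDerivAt_snd.comp_hasDerivAt t (hγ t) : )

/-- The primitive of a continuous function, vanishing at zero. -/
theorem exists_primitive {f : ℝ → ℝ} (hf : Continuous f) (c : ℝ) :
    ∃ F : ℝ → ℝ, F 0 = c ∧ ∀ t, HasDerivAt F (f t) t :=
  ⟨fun t => c + ∫ s in (0 : ℝ)..t, f s, by simp,
    fun t => (hf.integral_hasStrictDerivAt 0 t).hasDerivAt.const_add c⟩

theorem eq_of_hasDerivAt_zero {f : ℝ → ℝ} (hf : ∀ t, HasDerivAt f 0 t) (s t : ℝ) : f s = f t :=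
  is_const_of_deriv_eq_zero (fun t => (hf t).differentiableAt) (fun t => (hf t).deriv) s t

/-- The coordinates of a normal extremal, with all the relations between them. -/
theorem exists_extremal (α β : ℝ) : ∃ φ x y ω p : ℝ → ℝ, φ 0 = 0 ∧ x 0 = 0 ∧ y 0 = 0 ∧
    ω 0 = 2 * α ∧ p 0 = 2 * β ∧
    (∀ t, Real.sin (ω t / 2) = Real.sin α * Real.cos (φ t) + β * Real.sin (φ t)) ∧
    (∀ t, Real.cos (ω t / 2) = Real.cos α + y t * Real.sin α - β * x t) ∧
    (∀ t, p t / 2 = β * Real.cos (φ t) - Real.sin α * Real.sin (φ t)) ∧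
    (∀ t, HasDerivAt φ (Real.cos (ω t / 2)) t) ∧
    (∀ t, HasDerivAt x (Real.sin (ω t / 2) * Real.cos (φ t)) t) ∧
    (∀ t, HasDerivAt y (Real.sin (ω t / 2) * Real.sin (φ t)) t) ∧
    (∀ t, HasDerivAt ω (p t) t) ∧ ∀ t, HasDerivAt p (-Real.sin (ω t)) t := by
  obtain ⟨ω, p, hω0, hp0, hω, hp⟩ := exists_pendulum (2 * α) (2 * β)
  have cω : Continuous ω := continuous_iff_continuousAt.2 fun t => (hω t).continuousAt
  obtain ⟨φ, hφ0, hφ⟩ := exists_primitive (f := fun t => Real.cos (ω t / 2)) (by fun_prop) 0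
  have cφ : Continuous φ := continuous_iff_continuousAt.2 fun t => (hφ t).continuousAt
  obtain ⟨x, hx0, hx⟩ := exists_primitive
    (f := fun t => Real.sin (ω t / 2) * Real.cos (φ t)) (by fun_prop) 0
  obtain ⟨y, hy0, hy⟩ := exists_primitive
    (f := fun t => Real.sin (ω t / 2) * Real.sin (φ t)) (by fun_prop) 0
  have hsin : ∀ t, HasDerivAt (fun t => Real.sin (ω t / 2))
      (Real.cos (ω t / 2) * (p t / 2)) t := fun t => ((hω t).div_const 2).sin
  have hcos : ∀ t, HasDerivAt (fun t => Real.cos (ω t / 2))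
      (-Real.sin (ω t / 2) * (p t / 2)) t := fun t => ((hω t).div_const 2).cos
  have hp2 : ∀ t, HasDerivAt (fun t => p t / 2)
      (-(Real.sin (ω t / 2) * Real.cos (ω t / 2))) t := fun t => by
    refine ((hp t).div_const 2).congr_deriv ?_
    have := Real.sin_two_mul (ω t / 2)
    rw [mul_div_cancel₀ _ (two_ne_zero)] at this
    rw [this]; ring
  -- With `q = sin (ω/2)` and `h = p/2` one has `q' = φ' h` and `h' = -φ' q`. The pair `(q, h)`
  -- rotates by `-φ`, and undoing the rotation gives two constants of motion.
  have hA : ∀ t, Real.sin (ω t / 2) * Real.cos (φ t) - p t / 2 * Real.sin (φ t) = Real.sin α := by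
    intro t
    rw [eq_of_hasDerivAt_zero (f := fun t => Real.sin (ω t / 2) * Real.cos (φ t) -
      p t / 2 * Real.sin (φ t)) (fun t => ?_) t 0]
    · simp [hω0, hφ0]
    · refine (((hsin t).mul (hφ t).cos).sub ((hp2 t).mul (hφ t).sin)).congr_deriv ?_
      ring
  have hB : ∀ t, Real.sin (ω t / 2) * Real.sin (φ t) + p t / 2 * Real.cos (φ t) = β := by
    intro t
    rw [eq_of_hasDerivAt_zero (f := fun t => Real.sin (ω t / 2) * Real.sin (φ t) +
      p t / 2 * Real.cos (φ t)) (fun t => ?_) t 0]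
    · simp [hφ0, hp0]
    · refine (((hsin t).mul (hφ t).sin).add ((hp2 t).mul (hφ t).cos)).congr_deriv ?_
      ring
  have h1 : ∀ t, Real.sin (ω t / 2) = Real.sin α * Real.cos (φ t) + β * Real.sin (φ t) := by
    intro t
    rw [← hA t, ← hB t]
    linear_combination -Real.sin (ω t / 2) * Real.sin_sq_add_cos_sq (φ t)
  have h3 : ∀ t, p t / 2 = β * Real.cos (φ t) - Real.sin α * Real.sin (φ t) := by
    intro t
    rw [← hA t, ← hB t]
    linear_combination -(p t / 2) * Real.sin_sq_add_cos_sq (φ t)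
  refine ⟨φ, x, y, ω, p, hφ0, hx0, hy0, hω0, hp0, h1, fun t => ?_, h3, hφ, hx, hy, hω, hp⟩
  -- Both `cos (ω/2)` and `y sin α - β x` have derivative `-sin (ω/2) p/2`, by the formula `h3` for
  -- `p/2`.
  have := eq_of_hasDerivAt_zero (f := fun t => Real.cos (ω t / 2) -
      (y t * Real.sin α - β * x t)) (fun t => ?_) t 0
  · simp only [hω0, hx0, hy0] at this
    rw [mul_div_cancel_left₀ _ (two_ne_zero)] at this
    linarith
  · refine ((hcos t).sub (((hy t).mul_const _).sub ((hx t).const_mul β))).congr_deriv ?_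
    rw [h3 t]; ring

/-! ### Coordinates on the group, and the geodesic field in matrix entries. -/

/-- The element of `SE(2)` with given coordinates. -/
noncomputable def ofCoord (φ x y : ℝ) : SE2 :=
  ⟨⟨mat φ x y, mat (-φ) (-(Real.cos φ * x + Real.sin φ * y)) (Real.sin φ * x - Real.cos φ * y),
    mat_mul_inv φ x y, by
      have := mul_eq_one_comm.1 (mat_mul_inv φ x y)
      exact this⟩, φ, x, y, rfl⟩

@[simp] theorem toMat_ofCoord (φ x y : ℝ) : toMat (ofCoord φ x y) = mat φ x y := rfl

theorem toMat_injective : Function.Injective toMat := fun _ _ h =>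
  Subtype.ext (Units.ext h)

theorem exists_coord (g : SE2) : ∃ φ x y, g = ofCoord φ x y := by
  obtain ⟨φ, x, y, h⟩ := g.2
  exact ⟨φ, x, y, toMat_injective h⟩

theorem ofCoord_zero : ofCoord 0 0 0 = 1 := toMat_injective (by
  rw [toMat_ofCoord, mat_zero]; rfl)

theorem toMat_inv_ofCoord (φ x y : ℝ) : toMat (ofCoord φ x y)⁻¹ =
    mat (-φ) (-(Real.cos φ * x + Real.sin φ * y)) (Real.sin φ * x - Real.cos φ * y) := rfl

/-- The horizontal vector with coordinates `a, b`. -/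
def hor (a b : ℝ) : Matrix (Fin 3) (Fin 3) ℝ := a • e1 + b • e2

theorem hor_mem (a b : ℝ) : hor a b ∈ horizontal := by
  refine add_mem (Submodule.smul_mem _ _ (Submodule.subset_span ?_))
    (Submodule.smul_mem _ _ (Submodule.subset_span ?_)) <;> simp

theorem exists_hor {u : Matrix (Fin 3) (Fin 3) ℝ} (h : u ∈ horizontal) : ∃ a b, u = hor a b := by
  obtain ⟨a, b, h⟩ := Submodule.mem_span_pair.1 h
  exact ⟨a, b, h.symm⟩

theorem ip_hor (a b : ℝ) : ip (hor a b) (hor a b) = a ^ 2 + b ^ 2 := by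
  simp [ip, hor, e1, e2]; ring

/-- The control of the geodesic field in terms of matrix entries. -/
theorem geodesicControl_eq (α β : ℝ) (g : SE2) : geodesicControl α β g =
    hor (Real.cos α + toMat g 1 2 * Real.sin α - β * toMat g 0 2)
      (Real.sin α * toMat g 0 0 + β * toMat g 1 0) := by
  obtain ⟨φ, x, y, rfl⟩ := exists_coord g
  have h := Real.sin_sq_add_cos_sq φ
  unfold geodesicControl hor Ad
  rw [toMat_inv_ofCoord, toMat_ofCoord]
  congr 2
  · simp [ip, psi0, e1, e2, e3, mat, Matrix.mul_apply, Fin.sum_univ_three]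
    linear_combination (Real.cos α + Real.sin α * y - β * x) * h
  · simp [ip, psi0, e1, e2, e3, mat, Matrix.mul_apply, Fin.sum_univ_three]

/-- The left velocity in terms of matrix entries. -/
theorem hasLeftVelocity_iff {g : ℝ → SE2} {a b t : ℝ} : HasLeftVelocity g (hor a b) t ↔
    HasDerivAt (fun s => toMat (g s) 0 0) (-a * toMat (g t) 1 0) t ∧
    HasDerivAt (fun s => toMat (g s) 1 0) (a * toMat (g t) 0 0) t ∧
    HasDerivAt (fun s => toMat (g s) 0 2) (b * toMat (g t) 0 0) t ∧
    HasDerivAt (fun s => toMat (g s) 1 2) (b * toMat (g t) 1 0) t := by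
  have e01 : ∀ h : SE2, toMat h 0 1 = - toMat h 1 0 := fun h => by
    obtain ⟨φ, x, y, rfl⟩ := exists_coord h; simp [mat]
  have e11 : ∀ h : SE2, toMat h 1 1 = toMat h 0 0 := fun h => by
    obtain ⟨φ, x, y, rfl⟩ := exists_coord h; simp [mat]
  have e20 : ∀ h : SE2, toMat h 2 0 = 0 := fun h => by
    obtain ⟨φ, x, y, rfl⟩ := exists_coord h; simp [mat]
  have e21 : ∀ h : SE2, toMat h 2 1 = 0 := fun h => by
    obtain ⟨φ, x, y, rfl⟩ := exists_coord h; simp [mat]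
  have e22 : ∀ h : SE2, toMat h 2 2 = 1 := fun h => by
    obtain ⟨φ, x, y, rfl⟩ := exists_coord h; simp [mat]
  constructor
  · intro h
    refine ⟨(h 0 0).congr_deriv ?_, (h 1 0).congr_deriv ?_, (h 0 2).congr_deriv ?_,
      (h 1 2).congr_deriv ?_⟩ <;>
    simp [hor, e1, e2, Matrix.mul_apply, Fin.sum_univ_three, e01, e11] <;> ring
  · rintro ⟨h00, h10, h02, h12⟩ i j
    fin_cases i <;> fin_cases j <;>
      simp [hor, e1, e2, Matrix.mul_apply, Fin.sum_univ_three, e01, e11, e20, e21, e22]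
    · exact h00.congr_deriv (by ring)
    · exact h10.neg.congr_deriv (by ring)
    · exact h02.congr_deriv (by ring)
    · exact h10.congr_deriv (by ring)
    · exact h00.congr_deriv (by ring)
    · exact h12.congr_deriv (by ring)
    all_goals exact hasDerivAt_const _ _

/-- The left velocity of a curve that is given in coordinates. -/
theorem hasLeftVelocity_ofCoord {φ x y : ℝ → ℝ} {a b t : ℝ} (hφ : HasDerivAt φ a t)
    (hx : HasDerivAt x (b * Real.cos (φ t)) t) (hy : HasDerivAt y (b * Real.sin (φ t)) t) :
    HasLeftVelocity (fun s => ofCoord (φ s) (x s) (y s)) (hor a b) t := by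
  rw [hasLeftVelocity_iff]
  refine ⟨?_, ?_, ?_, ?_⟩ <;> simp [mat]
  · exact hφ.cos.congr_deriv (by ring)
  · exact hφ.sin.congr_deriv (by ring)
  · exact hx
  · exact hy

theorem isFieldCurve_iff {α β : ℝ} {g : ℝ → SE2} : IsFieldCurve α β g ↔ ∀ t,
    HasLeftVelocity g (hor (Real.cos α + toMat (g t) 1 2 * Real.sin α - β * toMat (g t) 0 2)
      (Real.sin α * toMat (g t) 0 0 + β * toMat (g t) 1 0)) t := by
  simp only [IsFieldCurve, geodesicControl_eq]

open scoped Manifold in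
/-- Two integral curves of the geodesic field with the same value at `0` are equal. -/
theorem IsFieldCurve.unique {α β : ℝ} {g h : ℝ → SE2} (hg : IsFieldCurve α β g)
    (hh : IsFieldCurve α β h) (h0 : g 0 = h 0) : g = h := by
  -- The entries `cos φ`, `sin φ`, `x`, `y` satisfy an autonomous quadratic system. Working with
  -- them avoids choosing an angle, and they determine the matrix.
  let f : ℝ × ℝ × ℝ × ℝ → ℝ × ℝ × ℝ × ℝ := fun z =>
    (-(Real.cos α + z.2.2.2 * Real.sin α - β * z.2.2.1) * z.2.1,
      (Real.cos α + z.2.2.2 * Real.sin α - β * z.2.2.1) * z.1,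
      (Real.sin α * z.1 + β * z.2.1) * z.1, (Real.sin α * z.1 + β * z.2.1) * z.2.1)
  let q : SE2 → ℝ × ℝ × ℝ × ℝ := fun k => (toMat k 0 0, toMat k 1 0, toMat k 0 2, toMat k 1 2)
  have hf : ContDiff ℝ 1 f := by fun_prop
  have key : ∀ {k : ℝ → SE2}, IsFieldCurve α β k → IsMIntegralCurve (I := 𝓘(ℝ, ℝ × ℝ × ℝ × ℝ))
      (fun t => q (k t)) f := by
    intro k hk t
    obtain ⟨h1, h2, h3, h4⟩ := hasLeftVelocity_iff.1 (isFieldCurve_iff.1 hk t)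
    exact (h1.prodMk (h2.prodMk (h3.prodMk h4))).hasFDerivAt.hasMFDerivAt
  have := isMIntegralCurve_Ioo_eq_of_contMDiff_boundaryless (t₀ := 0)
    (contMDiff_vectorSpace_iff_contDiff.2 hf) (key hg) (key hh) (by simp [h0])
  funext t
  have ht := congr_fun this t
  obtain ⟨φ, x, y, h1⟩ := exists_coord (g t)
  obtain ⟨φ', x', y', h2⟩ := exists_coord (h t)
  simp only [q, h1, h2, Prod.mk.injEq, toMat_ofCoord, mat] at ht
  apply toMat_injective
  rw [h1, h2]
  simp at ht
  simp [mat, ht.1, ht.2.1, ht.2.2.1, ht.2.2.2]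

/-- The identities `h1` and `h2` equate the velocity components `sin (ω/2)` and `cos (ω/2)` with
those of the control of the field. -/
theorem isFieldCurve_of_coord {α β : ℝ} {φ x y ω : ℝ → ℝ}
    (h1 : ∀ t, Real.sin (ω t / 2) = Real.sin α * Real.cos (φ t) + β * Real.sin (φ t))
    (h2 : ∀ t, Real.cos (ω t / 2) = Real.cos α + y t * Real.sin α - β * x t)
    (hφ : ∀ t, HasDerivAt φ (Real.cos (ω t / 2)) t)
    (hx : ∀ t, HasDerivAt x (Real.sin (ω t / 2) * Real.cos (φ t)) t)
    (hy : ∀ t, HasDerivAt y (Real.sin (ω t / 2) * Real.sin (φ t)) t) :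
    IsFieldCurve α β (fun t => ofCoord (φ t) (x t) (y t)) := by
  rw [isFieldCurve_iff]
  intro t
  convert hasLeftVelocity_ofCoord (hφ t) (hx t) (hy t) using 2
  · rw [h2 t]; simp [mat]
  · rw [h1 t]; simp [mat]

/-! ### Lifting horizontal paths to coordinates with a continuous angle and arc length. -/

/-- A continuous function whose derivative is nonpositive off a finite set does not increase. -/
theorem le_of_deriv_nonpos_off_finset {F : ℝ → ℝ} (P : Finset ℝ) : ∀ {a b : ℝ}, a ≤ b →
    ContinuousOn F (Icc a b) → (∀ t ∈ Ioo a b, t ∉ P → ∃ d ≤ 0, HasDerivAt F d t) → F b ≤ F a := by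
  induction P using Finset.induction_on with
  | empty =>
    intro a b hab hc hd
    refine antitoneOn_of_deriv_nonpos (convex_Icc a b) hc ?_ ?_ (left_mem_Icc.2 hab)
      (right_mem_Icc.2 hab) hab
    · rw [interior_Icc]
      intro t ht
      obtain ⟨d, -, h⟩ := hd t ht (by simp)
      exact h.differentiableAt.differentiableWithinAt
    · rw [interior_Icc]
      intro t ht
      obtain ⟨d, h0, h⟩ := hd t ht (by simp)
      rwa [h.deriv]
  | insert p P hp ih =>
    intro a b hab hc hd
    by_cases hpab : p ∈ Ioo a b
    · refine (ih hpab.2.le (hc.mono (Icc_subset_Icc_left hpab.1.le)) ?_).trans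
        (ih hpab.1.le (hc.mono (Icc_subset_Icc_right hpab.2.le)) ?_)
      · intro t ht htP
        exact hd t ⟨hpab.1.trans ht.1, ht.2⟩ (by simp [htP, ht.1.ne'])
      · intro t ht htP
        exact hd t ⟨ht.1, ht.2.trans hpab.2⟩ (by simp [htP, ht.2.ne])
    · refine ih hab hc fun t ht htP => hd t ht ?_
      rw [Finset.mem_insert]
      rintro (rfl | h)
      · exact hpab ht
      · exact htP h

theorem eq_of_deriv_zero_off_finset {F : ℝ → ℝ} (P : Finset ℝ) {a b : ℝ} (hab : a ≤ b)
    (hc : ContinuousOn F (Icc a b)) (hd : ∀ t ∈ Ioo a b, t ∉ P → HasDerivAt F 0 t) :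
    F b = F a := by
  apply le_antisymm
  · exact le_of_deriv_nonpos_off_finset P hab hc fun t ht h => ⟨0, le_rfl, hd t ht h⟩
  · have := le_of_deriv_nonpos_off_finset (F := fun t => -F t) P hab hc.neg
      fun t ht h => ⟨0, le_rfl, by simpa using (hd t ht h).fun_neg⟩
    simpa using this

/-- A horizontal path in the coordinates `Φ, X, Y`, together with its arc length `τ`. -/
structure IsCoordPath (T : ℝ) (τ Φ X Y : ℝ → ℝ) : Prop where
  nonneg : 0 ≤ T
  continuousOn_length : ContinuousOn τ (Icc 0 T)
  continuousOn_angle : ContinuousOn Φ (Icc 0 T)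
  continuousOn_fst : ContinuousOn X (Icc 0 T)
  continuousOn_snd : ContinuousOn Y (Icc 0 T)
  length_zero : τ 0 = 0
  hasDerivAt : ∃ P : Finset ℝ, ∀ t ∈ Ioo 0 T, t ∉ P → ∃ a b, HasDerivAt τ (√(a ^ 2 + b ^ 2)) t ∧
    HasDerivAt Φ a t ∧ HasDerivAt X (b * Real.cos (Φ t)) t ∧ HasDerivAt Y (b * Real.sin (Φ t)) t

theorem IsCoordPath.mono {T T' : ℝ} {τ Φ X Y : ℝ → ℝ} (h : IsCoordPath T τ Φ X Y) (h0 : 0 ≤ T')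
    (hT : T' ≤ T) : IsCoordPath T' τ Φ X Y where
  nonneg := h0
  continuousOn_length := h.continuousOn_length.mono (Icc_subset_Icc_right hT)
  continuousOn_angle := h.continuousOn_angle.mono (Icc_subset_Icc_right hT)
  continuousOn_fst := h.continuousOn_fst.mono (Icc_subset_Icc_right hT)
  continuousOn_snd := h.continuousOn_snd.mono (Icc_subset_Icc_right hT)
  length_zero := h.length_zero
  hasDerivAt := by
    obtain ⟨P, hP⟩ := h.hasDerivAt
    exact ⟨P, fun t ht => hP t ⟨ht.1, ht.2.trans_le hT⟩⟩

/-- Every horizontal path of finite length has coordinates. -/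
theorem IsHorizontalPath.exists_coordPath {T : ℝ} {γ : ℝ → SE2}
    {u : ℝ → Matrix (Fin 3) (Fin 3) ℝ} (h : IsHorizontalPath T γ u) (hfin : pathLength T u ≠ ∞)
    {φ₀ x₀ y₀ : ℝ} (h0 : γ 0 = ofCoord φ₀ x₀ y₀) : ∃ τ Φ X Y : ℝ → ℝ, IsCoordPath T τ Φ X Y ∧
      τ T = (pathLength T u).toReal ∧ Φ 0 = φ₀ ∧ X 0 = x₀ ∧ Y 0 = y₀ ∧
      γ T = ofCoord (Φ T) (X T) (Y T) := by
  obtain ⟨P, hsm, hvel⟩ := h.piecewise_smooth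
  obtain ⟨v, w, hu⟩ : ∃ v w : ℝ → ℝ, ∀ t, u t = hor (v t) (w t) := by
    choose v w hu using fun t => exists_hor (h.mem_horizontal t)
    exact ⟨v, w, hu⟩
  set U : Set ℝ := Ioo 0 T \ (P : Set ℝ) with hU
  have hUo : IsOpen U := isOpen_Ioo.sdiff P.finite_toSet.isClosed
  have hUT : U ⊆ Icc 0 T := fun t ht => Ioo_subset_Icc_self ht.1
  have hcs : ∀ t, toMat (γ t) 0 0 ^ 2 + toMat (γ t) 1 0 ^ 2 = 1 := fun t => by
    obtain ⟨φ, x, y, e⟩ := exists_coord (γ t)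
    simp [e, mat]
  have hd : ∀ t ∈ U, HasDerivAt (fun s => toMat (γ s) 0 0) (-v t * toMat (γ t) 1 0) t ∧
      HasDerivAt (fun s => toMat (γ s) 1 0) (v t * toMat (γ t) 0 0) t ∧
      HasDerivAt (fun s => toMat (γ s) 0 2) (w t * toMat (γ t) 0 0) t ∧
      HasDerivAt (fun s => toMat (γ s) 1 2) (w t * toMat (γ t) 1 0) t := fun t ht => by
    have := hvel t ht.1 ht.2
    rwa [hu, hasLeftVelocity_iff] at this
  have hcont : ∀ t ∈ U, ∀ i j, ContDiffAt ℝ 1 (fun s => toMat (γ s) i j) t := by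
    intro t ht i j
    obtain ⟨ε, hε, hball⟩ := Metric.isOpen_iff.1 hUo t ht
    have hsub : Icc (t - ε / 2) (t + ε / 2) ⊆ U := fun s hs => hball (by
      rw [Metric.mem_ball, Real.dist_eq, abs_lt]
      constructor <;> linarith [hs.1, hs.2])
    have hl := hsub (left_mem_Icc.2 (by linarith))
    have hr := hsub (right_mem_Icc.2 (by linarith))
    have := hsm (t - ε / 2) (t + ε / 2) hl.1.1.le (by linarith) hr.1.2.le
      (fun s hs => (hsub (Ioo_subset_Icc_self hs)).2) i j
    exact (this.contDiffAt (Icc_mem_nhds (by linarith) (by linarith))).of_le (by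
      exact_mod_cast le_top)
  have hcd : ∀ t ∈ U, ∀ i j, ContinuousAt (deriv fun s => toMat (γ s) i j) t := fun t ht i j =>
    ((hcont t ht i j).continuousAt_fderiv one_ne_zero).clm_apply continuousAt_const
  have hc : ∀ t ∈ U, ∀ i j, ContinuousAt (fun s => toMat (γ s) i j) t := fun t ht i j =>
    (hcont t ht i j).continuousAt
  -- The control is arbitrary at break points and is not assumed continuous. Off them it is
  -- recovered from the smooth entries, here as `cos · (sin)' - sin · (cos)'`.
  have hv : ContinuousOn v U := fun t ht => by
    refine ContinuousAt.continuousWithinAt (ContinuousAt.congr (f := fun s =>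
      toMat (γ s) 0 0 * deriv (fun s => toMat (γ s) 1 0) s -
      toMat (γ s) 1 0 * deriv (fun s => toMat (γ s) 0 0) s) ?_ ?_)
    · exact ((hc t ht 0 0).mul (hcd t ht 1 0)).sub ((hc t ht 1 0).mul (hcd t ht 0 0))
    · filter_upwards [hUo.mem_nhds ht] with s hs
      rw [(hd s hs).1.deriv, (hd s hs).2.1.deriv]
      linear_combination v s * hcs s
  have hw : ContinuousOn w U := fun t ht => by
    refine ContinuousAt.continuousWithinAt (ContinuousAt.congr (f := fun s =>
      toMat (γ s) 0 0 * deriv (fun s => toMat (γ s) 0 2) s +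
      toMat (γ s) 1 0 * deriv (fun s => toMat (γ s) 1 2) s) ?_ ?_)
    · exact ((hc t ht 0 0).mul (hcd t ht 0 2)).add ((hc t ht 1 0).mul (hcd t ht 1 2))
    · filter_upwards [hUo.mem_nhds ht] with s hs
      rw [(hd s hs).2.2.1.deriv, (hd s hs).2.2.2.deriv]
      linear_combination w s * hcs s
  have hs : ContinuousOn (fun t => √(v t ^ 2 + w t ^ 2)) U :=
    ((hv.pow 2).add (hw.pow 2)).sqrt
  have hUae : (U : Set ℝ) =ᵐ[volume] Icc 0 T := by
    have h1 : U =ᵐ[volume] Ioo 0 T :=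
      sdiff_null_ae_eq_self (P.finite_toSet.measure_zero volume)
    exact h1.trans Ioo_ae_eq_Icc
  have hmeas : ∀ {f : ℝ → ℝ}, ContinuousOn f U →
      AEStronglyMeasurable f (volume.restrict (Icc 0 T)) := fun hf => by
    rw [← Measure.restrict_congr_set hUae]
    exact hf.aestronglyMeasurable hUo.measurableSet
  have hlen : pathLength T u = ∫⁻ t in Icc 0 T, ENNReal.ofReal (√(v t ^ 2 + w t ^ 2)) := by
    simp only [pathLength, hu, ip_hor]
  -- Finite length is integrability of the speed, which dominates the angular velocity; the angle
  -- can then be defined as a primitive.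
  have hsint : IntegrableOn (fun t => √(v t ^ 2 + w t ^ 2)) (Icc 0 T) := by
    refine ⟨hmeas hs, ?_⟩
    rw [hasFiniteIntegral_iff_ofReal (Filter.Eventually.of_forall fun t => Real.sqrt_nonneg _),
      ← hlen]
    exact hfin.lt_top
  have hvint : IntegrableOn v (Icc 0 T) := Integrable.mono hsint (hmeas hv)
    (Filter.Eventually.of_forall fun t => by
      rw [Real.norm_eq_abs, Real.norm_eq_abs, abs_of_nonneg (Real.sqrt_nonneg _)]
      exact Real.abs_le_sqrt (by nlinarith [sq_nonneg (w t)]))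
  have hT := h.nonneg
  have hprim : ∀ {f : ℝ → ℝ}, ContinuousOn f U → IntegrableOn f (Icc 0 T) →
      ContinuousOn (fun t => ∫ s in (0 : ℝ)..t, f s) (Icc 0 T) ∧
      ∀ t ∈ U, HasDerivAt (fun t => ∫ s in (0 : ℝ)..t, f s) (f t) t := by
    intro f hf hfi
    refine ⟨intervalIntegral.continuousOn_primitive_interval (by rwa [uIcc_of_le hT]) |>.mono
      (by rw [uIcc_of_le hT]), fun t ht => ?_⟩
    refine intervalIntegral.integral_hasDerivAt_right ?_
      (hf.stronglyMeasurableAtFilter hUo t ht) (hf.continuousAt (hUo.mem_nhds ht))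
    rw [intervalIntegrable_iff_integrableOn_Icc_of_le (hUT ht).1]
    exact hfi.mono_set (Icc_subset_Icc_right (hUT ht).2)
  obtain ⟨cτ, dτ⟩ := hprim hs hsint
  obtain ⟨cΦ, dΦ⟩ := hprim hv hvint
  have cΦ' : ContinuousOn (fun t => φ₀ + ∫ s in (0 : ℝ)..t, v s) (Icc 0 T) :=
    continuousOn_const.add cΦ
  have hΦ : ∀ t ∈ Icc 0 T, toMat (γ t) 0 0 = Real.cos (φ₀ + ∫ s in (0 : ℝ)..t, v s) ∧
      toMat (γ t) 1 0 = Real.sin (φ₀ + ∫ s in (0 : ℝ)..t, v s) := by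
    intro t ht
    -- The first column of the rotation and `(cos Φ, sin Φ)` turn at the same rate. Their scalar
    -- product and their determinant are constant, with initial values `1` and `0`, so the two
    -- vectors agree.
    have hA := eq_of_deriv_zero_off_finset (F := fun t =>
      toMat (γ t) 0 0 * Real.cos (φ₀ + ∫ s in (0 : ℝ)..t, v s) +
      toMat (γ t) 1 0 * Real.sin (φ₀ + ∫ s in (0 : ℝ)..t, v s)) P ht.1
      ((((h.continuousOn 0 0).mul (Real.continuous_cos.comp_continuousOn cΦ')).add
        ((h.continuousOn 1 0).mul (Real.continuous_sin.comp_continuousOn cΦ'))).mono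
        (Icc_subset_Icc_right ht.2)) (fun s hs hsP => by
        have hsU : s ∈ U := ⟨⟨hs.1, hs.2.trans_le ht.2⟩, hsP⟩
        refine (((hd s hsU).1.mul ((dΦ s hsU).const_add φ₀).cos).add
          ((hd s hsU).2.1.mul ((dΦ s hsU).const_add φ₀).sin)).congr_deriv ?_
        ring)
    have hB := eq_of_deriv_zero_off_finset (F := fun t =>
      toMat (γ t) 1 0 * Real.cos (φ₀ + ∫ s in (0 : ℝ)..t, v s) -
      toMat (γ t) 0 0 * Real.sin (φ₀ + ∫ s in (0 : ℝ)..t, v s)) P ht.1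
      ((((h.continuousOn 1 0).mul (Real.continuous_cos.comp_continuousOn cΦ')).sub
        ((h.continuousOn 0 0).mul (Real.continuous_sin.comp_continuousOn cΦ'))).mono
        (Icc_subset_Icc_right ht.2)) (fun s hs hsP => by
        have hsU : s ∈ U := ⟨⟨hs.1, hs.2.trans_le ht.2⟩, hsP⟩
        refine (((hd s hsU).2.1.mul ((dΦ s hsU).const_add φ₀).cos).sub
          ((hd s hsU).1.mul ((dΦ s hsU).const_add φ₀).sin)).congr_deriv ?_
        ring)
    simp only [h0, toMat_ofCoord, intervalIntegral.integral_same, add_zero] at hA hB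
    simp only [mat, Matrix.of_apply, Matrix.cons_val', Matrix.cons_val_zero,
      Matrix.cons_val_one] at hA hB
    have e0 := Real.sin_sq_add_cos_sq φ₀
    have e1 := Real.sin_sq_add_cos_sq (φ₀ + ∫ s in (0 : ℝ)..t, v s)
    set Φ := φ₀ + ∫ s in (0 : ℝ)..t, v s
    constructor
    · linear_combination Real.cos Φ * hA - Real.sin Φ * hB + Real.cos Φ * e0 -
        toMat (γ t) 0 0 * e1
    · linear_combination Real.sin Φ * hA + Real.cos Φ * hB + Real.sin Φ * e0 -
        toMat (γ t) 1 0 * e1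
  refine ⟨fun t => ∫ s in (0 : ℝ)..t, √(v s ^ 2 + w s ^ 2), fun t => φ₀ + ∫ s in (0 : ℝ)..t, v s,
    fun t => toMat (γ t) 0 2, fun t => toMat (γ t) 1 2,
    ⟨hT, cτ, cΦ', h.continuousOn 0 2, h.continuousOn 1 2, by simp,
      P, fun t ht htP => ?_⟩, ?_, by simp, by simp [h0, mat], by simp [h0, mat], ?_⟩
  · have htU : t ∈ U := ⟨ht, htP⟩
    refine ⟨v t, w t, dτ t htU, (dΦ t htU).const_add φ₀, ?_, ?_⟩
    · rw [← (hΦ t (hUT htU)).1]; exact (hd t htU).2.2.1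
    · rw [← (hΦ t (hUT htU)).2]; exact (hd t htU).2.2.2
  · beta_reduce
    rw [hlen, intervalIntegral.integral_of_le hT, ← integral_Icc_eq_integral_Ioc,
      integral_eq_lintegral_of_nonneg_ae (Filter.Eventually.of_forall fun t => Real.sqrt_nonneg _)
      (hmeas hs)]
  · obtain ⟨e0, e1⟩ := hΦ T (right_mem_Icc.2 hT)
    obtain ⟨φ, x, y, e⟩ := exists_coord (γ T)
    rw [e, toMat_ofCoord] at e0 e1
    rw [e]
    simp [mat] at e0 e1
    exact toMat_injective (by simp [mat, e0, e1, e])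

/-- The form in which the infimum is used: a strict bound on the distance produces a competitor of
finite length, which can be lifted from the prescribed initial angle. -/
theorem exists_coordPath_of_dist_lt {φ₀ x₀ y₀ L : ℝ} {h : SE2}
    (hL : subRiemannianDist (ofCoord φ₀ x₀ y₀) h < ENNReal.ofReal L) :
    ∃ (T : ℝ) (τ Φ X Y : ℝ → ℝ), IsCoordPath T τ Φ X Y ∧ τ T < L ∧ Φ 0 = φ₀ ∧ X 0 = x₀ ∧
      Y 0 = y₀ ∧ h = ofCoord (Φ T) (X T) (Y T) := by
  simp only [subRiemannianDist, iInf_lt_iff] at hL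
  obtain ⟨T, γ, u, ⟨hγ, h0, hT⟩, hL⟩ := hL
  obtain ⟨τ, Φ, X, Y, hp, hτ, hΦ, hX, hY, hend⟩ := hγ.exists_coordPath hL.ne_top h0
  refine ⟨T, τ, Φ, X, Y, hp, ?_, hΦ, hX, hY, hT ▸ hend⟩
  rw [hτ]
  exact ENNReal.toReal_lt_of_lt_ofReal hL

/-! ### Upper bounds for the distance by smooth curves. -/

theorem contDiff_infty_of_hasDerivAt {f f' : ℝ → ℝ} (h : ∀ t, HasDerivAt f (f' t) t)
    (hf' : ContDiff ℝ ((⊤ : ℕ∞) : WithTop ℕ∞) f') : ContDiff ℝ ((⊤ : ℕ∞) : WithTop ℕ∞) f := by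
  rw [contDiff_infty_iff_deriv]
  refine ⟨fun t => (h t).differentiableAt, ?_⟩
  rwa [show deriv f = f' from funext fun t => (h t).deriv]

/-- A smooth horizontal curve bounds the distance of its end points. -/
theorem subRiemannianDist_le_integral {φ x y v w : ℝ → ℝ}
    (hv : ContDiff ℝ ((⊤ : ℕ∞) : WithTop ℕ∞) v) (hw : ContDiff ℝ ((⊤ : ℕ∞) : WithTop ℕ∞) w)
    (hφ : ∀ t, HasDerivAt φ (v t) t) (hx : ∀ t, HasDerivAt x (w t * Real.cos (φ t)) t)
    (hy : ∀ t, HasDerivAt y (w t * Real.sin (φ t)) t) {s t : ℝ} (hst : s ≤ t) :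
    subRiemannianDist (ofCoord (φ s) (x s) (y s)) (ofCoord (φ t) (x t) (y t)) ≤
      ENNReal.ofReal (∫ r in s..t, √(v r ^ 2 + w r ^ 2)) := by
  have sφ := contDiff_infty_of_hasDerivAt hφ hv
  have sx := contDiff_infty_of_hasDerivAt hx (hw.mul sφ.cos)
  have sy := contDiff_infty_of_hasDerivAt hy (hw.mul sφ.sin)
  have hsm : ∀ i j, ContDiff ℝ ((⊤ : ℕ∞) : WithTop ℕ∞)
      (fun r => toMat (ofCoord (φ (r + s)) (x (r + s)) (y (r + s))) i j) := by
    have hadd : ContDiff ℝ ((⊤ : ℕ∞) : WithTop ℕ∞) (fun r : ℝ => r + s) := by fun_prop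
    intro i j
    fin_cases i <;> fin_cases j <;> simp [mat]
    · exact (sφ.comp hadd).cos
    · exact (sφ.comp hadd).sin.neg
    · exact sx.comp hadd
    · exact (sφ.comp hadd).sin
    · exact (sφ.comp hadd).cos
    · exact sy.comp hadd
    all_goals exact contDiff_const
  have hvel : ∀ r, HasLeftVelocity (fun r => ofCoord (φ (r + s)) (x (r + s)) (y (r + s)))
      (hor (v (r + s)) (w (r + s))) r := fun r =>
    hasLeftVelocity_ofCoord ((hφ (r + s)).comp_add_const r s)
      ((hx (r + s)).comp_add_const r s) ((hy (r + s)).comp_add_const r s)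
  unfold subRiemannianDist
  refine (iInf_le _ (t - s)).trans ?_
  refine (iInf_le _ fun r => ofCoord (φ (r + s)) (x (r + s)) (y (r + s))).trans ?_
  refine (iInf_le _ fun r => hor (v (r + s)) (w (r + s))).trans ?_
  refine (iInf_le _ ⟨⟨by linarith, fun i j => (hsm i j).continuous.continuousOn,
      fun r => hor_mem _ _, ∅, fun a b _ _ _ _ i j => (hsm i j).contDiffOn, fun r _ _ => hvel r⟩,
      by simp, by simp⟩).trans ?_
  · have hcont : Continuous fun r => √(v r ^ 2 + w r ^ 2) :=
      ((hv.continuous.pow 2).add (hw.continuous.pow 2)).sqrt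
    have e := intervalIntegral.integral_comp_add_right (a := 0) (b := t - s)
      (fun r => √(v r ^ 2 + w r ^ 2)) s
    rw [zero_add, sub_add_cancel] at e
    rw [← e, intervalIntegral.integral_of_le (by linarith), ← integral_Icc_eq_integral_Ioc,
      ofReal_integral_eq_lintegral_ofReal]
    · simp only [pathLength, ip_hor, le_refl]
    · exact (hcont.comp (continuous_add_const s)).continuousOn.integrableOn_Icc
    · exact Filter.Eventually.of_forall fun r => Real.sqrt_nonneg _

/-! ### First and second order estimates along coordinate paths. -/

theorem inner_le_mul_sqrt {A B R v w : ℝ} (h : A ^ 2 + B ^ 2 ≤ R ^ 2) (hR : 0 ≤ R) :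
    A * v + B * w ≤ R * √(v ^ 2 + w ^ 2) := by
  have hn := Real.sq_sqrt (add_nonneg (sq_nonneg v) (sq_nonneg w))
  refine (abs_le_of_sq_le_sq' ?_ (mul_nonneg hR (Real.sqrt_nonneg _))).2
  rw [mul_pow, hn]
  nlinarith [sq_nonneg (A * w - B * v), mul_le_mul_of_nonneg_right h
    (add_nonneg (sq_nonneg v) (sq_nonneg w))]

/-- Functions whose derivative along the path is bounded above by a multiple of the speed. -/
theorem IsCoordPath.sub_le {T : ℝ} {τ Φ X Y F : ℝ → ℝ} (h : IsCoordPath T τ Φ X Y) (C : ℝ)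
    (hF : ContinuousOn F (Icc 0 T))
    (hd : ∀ t ∈ Ioo 0 T, ∀ a b, HasDerivAt τ (√(a ^ 2 + b ^ 2)) t → HasDerivAt Φ a t →
      HasDerivAt X (b * Real.cos (Φ t)) t → HasDerivAt Y (b * Real.sin (Φ t)) t →
      ∃ d ≤ C * √(a ^ 2 + b ^ 2), HasDerivAt F d t) : F T - F 0 ≤ C * τ T := by
  obtain ⟨P, hP⟩ := h.hasDerivAt
  have := le_of_deriv_nonpos_off_finset (F := fun t => F t - C * τ t) P h.nonneg
    (hF.sub (continuousOn_const.mul h.continuousOn_length)) fun t ht htP => by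
      obtain ⟨a, b, h1, h2, h3, h4⟩ := hP t ht htP
      obtain ⟨d, hd, hFd⟩ := hd t ht a b h1 h2 h3 h4
      exact ⟨d - C * √(a ^ 2 + b ^ 2), by linarith, hFd.sub (h1.const_mul C)⟩
  simp only [h.length_zero] at this
  linarith

theorem IsCoordPath.length_nonneg {T : ℝ} {τ Φ X Y : ℝ → ℝ} (h : IsCoordPath T τ Φ X Y) :
    0 ≤ τ T := by
  have := h.sub_le (F := fun _ => 0) 1 continuousOn_const fun t _ a b _ _ _ _ =>
    ⟨0, by positivity, hasDerivAt_const _ _⟩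
  linarith

theorem IsCoordPath.length_mem {T t : ℝ} {τ Φ X Y : ℝ → ℝ} (h : IsCoordPath T τ Φ X Y)
    (ht : t ∈ Icc 0 T) : τ t ∈ Icc 0 (τ T) := by
  refine ⟨(h.mono ht.1 ht.2).length_nonneg, ?_⟩
  obtain ⟨P, hP⟩ := h.hasDerivAt
  have := le_of_deriv_nonpos_off_finset (F := fun t => -τ t) P ht.2
    (h.continuousOn_length.neg.mono (Icc_subset_Icc_left ht.1)) fun s hs hsP => by
      obtain ⟨a, b, h1, -⟩ := hP s ⟨ht.1.trans_lt hs.1, hs.2⟩ hsP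
      exact ⟨-√(a ^ 2 + b ^ 2), by simp, h1.fun_neg⟩
  linarith

/-- The sub-Riemannian length is at least the Euclidean distance in coordinates. -/
theorem IsCoordPath.sq_add_sq_le {T : ℝ} {τ Φ X Y : ℝ → ℝ} (h : IsCoordPath T τ Φ X Y) :
    (Φ T - Φ 0) ^ 2 + (X T - X 0) ^ 2 + (Y T - Y 0) ^ 2 ≤ τ T ^ 2 := by
  set A := Φ T - Φ 0
  set B := X T - X 0
  set C := Y T - Y 0
  set R := √(A ^ 2 + B ^ 2 + C ^ 2) with hR
  have hR2 : R ^ 2 = A ^ 2 + B ^ 2 + C ^ 2 := Real.sq_sqrt (by positivity)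
  -- Test with the linear function whose gradient is the total displacement. Its horizontal gradient
  -- is at most `R`, and its increment is `R ^ 2`.
  have := h.sub_le (F := fun t => A * Φ t + B * X t + C * Y t) R
    (((continuousOn_const.mul h.continuousOn_angle).add
      (continuousOn_const.mul h.continuousOn_fst)).add
      (continuousOn_const.mul h.continuousOn_snd)) fun t _ a b _ h2 h3 h4 => by
    refine ⟨A * a + B * (b * Real.cos (Φ t)) + C * (b * Real.sin (Φ t)), ?_,
      ((h2.const_mul A).add (h3.const_mul B)).add (h4.const_mul C)⟩
    have := inner_le_mul_sqrt (A := A) (B := B * Real.cos (Φ t) + C * Real.sin (Φ t)) (v := a)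
      (w := b) (R := R) (by
        rw [hR2]
        nlinarith [sq_nonneg (B * Real.sin (Φ t) - C * Real.cos (Φ t)),
          Real.sin_sq_add_cos_sq (Φ t)]) (Real.sqrt_nonneg _)
    linarith
  have h1 : R ^ 2 ≤ R * τ T := by rw [hR2]; simp only [A, B, C] at *; linarith
  have h0 := h.length_nonneg
  rcases (Real.sqrt_nonneg (A ^ 2 + B ^ 2 + C ^ 2)).eq_or_lt with h2 | h2
  · rw [← hR2, hR, ← h2]; nlinarith
  · have : R ≤ τ T := le_of_mul_le_mul_left (by linarith [sq R]) h2
    rw [← hR2]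
    exact pow_le_pow_left₀ h2.le this 2

theorem IsCoordPath.abs_angle_le {T : ℝ} {τ Φ X Y : ℝ → ℝ} (h : IsCoordPath T τ Φ X Y) :
    |Φ T - Φ 0| ≤ τ T :=
  abs_le_of_sq_le_sq (by
    nlinarith [h.sq_add_sq_le, sq_nonneg (X T - X 0), sq_nonneg (Y T - Y 0)]) h.length_nonneg

/-- The displacement transversal to the initial direction is of second order. -/
theorem IsCoordPath.transversal_le {T : ℝ} {τ Φ X Y : ℝ → ℝ} (h : IsCoordPath T τ Φ X Y) :
    |Real.cos (Φ 0) * (Y T - Y 0) - Real.sin (Φ 0) * (X T - X 0)| ≤ τ T ^ 2 := by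
  have key : ∀ ε : ℝ, |ε| = 1 → ε * (Real.cos (Φ 0) * (Y T - Y 0) -
      Real.sin (Φ 0) * (X T - X 0)) ≤ τ T ^ 2 := by
    intro ε hε
    have := h.sub_le (F := fun t => ε * (Real.cos (Φ 0) * Y t - Real.sin (Φ 0) * X t)) (τ T)
      (continuousOn_const.mul ((continuousOn_const.mul h.continuousOn_snd).sub
        (continuousOn_const.mul h.continuousOn_fst))) fun t ht a b _ h2 h3 h4 => by
      refine ⟨_, ?_, ((h4.const_mul _).sub (h3.const_mul _)).const_mul ε⟩
      have e : ε * (Real.cos (Φ 0) * (b * Real.sin (Φ t)) - Real.sin (Φ 0) * (b * Real.cos (Φ t)))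
          = ε * (b * Real.sin (Φ t - Φ 0)) := by rw [Real.sin_sub]; ring
      rw [e]
      have h5 := (h.mono ht.1.le ht.2.le).abs_angle_le
      have h6 := (h.length_mem (Ioo_subset_Icc_self ht)).2
      -- Transversal motion has speed `|b sin (Φ t - Φ 0)|`, and the angle can turn by at most the
      -- length: this is the extra order.
      have h7 : |Real.sin (Φ t - Φ 0)| ≤ τ T :=
        (Real.abs_sin_le_abs.trans h5).trans h6
      calc ε * (b * Real.sin (Φ t - Φ 0)) ≤ |ε * (b * Real.sin (Φ t - Φ 0))| := le_abs_self _
        _ = |Real.sin (Φ t - Φ 0)| * |b| := by rw [abs_mul, abs_mul, hε]; ring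
        _ ≤ τ T * √(a ^ 2 + b ^ 2) := by
          gcongr
          · exact h.length_nonneg
          · exact Real.abs_le_sqrt (by nlinarith [sq_nonneg a])
    linarith [sq (τ T)]
  rw [abs_le]
  constructor
  · linarith [key (-1) (by simp)]
  · linarith [key 1 (by simp)]

/-! ### Calibration of the normal extremals. -/

theorem sq_add_sq_le_sq (A B : ℝ) : A ^ 2 + B ^ 2 ≤ ((A ^ 2 + B ^ 2 + 1) / 2) ^ 2 := by
  nlinarith [sq_nonneg (A ^ 2 + B ^ 2 - 1)]

theorem angle_eq {A B : ℝ} (hc : Real.cos A = Real.cos B) (hs : Real.sin A = Real.sin B)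
    (h : |A - B| < 2 * Real.pi) : A = B := by
  have h1 : Real.cos (A - B) = 1 := by
    rw [Real.cos_sub, hc, hs]; linarith [Real.sin_sq_add_cos_sq B, sq (Real.cos B), sq (Real.sin B)]
  have := (Real.cos_eq_one_iff_of_lt_of_lt (abs_lt.1 h).1 (abs_lt.1 h).2).1 h1
  linarith

theorem ofCoord_eq {φ x y φ' x' y' : ℝ} (h : ofCoord φ x y = ofCoord φ' x' y') :
    Real.cos φ = Real.cos φ' ∧ Real.sin φ = Real.sin φ' ∧ x = x' ∧ y = y' := by
  have h := congrArg toMat h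
  simp only [toMat_ofCoord] at h
  have e := fun i j => congrFun (congrFun h i) j
  exact ⟨by simpa [mat] using e 0 0, by simpa [mat] using e 1 0, by simpa [mat] using e 0 2,
    by simpa [mat] using e 1 2⟩

theorem abs_sin_sub_self_le_sq (z : ℝ) : |Real.sin z - z| ≤ z ^ 2 := by
  have key : ∀ z : ℝ, 0 ≤ z → |Real.sin z - z| ≤ z ^ 2 := by
    intro z hz
    have h1 := Real.sin_le hz
    rw [abs_of_nonpos (by linarith)]
    rcases le_or_gt z 1 with h | h
    · rcases hz.eq_or_lt with rfl | h0
      · simp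
      · have := Real.sin_gt_sub_cube h0
        nlinarith [mul_pos h0 h0, mul_pos (mul_pos h0 h0) h0]
    · rcases le_or_gt z 2 with h2 | h2
      · have := Real.sin_nonneg_of_nonneg_of_le_pi hz (by linarith [Real.pi_gt_three])
        nlinarith
      · have := Real.neg_one_le_sin z
        nlinarith
  rcases le_total 0 z with h | h
  · exact key z h
  · have := key (-z) (by linarith)
    rw [Real.sin_neg, neg_sq] at this
    rwa [show Real.sin z - z = -(-Real.sin z - -z) by ring, abs_neg]

/-- The Taylor estimate for the potential of the pendulum. -/
theorem potential_taylor (q h δ : ℝ) : (q * Real.cos δ + h * Real.sin δ) ^ 2 / 2 - q ^ 2 / 2 -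
    q * h * δ ≤ 3 / 2 * (q ^ 2 + h ^ 2) * δ ^ 2 := by
  have e1 := abs_sin_sub_self_le_sq (2 * δ)
  have e2 : Real.sin δ ^ 2 ≤ δ ^ 2 := sq_le_sq.2 Real.abs_sin_le_abs
  -- The remainder splits into a `sin² δ` term, bounded by half of `(q² + h²) δ²`, and a `sin 2δ -
  -- 2δ` term, bounded by `(q² + h²) δ²`; hence the factor `3 / 2`.
  have e : (q * Real.cos δ + h * Real.sin δ) ^ 2 / 2 - q ^ 2 / 2 - q * h * δ =
      (h ^ 2 - q ^ 2) / 2 * Real.sin δ ^ 2 + q * h * ((Real.sin (2 * δ) - 2 * δ) / 2) := by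
    rw [Real.sin_two_mul]
    linear_combination q ^ 2 / 2 * Real.sin_sq_add_cos_sq δ
  have e3 : (h ^ 2 - q ^ 2) / 2 * Real.sin δ ^ 2 ≤ (h ^ 2 + q ^ 2) / 2 * δ ^ 2 := by
    nlinarith [sq_nonneg (h * δ), sq_nonneg (q * Real.sin δ), sq_nonneg (q * δ),
      mul_le_mul_of_nonneg_left e2 (sq_nonneg h)]
  have e4 : q * h * ((Real.sin (2 * δ) - 2 * δ) / 2) ≤ (q ^ 2 + h ^ 2) / 2 * (2 * δ ^ 2) := by
    refine (le_abs_self _).trans ?_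
    rw [abs_mul, abs_div, abs_two]
    refine mul_le_mul ?_ (by nlinarith) (by positivity) (by positivity)
    rw [abs_le]
    constructor <;> nlinarith [sq_nonneg (q - h), sq_nonneg (q + h)]
  rw [e]
  linarith

/-- The Hamilton-Jacobi inequality for the quadratic calibration. -/
theorem hamilton_jacobi_le {a b K c φ r : ℝ} (hK : K = 3 * (a ^ 2 + b ^ 2) + 1)
    (h1 : c ^ 2 + (a * Real.cos φ + b * Real.sin φ) ^ 2 = 1) (ψ : ℝ) (hσ : |r| ≤ 1 / (2 * K)) :
    (c ^ 2 - 1 / 2 + (-((a * Real.cos φ + b * Real.sin φ) *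
      (b * Real.cos φ - a * Real.sin φ)) * (ψ - φ) + c * -c) -
      (K * (ψ - φ) ^ 2 + K * r * (2 * (ψ - φ) * -c))) +
    ((c - 2 * K * r * (ψ - φ)) ^ 2 + (a * Real.cos ψ + b * Real.sin ψ) ^ 2) / 2 ≤ 0 := by
  have hK1 : 1 ≤ K := by rw [hK]; nlinarith [sq_nonneg a, sq_nonneg b]
  have hq : a * Real.cos ψ + b * Real.sin ψ = (a * Real.cos (φ) + b * Real.sin (φ)) *
      Real.cos (ψ - φ) + (b * Real.cos (φ) - a * Real.sin (φ)) * Real.sin (ψ - φ) := by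
    rw [Real.cos_sub, Real.sin_sub]
    linear_combination (-(a * Real.cos ψ) - b * Real.sin ψ) * Real.sin_sq_add_cos_sq (φ)
  have hqh : (a * Real.cos (φ) + b * Real.sin (φ)) ^ 2 +
      (b * Real.cos (φ) - a * Real.sin (φ)) ^ 2 = a ^ 2 + b ^ 2 := by
    linear_combination (a ^ 2 + b ^ 2) * Real.sin_sq_add_cos_sq (φ)
  have htay := potential_taylor (a * Real.cos (φ) + b * Real.sin (φ))
    (b * Real.cos (φ) - a * Real.sin (φ)) (ψ - φ)
  rw [← hq, hqh] at htay
  -- This explains `K` and the range of `r`. With `δ = ψ - φ`, the Taylor remainder is at most `(K -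
  -- 1)/2 · δ²` and the square of the extra momentum `2 K r δ` contributes at most `K/2 · δ²`. Both
  -- are absorbed by `-K δ²`, the time derivative of the quadratic term.
  have hm : (2 * K * (r)) ^ 2 ≤ K := by
    have : |2 * K * (r)| ≤ 1 := by
      rw [abs_mul, abs_of_pos (by linarith)]
      calc 2 * K * |r| ≤ 2 * K * (1 / (2 * K)) := by gcongr
        _ = 1 := by field_simp
    nlinarith [sq_abs (2 * K * (r)), abs_nonneg (2 * K * (r))]
  have hm2 := mul_le_mul_of_nonneg_right hm (sq_nonneg (ψ - φ))
  have hK2 : (a ^ 2 + b ^ 2) * (ψ - φ) ^ 2 = (K - 1) / 3 * (ψ - φ) ^ 2 := by rw [hK]; ring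
  have hδ := sq_nonneg (ψ - φ)
  clear hq hqh
  generalize a * Real.cos (φ) + b * Real.sin (φ) = q at *
  generalize b * Real.cos (φ) - a * Real.sin (φ) = h at *
  generalize a * Real.cos ψ + b * Real.sin ψ = B at *
  generalize ψ - φ = δ at *
  linarith

/-- A normal extremal realizes the distance of nearby points. -/
theorem le_subRiemannianDist_of_extremal {a b t₀ : ℝ} {φ x y c : ℝ → ℝ}
    (hc1 : ∀ t, c t ^ 2 + (a * Real.cos (φ t) + b * Real.sin (φ t)) ^ 2 = 1)
    (hφ : ∀ t, HasDerivAt φ (c t) t)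
    (hc : ∀ t, HasDerivAt c (-((a * Real.cos (φ t) + b * Real.sin (φ t)) *
      (b * Real.cos (φ t) - a * Real.sin (φ t)))) t)
    (hx : ∀ t, HasDerivAt x ((a * Real.cos (φ t) + b * Real.sin (φ t)) * Real.cos (φ t)) t)
    (hy : ∀ t, HasDerivAt y ((a * Real.cos (φ t) + b * Real.sin (φ t)) * Real.sin (φ t)) t)
    {K : ℝ} (hK : K = 3 * (a ^ 2 + b ^ 2) + 1) {s t : ℝ} (hs : |s - t₀| ≤ 1 / (2 * K))
    (ht : |t - t₀| ≤ 1 / (2 * K)) (hst : s ≤ t) :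
    ENNReal.ofReal (t - s) ≤
      subRiemannianDist (ofCoord (φ s) (x s) (y s)) (ofCoord (φ t) (x t) (y t)) := by
  have hK1 : 1 ≤ K := by rw [hK]; nlinarith [sq_nonneg a, sq_nonneg b]
  by_contra! hlt
  obtain ⟨T, τ, Φ, X, Y, hp, hL, hΦ0, hX0, hY0, hend⟩ := exists_coordPath_of_dist_lt hlt
  obtain ⟨hce, hse, hXe, hYe⟩ := ofCoord_eq hend
  have hKε : 1 / (2 * K) ≤ 1 / 2 := by gcongr; linarith
  rw [abs_le] at hs ht
  have hc_le : ∀ t, |c t| ≤ 1 := fun t => by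
    have := hc1 t
    have h2 := sq_nonneg (a * Real.cos (φ t) + b * Real.sin (φ t))
    rw [← sq_le_one_iff_abs_le_one]
    linarith
  have hφlip : |φ t - φ s| ≤ 1 * (t - s) := by
    have := Convex.norm_image_sub_le_of_norm_hasDerivWithin_le (f := φ) (f' := c) (C := 1)
      (fun r _ => (hφ r).hasDerivWithinAt) (fun r _ => hc_le r) convex_univ (mem_univ s)
      (mem_univ t)
    simpa [Real.norm_eq_abs, abs_of_nonneg (sub_nonneg.2 hst)] using this
  -- The end points agree as group elements, so the angles agree modulo `2π`. Both are close to `φ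
  -- s`, hence they are equal.
  have hΦe : Φ T = φ t := by
    refine angle_eq hce.symm hse.symm ?_
    have h1 := hp.abs_angle_le
    rw [hΦ0] at h1
    have h2 := abs_sub_le (Φ T) (φ s) (φ t)
    rw [abs_sub_comm (φ s)] at h2
    linarith [Real.pi_gt_three]
  -- `S` makes the calibration grow at rate exactly `1/2` along the extremal, where the terms in `ψ
  -- - φ` vanish.
  obtain ⟨S, -, hS⟩ := exists_primitive (f := fun t => c t ^ 2 - 1 / 2)
    ((continuous_iff_continuousAt.2 fun t => (hc t).continuousAt).pow 2 |>.sub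
      continuous_const) 0
  have hHJ := fun σ ψ (hσ : |σ - t₀| ≤ 1 / (2 * K)) => hamilton_jacobi_le hK (hc1 σ) ψ hσ
  have hfσ : ∀ σ ψ, HasDerivAt (fun σ => S σ + c σ * (ψ - φ σ) - K * (σ - t₀) * (ψ - φ σ) ^ 2)
      (c σ ^ 2 - 1 / 2 + (-((a * Real.cos (φ σ) + b * Real.sin (φ σ)) *
        (b * Real.cos (φ σ) - a * Real.sin (φ σ))) * (ψ - φ σ) + c σ * -c σ) -
        (K * (ψ - φ σ) ^ 2 + K * (σ - t₀) * (2 * (ψ - φ σ) * -c σ))) σ := by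
    intro σ ψ
    have hsub := (hφ σ).const_sub ψ
    refine (((hS σ).add ((hc σ).mul hsub)).sub
      ((((hasDerivAt_id σ).sub_const t₀).const_mul K).mul (hsub.pow 2))).congr_deriv ?_
    simp
  have hcont : ∀ {f f' : ℝ → ℝ}, (∀ t, HasDerivAt f (f' t) t) → Continuous f := fun h =>
    continuous_iff_continuousAt.2 fun t => (h t).continuousAt
  have cS := hcont hS
  have cc := hcont hc
  have cφ := hcont hφ
  have hFc : ContinuousOn (fun r => a * X r + b * Y r + (S (s + τ r) +
      c (s + τ r) * (Φ r - φ (s + τ r)) - K * (s + τ r - t₀) * (Φ r - φ (s + τ r)) ^ 2))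
      (Icc 0 T) := by
    have h5 := hp.continuousOn_angle
    have h6 := hp.continuousOn_fst
    have h7 := hp.continuousOn_snd
    have h8 := hp.continuousOn_length
    clear * - h5 h6 h7 h8 cS cc cφ
    have h1 : ContinuousOn (fun r => s + τ r) (Icc 0 T) := continuousOn_const.add h8
    have h2 : ContinuousOn (fun r => c (s + τ r)) (Icc 0 T) := cc.comp_continuousOn h1
    have h3 : ContinuousOn (fun r => φ (s + τ r)) (Icc 0 T) := cφ.comp_continuousOn h1
    have h4 : ContinuousOn (fun r => S (s + τ r)) (Icc 0 T) := cS.comp_continuousOn h1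
    exact ((continuousOn_const.mul h6).add (continuousOn_const.mul h7)).add
        ((h4.add (h2.mul (h5.sub h3))).sub
        ((continuousOn_const.mul (h1.sub continuousOn_const)).mul ((h5.sub h3).pow 2)))
  -- the calibration does not increase along the competitor
  have hF := hp.sub_le (F := fun r => a * X r + b * Y r + (S (s + τ r) +
    c (s + τ r) * (Φ r - φ (s + τ r)) - K * (s + τ r - t₀) * (Φ r - φ (s + τ r)) ^ 2)) (1 / 2)
    hFc
    fun r hr v w d1 d2 d3 d4 => by
      have hσ : HasDerivAt (fun r => s + τ r) (√(v ^ 2 + w ^ 2)) r := d1.const_add s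
      have e1 : HasDerivAt (fun r => φ (s + τ r)) (c (s + τ r) * √(v ^ 2 + w ^ 2)) r :=
        (hφ (s + τ r)).comp r hσ
      have e2 : HasDerivAt (fun r => c (s + τ r)) (-((a * Real.cos (φ (s + τ r)) +
          b * Real.sin (φ (s + τ r))) * (b * Real.cos (φ (s + τ r)) -
          a * Real.sin (φ (s + τ r)))) * √(v ^ 2 + w ^ 2)) r := (hc (s + τ r)).comp r hσ
      have e3 : HasDerivAt (fun r => S (s + τ r)) ((c (s + τ r) ^ 2 - 1 / 2) *
        √(v ^ 2 + w ^ 2)) r := (hS (s + τ r)).comp r hσ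
      have e4 : HasDerivAt (fun r => Φ r - φ (s + τ r)) (v - c (s + τ r) * √(v ^ 2 + w ^ 2)) r :=
        d2.fun_sub e1
      have e5 := (d3.const_mul a).fun_add (d4.const_mul b)
      have e6 := (e3.fun_add (e2.fun_mul e4)).fun_sub
        (((hσ.sub_const t₀).const_mul K).fun_mul (e4.fun_pow 2))
      refine ⟨_, ?_, e5.fun_add e6⟩
      have hτ := hp.length_mem (Ioo_subset_Icc_self hr)
      have hj := hHJ (s + τ r) (Φ r) (by
        rw [abs_le]; constructor <;> linarith [hτ.1, hτ.2])
      set n := √(v ^ 2 + w ^ 2) with hn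
      set σ := s + τ r
      set A := c σ - 2 * K * (σ - t₀) * (Φ r - φ σ) with hA
      set B := a * Real.cos (Φ r) + b * Real.sin (Φ r) with hB
      -- `A` and `B` are the horizontal derivatives of the calibration. Since `√(A² + B²) ≤ (A² + B²
      -- + 1)/2`, the spatial part grows at most at rate `(A² + B² + 1)/2` per unit length. The
      -- Hamilton-Jacobi inequality `hj` removes `(A² + B²)/2`.
      have hcs := inner_le_mul_sqrt (A := A) (B := B) (R := (A ^ 2 + B ^ 2 + 1) / 2) (v := v)
        (w := w) (sq_add_sq_le_sq A B) (by positivity)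
      have hj2 := mul_le_mul_of_nonneg_right hj (Real.sqrt_nonneg (v ^ 2 + w ^ 2))
      rw [← hn] at hcs hj2
      rw [hA, hB] at hcs hj2
      clear e1 e2 e3 e4 e5 e6 hσ
      simp only [Nat.add_one_sub_one, pow_one, Nat.cast_ofNat]
      linarith
  -- the calibration along the extremal
  have hG := le_of_deriv_nonpos_off_finset (F := fun σ => S σ + c σ * (φ t - φ σ) -
    K * (σ - t₀) * (φ t - φ σ) ^ 2) ∅ (a := s + τ T) (b := t) (by linarith)
    (hcont fun σ => hfσ σ (φ t)).continuousOn fun σ hσ _ => by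
      refine ⟨_, ?_, hfσ σ (φ t)⟩
      have := hHJ σ (φ t) (by
        rw [abs_le]; constructor <;> linarith [hσ.1, hσ.2, hp.length_nonneg])
      have h1 := sq_nonneg (c σ - 2 * K * (σ - t₀) * (φ t - φ σ))
      have h2 := sq_nonneg (a * Real.cos (φ t) + b * Real.sin (φ t))
      linarith
  -- The competitor arrives early, at `s + τ T < t`. By `hG`, waiting at the end point until `t`
  -- does not increase the calibration, so its total gain is less than `(t - s)/2`. The extremal
  -- gains exactly this amount, a contradiction.
  have hE := eq_of_hasDerivAt_zero (f := fun r => a * x r + b * y r + S r - r / 2) (fun r => by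
    refine (((((hx r).const_mul a).add ((hy r).const_mul b)).add (hS r)).sub
      ((hasDerivAt_id r).div_const 2)).congr_deriv ?_
    linear_combination hc1 r) s t
  simp only [hΦ0, hX0, hY0, hp.length_zero, hΦe, ← hXe, ← hYe, add_zero, sub_self, mul_zero,
    zero_pow two_ne_zero, sub_zero] at hF hG hE
  linarith

/-! ### Integral curves of the field are geodesics. -/

/-- A geodesic field curve through the unit has the coordinates of a normal extremal. -/
theorem IsFieldCurve.exists_coord {α β : ℝ} {g : ℝ → SE2} (h0 : g 0 = 1)
    (hg : IsFieldCurve α β g) : ∃ φ x y ω p : ℝ → ℝ,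
    (g = fun t => ofCoord (φ t) (x t) (y t)) ∧ φ 0 = 0 ∧ x 0 = 0 ∧ y 0 = 0 ∧
    ω 0 = 2 * α ∧ p 0 = 2 * β ∧
    (∀ t, Real.sin (ω t / 2) = Real.sin α * Real.cos (φ t) + β * Real.sin (φ t)) ∧
    (∀ t, Real.cos (ω t / 2) = Real.cos α + y t * Real.sin α - β * x t) ∧
    (∀ t, p t / 2 = β * Real.cos (φ t) - Real.sin α * Real.sin (φ t)) ∧
    (∀ t, HasDerivAt φ (Real.cos (ω t / 2)) t) ∧
    (∀ t, HasDerivAt x (Real.sin (ω t / 2) * Real.cos (φ t)) t) ∧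
    (∀ t, HasDerivAt y (Real.sin (ω t / 2) * Real.sin (φ t)) t) ∧
    (∀ t, HasDerivAt ω (p t) t) ∧ ∀ t, HasDerivAt p (-Real.sin (ω t)) t := by
  obtain ⟨φ, x, y, ω, p, hφ0, hx0, hy0, hω0, hp0, h1, h2, h3, hφ, hx, hy, hω, hp⟩ :=
    exists_extremal α β
  exact ⟨φ, x, y, ω, p, hg.unique (isFieldCurve_of_coord h1 h2 hφ hx hy)
    (by rw [h0, hφ0, hx0, hy0, ofCoord_zero]), hφ0, hx0, hy0, hω0, hp0, h1, h2, h3, hφ, hx, hy,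
    hω, hp⟩

theorem existsUnique_fieldCurve (α β : ℝ) : ∃! g : ℝ → SE2, g 0 = 1 ∧ IsFieldCurve α β g := by
  obtain ⟨φ, x, y, ω, p, hφ0, hx0, hy0, hω0, hp0, h1, h2, h3, hφ, hx, hy, hω, hp⟩ :=
    exists_extremal α β
  refine ⟨fun t => ofCoord (φ t) (x t) (y t), ⟨by simp [hφ0, hx0, hy0, ofCoord_zero],
    isFieldCurve_of_coord h1 h2 hφ hx hy⟩, fun h hh => ?_⟩
  exact hh.2.unique (isFieldCurve_of_coord h1 h2 hφ hx hy)
    (by rw [hh.1, hφ0, hx0, hy0, ofCoord_zero])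

/-- Bootstrapping: `ω' = p` and `p' = -sin ω` raise the differentiability of both functions by one
order at a time. -/
theorem contDiff_pendulum {ω p : ℝ → ℝ} (hω : ∀ t, HasDerivAt ω (p t) t)
    (hp : ∀ t, HasDerivAt p (-Real.sin (ω t)) t) :
    ContDiff ℝ ((⊤ : ℕ∞) : WithTop ℕ∞) ω := by
  have dω : deriv ω = p := funext fun t => (hω t).deriv
  have dp : deriv p = fun t => -Real.sin (ω t) := funext fun t => (hp t).deriv
  have key : ∀ n : ℕ, ContDiff ℝ n ω ∧ ContDiff ℝ n p := by
    intro n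
    induction n with
    | zero =>
      exact ⟨contDiff_zero.2 (continuous_iff_continuousAt.2 fun t => (hω t).continuousAt),
        contDiff_zero.2 (continuous_iff_continuousAt.2 fun t => (hp t).continuousAt)⟩
    | succ n ih =>
      push_cast
      rw [contDiff_succ_iff_deriv, contDiff_succ_iff_deriv, dω, dp]
      exact ⟨⟨fun t => (hω t).differentiableAt, by simp, ih.2⟩,
        ⟨fun t => (hp t).differentiableAt, by simp, ih.1.sin.neg⟩⟩
  exact contDiff_infty.2 fun n => (key n).1

/-- A geodesic field curve is locally shortest, for points in increasing order. -/
theorem IsFieldCurve.exists_dist_eq {α β : ℝ} {g : ℝ → SE2} (h0 : g 0 = 1)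
    (hg : IsFieldCurve α β g) (t₀ : ℝ) : ∃ ε > 0, ∀ s ∈ Ioo (t₀ - ε) (t₀ + ε),
    ∀ t ∈ Ioo (t₀ - ε) (t₀ + ε), s ≤ t →
      subRiemannianDist (g s) (g t) = ENNReal.ofReal (t - s) := by
  obtain ⟨φ, x, y, ω, p, rfl, -, -, -, -, -, h1, h2, h3, hφ, hx, hy, hω, hp⟩ :=
    hg.exists_coord h0
  set K := 3 * (Real.sin α ^ 2 + β ^ 2) + 1 with hK
  have hKpos : 0 < K := by positivity
  refine ⟨1 / (2 * K), by positivity, fun s hs t ht hst => le_antisymm ?_ ?_⟩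
  · have hsm := contDiff_pendulum hω hp
    have := subRiemannianDist_le_integral (hsm.div_const 2).cos (hsm.div_const 2).sin hφ hx hy hst
    simpa using this
  · refine le_subRiemannianDist_of_extremal (a := Real.sin α) (b := β) (t₀ := t₀)
      (c := fun t => Real.cos (ω t / 2)) (fun t => ?_) hφ (fun t => ?_) (fun t => ?_) (fun t => ?_)
      hK ?_ ?_ hst
    · rw [← h1]; simp
    · refine ((hω t).div_const 2).cos.congr_deriv ?_
      rw [h3, h1]; ring
    · rw [← h1]; exact hx t
    · rw [← h1]; exact hy t
    · rw [abs_le]; constructor <;> linarith [hs.1, hs.2]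
    · rw [abs_le]; constructor <;> linarith [ht.1, ht.2]

theorem HasLeftVelocity.comp_neg {g : ℝ → SE2} {a b t : ℝ}
    (h : HasLeftVelocity g (hor a b) (-t)) :
    HasLeftVelocity (fun s => g (-s)) (hor (-a) (-b)) t := by
  rw [hasLeftVelocity_iff] at h ⊢
  obtain ⟨h1, h2, h3, h4⟩ := h
  have hn := hasDerivAt_neg t
  exact ⟨(h1.comp t hn).congr_deriv (by ring), (h2.comp t hn).congr_deriv (by ring),
    (h3.comp t hn).congr_deriv (by ring), (h4.comp t hn).congr_deriv (by ring)⟩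

/-- Reversing time negates the velocity. The control is linear in `(cos α, sin α, β)`, and `(α + π,
-β)` negates this triple. -/
theorem IsFieldCurve.comp_neg {α β : ℝ} {g : ℝ → SE2} (hg : IsFieldCurve α β g) :
    IsFieldCurve (α + Real.pi) (-β) fun t => g (-t) := by
  rw [isFieldCurve_iff] at hg ⊢
  intro t
  convert (hg (-t)).comp_neg using 2
  · rw [Real.cos_add_pi, Real.sin_add_pi]; ring
  · rw [Real.sin_add_pi]; ring

theorem IsFieldCurve.isGeodesic {α β : ℝ} {g : ℝ → SE2} (h0 : g 0 = 1)
    (hg : IsFieldCurve α β g) : IsGeodesic g := by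
  intro t₀
  obtain ⟨ε₁, hε₁, h1⟩ := hg.exists_dist_eq h0 t₀
  -- The reversed curve settles the pairs with `t ≤ s`, without appeal to the symmetry of the
  -- distance.
  obtain ⟨ε₂, hε₂, h2⟩ := hg.comp_neg.exists_dist_eq (by simpa using h0) (-t₀)
  have hl := min_le_left ε₁ ε₂
  have hr := min_le_right ε₁ ε₂
  refine ⟨min ε₁ ε₂, lt_min hε₁ hε₂, fun s hs t ht => ?_⟩
  rcases le_total s t with hst | hst
  · rw [abs_of_nonneg (by linarith)]
    exact h1 s ⟨by linarith [hs.1], by linarith [hs.2]⟩ t ⟨by linarith [ht.1], by linarith [ht.2]⟩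
      hst
  · rw [abs_of_nonpos (by linarith)]
    have := h2 (-s) ⟨by linarith [hs.2], by linarith [hs.1]⟩ (-t)
      ⟨by linarith [ht.2], by linarith [ht.1]⟩ (by linarith)
    simp only [neg_neg] at this
    rw [this]
    congr 1
    ring

theorem IsFieldCurve.pendulum {α β : ℝ} {g : ℝ → SE2} (h0 : g 0 = 1)
    (hg : IsFieldCurve α β g) : ∃ φ x y ω : ℝ → ℝ,
    (∀ t, toMat (g t) = mat (φ t) (x t) (y t)) ∧ φ 0 = 0 ∧ x 0 = 0 ∧ y 0 = 0 ∧
    (∀ t, Real.sin (ω t / 2) = Real.sin α * Real.cos (φ t) + β * Real.sin (φ t)) ∧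
    (∀ t, Real.cos (ω t / 2) = Real.cos α + y t * Real.sin α - β * x t) ∧
    (∀ t, HasDerivAt φ (Real.cos (ω t / 2)) t) ∧
    (∀ t, HasDerivAt x (Real.sin (ω t / 2) * Real.cos (φ t)) t) ∧
    (∀ t, HasDerivAt y (Real.sin (ω t / 2) * Real.sin (φ t)) t) ∧
    Differentiable ℝ ω ∧ (∀ t, HasDerivAt (deriv ω) (-Real.sin (ω t)) t) ∧
    ω 0 = 2 * α ∧ deriv ω 0 = 2 * β := by
  obtain ⟨φ, x, y, ω, p, rfl, hφ0, hx0, hy0, hω0, hp0, h1, h2, -, hφ, hx, hy, hω, hp⟩ :=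
    hg.exists_coord h0
  have dω : deriv ω = p := funext fun t => (hω t).deriv
  exact ⟨φ, x, y, ω, fun t => rfl, hφ0, hx0, hy0, h1, h2, hφ, hx, hy,
    fun t => (hω t).differentiableAt, by rw [dω]; exact hp, hω0, by rw [dω]; exact hp0⟩

/-! ### Regularity of shortest curves: Lipschitz coordinates and horizontal velocity. -/

/-- A curve that is shortest on a short interval has coordinates on this interval, with first and
second order estimates. -/
theorem exists_coord_of_dist_eq {g : ℝ → SE2} {T : ℝ} (hT0 : 0 ≤ T) (hT : T ≤ 1 / 2)
    (hd : ∀ s t, 0 ≤ s → s ≤ t → t ≤ T → subRiemannianDist (g s) (g t) = ENNReal.ofReal (t - s)) :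
    ∃ φ x y : ℝ → ℝ, (∀ t ∈ Icc 0 T, g t = ofCoord (φ t) (x t) (y t)) ∧
      (∀ s t, s ≤ t → (φ t - φ s) ^ 2 + (x t - x s) ^ 2 + (y t - y s) ^ 2 ≤ (t - s) ^ 2) ∧
      ∀ s t, s ≤ t → |Real.cos (φ s) * (y t - y s) - Real.sin (φ s) * (x t - x s)| ≤
        (t - s) ^ 2 := by
  obtain ⟨φ₀, x₀, y₀, hg0⟩ := exists_coord (g 0)
  -- Angles are chosen within `1` of the initial one. For a competitor of length less than `1`, the
  -- lifted final angle then differs from the chosen one by less than `3 < 2π`, so no multiple of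
  -- `2π` can intervene.
  have h1 : ∀ t : ℝ, ∃ φ x y : ℝ, t ∈ Icc 0 T → g t = ofCoord φ x y ∧ |φ - φ₀| < 1 := by
    intro t
    by_cases ht : t ∈ Icc 0 T
    · have := hd 0 t le_rfl ht.1 ht.2
      rw [hg0] at this
      obtain ⟨T', τ, Φ, X, Y, hp, hτ, hΦ, hX, hY, hend⟩ := exists_coordPath_of_dist_lt (L := 1)
        (this.trans_lt ((ENNReal.ofReal_lt_ofReal_iff one_pos).2 (by linarith [ht.2])))
      refine ⟨Φ T', X T', Y T', fun _ => ⟨hend, ?_⟩⟩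
      rw [← hΦ]
      exact hp.abs_angle_le.trans_lt hτ
    · exact ⟨0, 0, 0, fun h => absurd h ht⟩
  choose φ x y hco using h1
  have h2 : ∀ s t, 0 ≤ s → s ≤ t → t ≤ T → ∀ L ∈ Ioo (t - s) 1,
      (φ t - φ s) ^ 2 + (x t - x s) ^ 2 + (y t - y s) ^ 2 ≤ L ^ 2 ∧
      |Real.cos (φ s) * (y t - y s) - Real.sin (φ s) * (x t - x s)| ≤ L ^ 2 := by
    intro s t hs hst ht L hL
    obtain ⟨hgs, hφs⟩ := hco s ⟨hs, hst.trans ht⟩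
    obtain ⟨hgt, hφt⟩ := hco t ⟨hs.trans hst, ht⟩
    have h3 := hd s t hs hst ht
    rw [hgs] at h3
    obtain ⟨T', τ, Φ, X, Y, hp, hτ, hΦ, hX, hY, hend⟩ := exists_coordPath_of_dist_lt (L := L)
      (h3.trans_lt ((ENNReal.ofReal_lt_ofReal_iff (by linarith [hL.1])).2 hL.1))
    rw [hgt] at hend
    obtain ⟨hc, hsn, hXe, hYe⟩ := ofCoord_eq hend
    have h4 := hp.abs_angle_le
    have h0 := hp.length_nonneg
    have h5 : φ t = Φ T' := by
      refine angle_eq hc hsn ?_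
      rw [hΦ] at h4
      rw [abs_lt] at *
      rw [abs_le] at h4
      constructor <;> linarith [Real.pi_gt_three, hL.2]
    have h6 := hp.sq_add_sq_le
    have h7 := hp.transversal_le
    rw [hΦ, hX, hY, ← h5, ← hXe, ← hYe] at h6
    rw [hΦ, hX, hY, ← hXe, ← hYe] at h7
    have h8 : τ T' ^ 2 ≤ L ^ 2 := pow_le_pow_left₀ h0 hτ.le 2
    exact ⟨h6.trans h8, h7.trans h8⟩
  have h3 : ∀ s t, 0 ≤ s → s ≤ t → t ≤ T →
      (φ t - φ s) ^ 2 + (x t - x s) ^ 2 + (y t - y s) ^ 2 ≤ (t - s) ^ 2 ∧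
      |Real.cos (φ s) * (y t - y s) - Real.sin (φ s) * (x t - x s)| ≤ (t - s) ^ 2 := by
    intro s t hs hst ht
    have hev : ∀ᶠ L in nhdsWithin (t - s) (Ioi (t - s)), L ∈ Ioo (t - s) 1 :=
      Ioo_mem_nhdsGT (by linarith)
    have hlim : Filter.Tendsto (fun L : ℝ => L ^ 2) (nhdsWithin (t - s) (Ioi (t - s)))
        (nhds ((t - s) ^ 2)) := ((continuous_pow 2).tendsto _).mono_left nhdsWithin_le_nhds
    exact ⟨ge_of_tendsto hlim (hev.mono fun L hL => (h2 s t hs hst ht L hL).1),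
      ge_of_tendsto hlim (hev.mono fun L hL => (h2 s t hs hst ht L hL).2)⟩
  -- Composing with the projection onto `[0, T]`, which is `1`-Lipschitz, extends the estimates to
  -- the whole line.
  let π : ℝ → ℝ := fun t => max 0 (min t T)
  have hπ0 : ∀ t, 0 ≤ π t := fun t => le_max_left _ _
  have hπT : ∀ t, π t ≤ T := fun t => max_le hT0 (min_le_right _ _)
  have hπm : ∀ s t, s ≤ t → π s ≤ π t := fun s t h => max_le_max le_rfl (min_le_min h le_rfl)
  have hπd : ∀ s t, s ≤ t → (π t - π s) ^ 2 ≤ (t - s) ^ 2 := by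
    intro s t h
    refine pow_le_pow_left₀ (sub_nonneg.2 (hπm s t h)) ?_ 2
    simp only [π]
    rcases max_cases 0 (min t T) with h1 | h1 <;> rcases min_cases t T with h2 | h2 <;>
      rcases max_cases 0 (min s T) with h3 | h3 <;> rcases min_cases s T with h4 | h4 <;> linarith
  refine ⟨fun t => φ (π t), fun t => x (π t), fun t => y (π t), fun t ht => ?_,
    fun s t hst => ((h3 _ _ (hπ0 s) (hπm s t hst) (hπT t)).1).trans (hπd s t hst),
    fun s t hst => ((h3 _ _ (hπ0 s) (hπm s t hst) (hπT t)).2).trans (hπd s t hst)⟩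
  have : π t = t := by simp only [π]; rw [min_eq_left ht.2, max_eq_right ht.1]
  beta_reduce
  rw [this]
  exact (hco t ht).1

theorem lipschitzWith_one_of_sq_le {f : ℝ → ℝ}
    (h : ∀ s t, s ≤ t → (f t - f s) ^ 2 ≤ (t - s) ^ 2) : LipschitzWith 1 f := by
  refine LipschitzWith.of_dist_le_mul fun s t => ?_
  rw [Real.dist_eq, Real.dist_eq, NNReal.coe_one, one_mul]
  apply sq_le_sq.1
  rcases le_total s t with hst | hst
  · have := h s t hst
    rwa [← neg_sub, neg_sq, ← neg_sub t s, neg_sq]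
  · exact h t s hst

theorem integral_deriv_of_lipschitzWith {f : ℝ → ℝ} (h : LipschitzWith 1 f) (a b : ℝ) :
    ∫ t in a..b, deriv f t = f b - f a :=
  (h.lipschitzOnWith (s := uIcc a b)).absolutelyContinuousOnInterval.integral_deriv_eq_sub

/-- The velocity of a curve with the first and second order estimates. -/
theorem exists_velocity {φ x y : ℝ → ℝ}
    (h1 : ∀ s t, s ≤ t → (φ t - φ s) ^ 2 + (x t - x s) ^ 2 + (y t - y s) ^ 2 ≤ (t - s) ^ 2)
    (h2 : ∀ s t, s ≤ t → |Real.cos (φ s) * (y t - y s) - Real.sin (φ s) * (x t - x s)| ≤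
      (t - s) ^ 2) : ∃ u w : ℝ → ℝ, Measurable u ∧ Measurable w ∧ (∀ t, u t ^ 2 + w t ^ 2 ≤ 1) ∧
      Continuous φ ∧ (∀ a b, ∫ t in a..b, u t = φ b - φ a) ∧
      (∀ a b, ∫ t in a..b, w t * Real.cos (φ t) = x b - x a) ∧
      ∀ a b, ∫ t in a..b, w t * Real.sin (φ t) = y b - y a := by
  have lφ : LipschitzWith 1 φ := lipschitzWith_one_of_sq_le fun s t h => by
    nlinarith [h1 s t h, sq_nonneg (x t - x s), sq_nonneg (y t - y s)]
  have lx : LipschitzWith 1 x := lipschitzWith_one_of_sq_le fun s t h => by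
    nlinarith [h1 s t h, sq_nonneg (φ t - φ s), sq_nonneg (y t - y s)]
  have ly : LipschitzWith 1 y := lipschitzWith_one_of_sq_le fun s t h => by
    nlinarith [h1 s t h, sq_nonneg (x t - x s), sq_nonneg (φ t - φ s)]
  have cφ := lφ.continuous
  let u := deriv φ
  -- The component of the planar velocity along the heading; the transversal component will vanish
  -- almost everywhere.
  let w := fun t => Real.cos (φ t) * deriv x t + Real.sin (φ t) * deriv y t
  have mu : Measurable u := measurable_deriv φ
  have mw : Measurable w := ((Real.continuous_cos.comp cφ).measurable.mul (measurable_deriv x)).add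
    ((Real.continuous_sin.comp cφ).measurable.mul (measurable_deriv y))
  have hae : ∀ᵐ t, u t ^ 2 + w t ^ 2 ≤ 1 ∧ deriv x t = w t * Real.cos (φ t) ∧
      deriv y t = w t * Real.sin (φ t) := by
    filter_upwards [lφ.ae_differentiableAt_real, lx.ae_differentiableAt_real,
      ly.ae_differentiableAt_real] with t dφ dx dy
    have hslope : ∀ {f : ℝ → ℝ}, DifferentiableAt ℝ f t → Filter.Tendsto
        (fun r => (r - t)⁻¹ * (f r - f t)) (nhdsWithin t (Ioi t)) (nhds (deriv f t)) := fun hf => by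
      have := (hasDerivAt_iff_tendsto_slope.1 hf.hasDerivAt).mono_left
        (nhdsWithin_mono t (s := Ioi t) fun r hr => ne_of_gt hr)
      simpa [slope_fun_def] using this
    have e1 : deriv φ t ^ 2 + deriv x t ^ 2 + deriv y t ^ 2 ≤ 1 := by
      refine le_of_tendsto ((((hslope dφ).pow 2).add ((hslope dx).pow 2)).add ((hslope dy).pow 2))
        (eventually_nhdsWithin_of_forall fun r hr => ?_)
      have hr' : 0 < r - t := sub_pos.2 hr
      have := h1 t r (le_of_lt hr)
      calc _ = ((r - t)⁻¹) ^ 2 * ((φ r - φ t) ^ 2 + (x r - x t) ^ 2 + (y r - y t) ^ 2) := by ring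
        _ ≤ ((r - t)⁻¹) ^ 2 * (r - t) ^ 2 := by gcongr
        _ = 1 := by field_simp
    -- Dividing the quadratic estimate by `r - t` and letting `r` tend to `t` shows that the limit
    -- velocity is horizontal.
    have e2 : |Real.cos (φ t) * deriv y t - Real.sin (φ t) * deriv x t| ≤ 0 := by
      have hz : Filter.Tendsto (fun r => r - t) (nhdsWithin t (Ioi t)) (nhds 0) := by
        have : Filter.Tendsto (fun r : ℝ => r - t) (nhds t) (nhds (t - t)) :=
          (continuous_sub_right t).tendsto t
        rw [sub_self] at this
        exact this.mono_left nhdsWithin_le_nhds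
      refine le_of_tendsto_of_tendsto ((((hslope dy).const_mul _).sub
        ((hslope dx).const_mul _)).abs) hz (eventually_nhdsWithin_of_forall fun r hr => ?_)
      have hr' : 0 < r - t := sub_pos.2 hr
      have := h2 t r (le_of_lt hr)
      calc |Real.cos (φ t) * ((r - t)⁻¹ * (y r - y t)) -
            Real.sin (φ t) * ((r - t)⁻¹ * (x r - x t))|
          = |(r - t)⁻¹ * (Real.cos (φ t) * (y r - y t) - Real.sin (φ t) * (x r - x t))| := by
            exact congrArg abs (by ring)
        _ = (r - t)⁻¹ * |Real.cos (φ t) * (y r - y t) - Real.sin (φ t) * (x r - x t)| := by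
          rw [abs_mul, abs_of_pos (inv_pos.2 hr')]
        _ ≤ (r - t)⁻¹ * (r - t) ^ 2 := by gcongr
        _ = r - t := by field_simp
    have e3 := abs_nonpos_iff.1 e2
    have e4 := Real.sin_sq_add_cos_sq (φ t)
    have ex : deriv x t = w t * Real.cos (φ t) := by
      simp only [w]
      linear_combination -deriv x t * e4 - Real.sin (φ t) * e3
    have ey : deriv y t = w t * Real.sin (φ t) := by
      simp only [w]
      linear_combination -deriv y t * e4 + Real.cos (φ t) * e3
    refine ⟨?_, ex, ey⟩
    have : w t ^ 2 = deriv x t ^ 2 + deriv y t ^ 2 := by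
      rw [ex, ey]; linear_combination -w t ^ 2 * e4
    simp only [u]
    linarith
  -- Setting the velocity to zero off this set of full measure makes the bound hold everywhere and
  -- changes no integral.
  let A : Set ℝ := {t | u t ^ 2 + w t ^ 2 ≤ 1}
  have mA : MeasurableSet A := measurableSet_le ((mu.pow_const 2).add (mw.pow_const 2))
    measurable_const
  have hA : ∀ᵐ t, t ∈ A := hae.mono fun t h => h.1
  refine ⟨A.indicator u, A.indicator w, mu.indicator mA, mw.indicator mA, fun t => ?_, cφ,
    fun a b => ?_, fun a b => ?_, fun a b => ?_⟩
  · by_cases ht : t ∈ A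
    · rw [indicator_of_mem ht, indicator_of_mem ht]; exact ht
    · rw [indicator_of_notMem ht, indicator_of_notMem ht]; norm_num
  · rw [← integral_deriv_of_lipschitzWith lφ]
    refine intervalIntegral.integral_congr_ae (hA.mono fun t ht _ => ?_)
    rw [indicator_of_mem ht]
  · rw [← integral_deriv_of_lipschitzWith lx]
    refine intervalIntegral.integral_congr_ae ((hA.and hae).mono fun t ht _ => ?_)
    rw [indicator_of_mem ht.1, ht.2.2.1]
  · rw [← integral_deriv_of_lipschitzWith ly]
    refine intervalIntegral.integral_congr_ae ((hA.and hae).mono fun t ht _ => ?_)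
    rw [indicator_of_mem ht.1, ht.2.2.2]

/-! ### Competitors with bounded measurable velocity: smooth approximation with fixed end points. -/

theorem intervalIntegrable_of_bounded {f : ℝ → ℝ} (hf : Measurable f) {C : ℝ}
    (hC : ∀ t, |f t| ≤ C) (a b : ℝ) : IntervalIntegrable f volume a b :=
  (intervalIntegrable_const (c := C)).mono_fun hf.aestronglyMeasurable
    (Filter.Eventually.of_forall fun t => by
      simpa only [Real.norm_eq_abs] using (hC t).trans (le_abs_self C))

/-- Bounded measurable functions are approximated by smooth functions in `L¹`. -/
theorem exists_smooth_approx {f : ℝ → ℝ} (hf : Measurable f) {C : ℝ} (hC : ∀ t, |f t| ≤ C)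
    {T : ℝ} (hT : 0 < T) {ε : ℝ} (hε : 0 < ε) : ∃ p : ℝ → ℝ,
    ContDiff ℝ ((⊤ : ℕ∞) : WithTop ℕ∞) p ∧ ∫ t in (0 : ℝ)..T, |f t - p t| ≤ ε := by
  have hfi := intervalIntegrable_of_bounded hf hC 0 T
  have hF : Integrable ((Ioc 0 T).indicator f) :=
    (integrable_indicator_iff measurableSet_Ioc).2
      ((intervalIntegrable_iff_integrableOn_Ioc_of_le hT.le).1 hfi)
  -- Continuous functions are dense in `L¹`, and by Weierstrass polynomials approximate them
  -- uniformly on `[0, T]`.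
  obtain ⟨g, -, hg, hgc, hgi⟩ := hF.exists_hasCompactSupport_integral_sub_le (half_pos hε)
  obtain ⟨p, hp⟩ := exists_polynomial_near_of_continuousOn 0 T g hgc.continuousOn
    (ε / (2 * T)) (by positivity)
  refine ⟨fun t => p.eval t, by simpa using p.contDiff_aeval (𝕜 := ℝ) _, ?_⟩
  have hpc : Continuous fun t => p.eval t := p.continuous
  have h1 : IntervalIntegrable (fun t => |f t - g t|) volume 0 T :=
    (hfi.sub (hgc.intervalIntegrable 0 T)).abs
  calc ∫ t in (0 : ℝ)..T, |f t - p.eval t|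
      ≤ ∫ t in (0 : ℝ)..T, (|f t - g t| + ε / (2 * T)) := by
        refine intervalIntegral.integral_mono_on hT.le
          (hfi.sub (hpc.intervalIntegrable 0 T)).abs (h1.add intervalIntegrable_const) ?_
        intro t ht
        have := hp t ht
        rw [abs_sub_comm] at this
        exact (abs_sub_le _ (g t) _).trans (by linarith)
    _ = (∫ t in (0 : ℝ)..T, |f t - g t|) + ε / 2 := by
        rw [intervalIntegral.integral_add h1 intervalIntegrable_const]
        simp
        field_simp
    _ ≤ ε / 2 + ε / 2 := by
        gcongr
        refine le_trans ?_ hg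
        rw [intervalIntegral.integral_of_le hT.le]
        calc ∫ t in Ioc 0 T, |f t - g t| = ∫ t in Ioc 0 T, ‖(Ioc 0 T).indicator f t - g t‖ := by
              refine setIntegral_congr_fun measurableSet_Ioc fun t ht => ?_
              simp [indicator_of_mem ht]
          _ ≤ ∫ t, ‖(Ioc 0 T).indicator f t - g t‖ :=
              setIntegral_le_integral (hF.sub hgi).norm
                (Filter.Eventually.of_forall fun t => norm_nonneg _)
    _ = ε := by ring

/-- The Gram determinant of `cos ψ` and `sin ψ`. -/
noncomputable def gramDet (T : ℝ) (ψ : ℝ → ℝ) : ℝ :=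
  (∫ t in (0 : ℝ)..T, Real.cos (ψ t) ^ 2) * (∫ t in (0 : ℝ)..T, Real.sin (ψ t) ^ 2) -
    (∫ t in (0 : ℝ)..T, Real.cos (ψ t) * Real.sin (ψ t)) ^ 2

/-- The coefficient of `cos ψ` in the solution of the Gram system. -/
noncomputable def gramCos (T : ℝ) (ψ : ℝ → ℝ) (p q : ℝ) : ℝ :=
  ((∫ t in (0 : ℝ)..T, Real.sin (ψ t) ^ 2) * p -
    (∫ t in (0 : ℝ)..T, Real.cos (ψ t) * Real.sin (ψ t)) * q) / gramDet T ψ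

/-- The coefficient of `sin ψ` in the solution of the Gram system. -/
noncomputable def gramSin (T : ℝ) (ψ : ℝ → ℝ) (p q : ℝ) : ℝ :=
  ((∫ t in (0 : ℝ)..T, Real.cos (ψ t) ^ 2) * q -
    (∫ t in (0 : ℝ)..T, Real.cos (ψ t) * Real.sin (ψ t)) * p) / gramDet T ψ

/-- Cramer's rule. Adding `gramCos · cos ψ + gramSin · sin ψ` to the translational velocity moves
the end point by exactly `(p, q)` and leaves the angle alone. -/
theorem gram_solve {T : ℝ} {ψ : ℝ → ℝ} (hD : gramDet T ψ ≠ 0) (p q : ℝ) :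
    gramCos T ψ p q * (∫ t in (0 : ℝ)..T, Real.cos (ψ t) ^ 2) +
      gramSin T ψ p q * (∫ t in (0 : ℝ)..T, Real.cos (ψ t) * Real.sin (ψ t)) = p ∧
    gramCos T ψ p q * (∫ t in (0 : ℝ)..T, Real.cos (ψ t) * Real.sin (ψ t)) +
      gramSin T ψ p q * (∫ t in (0 : ℝ)..T, Real.sin (ψ t) ^ 2) = q := by
  have e : gramDet T ψ = _ := rfl
  conv at e => rhs; unfold gramDet
  constructor <;> unfold gramCos gramSin <;> field_simp <;> rw [e] <;> ring

section Integrals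

variable {T : ℝ} {ψ w : ℝ → ℝ}

theorem integral_add_gram_mul_cos (hψ : Continuous ψ) (hw : IntervalIntegrable w volume 0 T)
    (c d : ℝ) : ∫ t in (0 : ℝ)..T, (w t + c * Real.cos (ψ t) + d * Real.sin (ψ t)) *
      Real.cos (ψ t) = (∫ t in (0 : ℝ)..T, w t * Real.cos (ψ t)) +
      (c * (∫ t in (0 : ℝ)..T, Real.cos (ψ t) ^ 2) +
      d * (∫ t in (0 : ℝ)..T, Real.cos (ψ t) * Real.sin (ψ t))) := by
  have i1 : IntervalIntegrable (fun t => w t * Real.cos (ψ t)) volume 0 T :=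
    hw.mul_continuousOn (by fun_prop)
  have i2 : IntervalIntegrable (fun t => c * Real.cos (ψ t) ^ 2) volume 0 T :=
    Continuous.intervalIntegrable (by fun_prop) _ _
  have i3 : IntervalIntegrable (fun t => d * (Real.cos (ψ t) * Real.sin (ψ t))) volume 0 T :=
    Continuous.intervalIntegrable (by fun_prop) _ _
  rw [← intervalIntegral.integral_const_mul, ← intervalIntegral.integral_const_mul,
    ← intervalIntegral.integral_add i2 i3, ← intervalIntegral.integral_add i1 (i2.add i3)]
  congr 1
  funext t
  ring

theorem integral_add_gram_mul_sin (hψ : Continuous ψ) (hw : IntervalIntegrable w volume 0 T)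
    (c d : ℝ) : ∫ t in (0 : ℝ)..T, (w t + c * Real.cos (ψ t) + d * Real.sin (ψ t)) *
      Real.sin (ψ t) = (∫ t in (0 : ℝ)..T, w t * Real.sin (ψ t)) +
      (c * (∫ t in (0 : ℝ)..T, Real.cos (ψ t) * Real.sin (ψ t)) +
      d * (∫ t in (0 : ℝ)..T, Real.sin (ψ t) ^ 2)) := by
  have i1 : IntervalIntegrable (fun t => w t * Real.sin (ψ t)) volume 0 T :=
    hw.mul_continuousOn (by fun_prop)
  have i2 : IntervalIntegrable (fun t => c * (Real.cos (ψ t) * Real.sin (ψ t))) volume 0 T :=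
    Continuous.intervalIntegrable (by fun_prop) _ _
  have i3 : IntervalIntegrable (fun t => d * Real.sin (ψ t) ^ 2) volume 0 T :=
    Continuous.intervalIntegrable (by fun_prop) _ _
  rw [← intervalIntegral.integral_const_mul, ← intervalIntegral.integral_const_mul,
    ← intervalIntegral.integral_add i2 i3, ← intervalIntegral.integral_add i1 (i2.add i3)]
  congr 1
  funext t
  ring

/-- For `z = w + c cos ψ + d sin ψ` one has `z² - w² = (z - w)(z + w)` with `z - w` in the span of
`cos ψ` and `sin ψ`. The change of energy is thus expressed by the displacements that `w` and `z`
produce. -/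
theorem integral_add_gram_sq (hψ : Continuous ψ) (hw : IntervalIntegrable w volume 0 T)
    (hw2 : IntervalIntegrable (fun t => w t ^ 2) volume 0 T)
    (c d : ℝ) : ∫ t in (0 : ℝ)..T, (w t + c * Real.cos (ψ t) + d * Real.sin (ψ t)) ^ 2 =
      (∫ t in (0 : ℝ)..T, w t ^ 2) +
      c * ((∫ t in (0 : ℝ)..T, w t * Real.cos (ψ t)) +
        ∫ t in (0 : ℝ)..T, (w t + c * Real.cos (ψ t) + d * Real.sin (ψ t)) * Real.cos (ψ t)) +
      d * ((∫ t in (0 : ℝ)..T, w t * Real.sin (ψ t)) +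
        ∫ t in (0 : ℝ)..T, (w t + c * Real.cos (ψ t) + d * Real.sin (ψ t)) * Real.sin (ψ t)) := by
  have i1 : IntervalIntegrable (fun t => w t * Real.cos (ψ t)) volume 0 T :=
    hw.mul_continuousOn (by fun_prop)
  have i2 : IntervalIntegrable (fun t => w t * Real.sin (ψ t)) volume 0 T :=
    hw.mul_continuousOn (by fun_prop)
  have i0 : IntervalIntegrable (fun t => w t + c * Real.cos (ψ t) + d * Real.sin (ψ t))
      volume 0 T := (hw.add (Continuous.intervalIntegrable (by fun_prop) _ _)).add
    (Continuous.intervalIntegrable (by fun_prop) _ _)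
  have i3 : IntervalIntegrable (fun t => (w t + c * Real.cos (ψ t) + d * Real.sin (ψ t)) *
      Real.cos (ψ t)) volume 0 T := i0.mul_continuousOn (by fun_prop)
  have i4 : IntervalIntegrable (fun t => (w t + c * Real.cos (ψ t) + d * Real.sin (ψ t)) *
      Real.sin (ψ t)) volume 0 T := i0.mul_continuousOn (by fun_prop)
  rw [← intervalIntegral.integral_add i1 i3, ← intervalIntegral.integral_add i2 i4,
    ← intervalIntegral.integral_const_mul, ← intervalIntegral.integral_const_mul,
    ← intervalIntegral.integral_add hw2 ((i1.add i3).const_mul c),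
    ← intervalIntegral.integral_add (hw2.add ((i1.add i3).const_mul c)) ((i2.add i4).const_mul d)]
  congr 1
  funext t
  ring

end Integrals

theorem tendsto_integral_mul_comp {ι : Type*} {l : Filter ι} [l.IsCountablyGenerated] {T : ℝ}
    {ψ : ℝ → ℝ} {Ψ : ι → ℝ → ℝ} (hΨ : ∀ i, Continuous (Ψ i)) (hT : 0 ≤ T)
    (h : ∀ t ∈ Icc 0 T, Filter.Tendsto (fun i => Ψ i t) l (nhds (ψ t))) {w f : ℝ → ℝ}
    (hw : Measurable w) {C : ℝ} (hC : ∀ t, |w t| ≤ C) (hf : Continuous f) (hf1 : ∀ t, |f t| ≤ 1) :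
    Filter.Tendsto (fun i => ∫ t in (0 : ℝ)..T, w t * f (Ψ i t)) l
      (nhds (∫ t in (0 : ℝ)..T, w t * f (ψ t))) := by
  have hC0 : 0 ≤ C := (abs_nonneg _).trans (hC 0)
  refine intervalIntegral.tendsto_integral_filter_of_dominated_convergence (fun _ => C)
    (Filter.Eventually.of_forall fun i =>
      (hw.mul (hf.comp (hΨ i)).measurable).aestronglyMeasurable)
    (Filter.Eventually.of_forall fun i => Filter.Eventually.of_forall fun t _ => ?_)
    intervalIntegrable_const (Filter.Eventually.of_forall fun t ht => ?_)
  · rw [Real.norm_eq_abs, abs_mul]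
    calc |w t| * |f (Ψ i t)| ≤ C * 1 := by gcongr; exacts [hC t, hf1 _]
      _ = C := mul_one C
  · rw [uIoc_of_le hT] at ht
    exact ((hf.tendsto _).comp (h t (Ioc_subset_Icc_self ht))).const_mul _

section GramLimits

variable {ι : Type*} {l : Filter ι} [l.IsCountablyGenerated] {T : ℝ}
    {ψ : ℝ → ℝ} {Ψ : ι → ℝ → ℝ}

theorem tendsto_gram (hΨ : ∀ i, Continuous (Ψ i)) (hT : 0 ≤ T)
    (h : ∀ t ∈ Icc 0 T, Filter.Tendsto (fun i => Ψ i t) l (nhds (ψ t))) :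
    Filter.Tendsto (fun i => ∫ t in (0 : ℝ)..T, Real.cos (Ψ i t) ^ 2) l
      (nhds (∫ t in (0 : ℝ)..T, Real.cos (ψ t) ^ 2)) ∧
    Filter.Tendsto (fun i => ∫ t in (0 : ℝ)..T, Real.cos (Ψ i t) * Real.sin (Ψ i t)) l
      (nhds (∫ t in (0 : ℝ)..T, Real.cos (ψ t) * Real.sin (ψ t))) ∧
    Filter.Tendsto (fun i => ∫ t in (0 : ℝ)..T, Real.sin (Ψ i t) ^ 2) l
      (nhds (∫ t in (0 : ℝ)..T, Real.sin (ψ t) ^ 2)) ∧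
    Filter.Tendsto (fun i => gramDet T (Ψ i)) l (nhds (gramDet T ψ)) := by
  have key : ∀ f : ℝ → ℝ, Continuous f → (∀ t, |f t| ≤ 1) →
      Filter.Tendsto (fun i => ∫ t in (0 : ℝ)..T, f (Ψ i t)) l
      (nhds (∫ t in (0 : ℝ)..T, f (ψ t))) := fun f hf hf1 => by
    have := tendsto_integral_mul_comp hΨ hT h (w := fun _ => 1) (C := 1) measurable_const
      (by simp) hf hf1
    simpa using this
  have h1 := key (fun z => Real.cos z ^ 2) (by fun_prop) fun t => by
    rw [abs_of_nonneg (sq_nonneg _)]; exact Real.cos_sq_le_one t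
  have h2 := key (fun z => Real.cos z * Real.sin z) (by fun_prop) fun t => by
    rw [abs_mul]
    exact mul_le_one₀ (Real.abs_cos_le_one t) (abs_nonneg _) (Real.abs_sin_le_one t)
  have h3 := key (fun z => Real.sin z ^ 2) (by fun_prop) fun t => by
    rw [abs_of_nonneg (sq_nonneg _)]; exact Real.sin_sq_le_one t
  exact ⟨h1, h2, h3, (h1.mul h3).sub (h2.pow 2)⟩

end GramLimits

theorem sqrt_sq_add_sq_le (v z V Z : ℝ) :
    √(V ^ 2 + Z ^ 2) ≤ √(v ^ 2 + z ^ 2) + |V - v| + |Z - z| := by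
  have hs := Real.sq_sqrt (add_nonneg (sq_nonneg v) (sq_nonneg z))
  have h1 : |v| ≤ √(v ^ 2 + z ^ 2) := Real.abs_le_sqrt (by nlinarith [sq_nonneg z])
  have h2 : |z| ≤ √(v ^ 2 + z ^ 2) := Real.abs_le_sqrt (by nlinarith [sq_nonneg v])
  have h0 := Real.sqrt_nonneg (v ^ 2 + z ^ 2)
  rw [Real.sqrt_le_left (by positivity)]
  set s := √(v ^ 2 + z ^ 2)
  have e1 : v * (V - v) ≤ s * |V - v| := (le_abs_self _).trans (by rw [abs_mul]; gcongr)
  have e2 : z * (Z - z) ≤ s * |Z - z| := (le_abs_self _).trans (by rw [abs_mul]; gcongr)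
  have e3 := mul_nonneg (abs_nonneg (V - v)) (abs_nonneg (Z - z))
  nlinarith [sq_abs (V - v), sq_abs (Z - z)]

theorem abs_integral_mul_le {f g : ℝ → ℝ} {T t : ℝ} (ht : t ∈ Icc 0 T)
    (hf : IntervalIntegrable f volume 0 T) (hg : Continuous g) (hg1 : ∀ s, |g s| ≤ 1) :
    |∫ s in (0 : ℝ)..t, f s * g s| ≤ ∫ s in (0 : ℝ)..T, |f s| := by
  have hft : IntervalIntegrable f volume 0 t := hf.mono_set (by
    rw [uIcc_of_le ht.1, uIcc_of_le (ht.1.trans ht.2)]; exact Icc_subset_Icc_right ht.2)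
  calc |∫ s in (0 : ℝ)..t, f s * g s| ≤ ∫ s in (0 : ℝ)..t, |f s * g s| :=
        intervalIntegral.abs_integral_le_integral_abs ht.1
    _ ≤ ∫ s in (0 : ℝ)..t, |f s| := by
        refine intervalIntegral.integral_mono_on ht.1
          (hft.mul_continuousOn hg.continuousOn).abs hft.abs fun s _ => ?_
        rw [abs_mul]
        exact mul_le_of_le_one_right (abs_nonneg _) (hg1 s)
    _ ≤ ∫ s in (0 : ℝ)..T, |f s| :=
        intervalIntegral.integral_mono_interval le_rfl ht.1 ht.2
          (Filter.Eventually.of_forall fun s => abs_nonneg _) hf.abs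

theorem intervalIntegrable_speed {v z : ℝ → ℝ} {C : ℝ} (hv : Measurable v) (hz : Measurable z)
    (hvC : ∀ t, |v t| ≤ C) (hzC : ∀ t, |z t| ≤ C) (a b : ℝ) :
    IntervalIntegrable (fun t => √(v t ^ 2 + z t ^ 2)) volume a b := by
  have hm : Measurable fun t => √(v t ^ 2 + z t ^ 2) :=
    ((hv.pow_const 2).add (hz.pow_const 2)).sqrt
  refine intervalIntegrable_of_bounded hm (C := C + C) (fun t => ?_) a b
  rw [abs_of_nonneg (Real.sqrt_nonneg _)]
  have := sqrt_sq_add_sq_le 0 0 (v t) (z t)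
  simp only [ne_eq, OfNat.ofNat_ne_zero, not_false_eq_true, zero_pow, add_zero,
    Real.sqrt_zero, sub_zero, zero_add] at this
  linarith [hvC t, hzC t]

/-- The distance is bounded by the length of a curve with bounded measurable velocity, if its
angle is not constant. -/
theorem le_integral_of_le_subRiemannianDist {T : ℝ} (hT : 0 < T) {φ₀ x₀ y₀ δ C : ℝ}
    {v z ψ : ℝ → ℝ} (hv : Measurable v) (hz : Measurable z) (hvC : ∀ t, |v t| ≤ C)
    (hzC : ∀ t, |z t| ≤ C) (hψ : ∀ t, ψ t = φ₀ + ∫ s in (0 : ℝ)..t, v s)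
    (hD : gramDet T ψ ≠ 0)
    (hd : ENNReal.ofReal δ ≤ subRiemannianDist (ofCoord φ₀ x₀ y₀) (ofCoord (ψ T)
      (x₀ + ∫ t in (0 : ℝ)..T, z t * Real.cos (ψ t))
      (y₀ + ∫ t in (0 : ℝ)..T, z t * Real.sin (ψ t)))) :
    δ ≤ ∫ t in (0 : ℝ)..T, √(v t ^ 2 + z t ^ 2) := by
  have hvi := fun a b => intervalIntegrable_of_bounded hv hvC a b
  have hzi := fun a b => intervalIntegrable_of_bounded hz hzC a b
  have hmem : T ∈ Icc 0 T := right_mem_Icc.2 hT.le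
  set X := ∫ t in (0 : ℝ)..T, z t * Real.cos (ψ t) with hX
  set Y := ∫ t in (0 : ℝ)..T, z t * Real.sin (ψ t) with hY
  have hε : ∀ n : ℕ, (0 : ℝ) < 1 / ((n : ℝ) + 1) := fun n => by positivity
  have hlim : Filter.Tendsto (fun n : ℕ => 1 / ((n : ℝ) + 1)) Filter.atTop (nhds 0) :=
    tendsto_one_div_add_atTop_nhds_zero_nat
  choose p hps hp using fun n => exists_smooth_approx hv hvC hT (hε n)
  choose q hqs hq using fun n => exists_smooth_approx hz hzC hT (hε n)
  have hpi : ∀ n a b, IntervalIntegrable (p n) volume a b := fun n a b =>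
    (hps n).continuous.intervalIntegrable a b
  have hqi : ∀ n a b, IntervalIntegrable (q n) volume a b := fun n a b =>
    (hqs n).continuous.intervalIntegrable a b
  -- Adding this small constant to the angular velocity makes the final angle exact.
  let k : ℕ → ℝ := fun n => (∫ s in (0 : ℝ)..T, (v s - p n s)) / T
  have hk : ∀ n, T * |k n| ≤ 1 / ((n : ℝ) + 1) := fun n => by
    simp only [k]
    rw [abs_div, abs_of_pos hT, mul_div_cancel₀ _ hT.ne']
    exact (intervalIntegral.abs_integral_le_integral_abs hT.le).trans (hp n)
  let V : ℕ → ℝ → ℝ := fun n t => p n t + k n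
  have hVs : ∀ n, ContDiff ℝ ((⊤ : ℕ∞) : WithTop ℕ∞) (V n) := fun n =>
    (hps n).add contDiff_const
  have hVi : ∀ n a b, IntervalIntegrable (V n) volume a b := fun n a b =>
    (hVs n).continuous.intervalIntegrable a b
  have hV : ∀ n, ∫ s in (0 : ℝ)..T, |V n s - v s| ≤ 2 * (1 / ((n : ℝ) + 1)) := fun n => by
    calc ∫ s in (0 : ℝ)..T, |V n s - v s| ≤ ∫ s in (0 : ℝ)..T, (|v s - p n s| + |k n|) := by
          refine intervalIntegral.integral_mono_on hT.le ((hVi n 0 T).sub (hvi 0 T)).abs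
            (((hvi 0 T).sub (hpi n 0 T)).abs.add intervalIntegrable_const) fun s _ => ?_
          simp only [V]
          rw [show p n s + k n - v s = -(v s - p n s) + k n by ring]
          exact (abs_add_le _ _).trans (by rw [abs_neg])
      _ = (∫ s in (0 : ℝ)..T, |v s - p n s|) + T * |k n| := by
          rw [intervalIntegral.integral_add ((hvi 0 T).sub (hpi n 0 T)).abs
            intervalIntegrable_const]
          simp
      _ ≤ 2 * (1 / ((n : ℝ) + 1)) := by linarith [hp n, hk n]
  let Ψ : ℕ → ℝ → ℝ := fun n t => φ₀ + ∫ s in (0 : ℝ)..t, V n s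
  have hΨd : ∀ n t, HasDerivAt (Ψ n) (V n t) t := fun n t =>
    ((hVs n).continuous.integral_hasStrictDerivAt 0 t).hasDerivAt.const_add φ₀
  have hΨc : ∀ n, Continuous (Ψ n) := fun n =>
    continuous_iff_continuousAt.2 fun t => (hΨd n t).continuousAt
  have hΨs : ∀ n, ContDiff ℝ ((⊤ : ℕ∞) : WithTop ℕ∞) (Ψ n) := fun n =>
    contDiff_infty_of_hasDerivAt (hΨd n) (hVs n)
  have hΨψ : ∀ n, ∀ t ∈ Icc 0 T, |Ψ n t - ψ t| ≤ 2 * (1 / ((n : ℝ) + 1)) := fun n t ht => by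
    have e : Ψ n t - ψ t = ∫ s in (0 : ℝ)..t, (V n s - v s) * 1 := by
      simp only [Ψ, hψ, mul_one]
      rw [intervalIntegral.integral_sub (hVi n 0 t) (hvi 0 t)]
      ring
    rw [e]
    exact (abs_integral_mul_le ht ((hVi n 0 T).sub (hvi 0 T)) continuous_const
      (by simp)).trans (hV n)
  have hΨlim : ∀ t ∈ Icc 0 T, Filter.Tendsto (fun n => Ψ n t) Filter.atTop (nhds (ψ t)) := by
    intro t ht
    rw [tendsto_iff_dist_tendsto_zero]
    refine squeeze_zero (fun n => dist_nonneg) (fun n => hΨψ n t ht) ?_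
    simpa using hlim.const_mul 2
  have hΨT : ∀ n, Ψ n T = ψ T := fun n => by
    simp only [Ψ, V, hψ, k]
    rw [intervalIntegral.integral_add (hpi n 0 T) intervalIntegrable_const,
      intervalIntegral.integral_sub (hvi 0 T) (hpi n 0 T)]
    simp
    field_simp
    ring
  obtain ⟨lC2, lCS, lS2, lD⟩ := tendsto_gram hΨc hT.le hΨlim
  have hres : ∀ f : ℝ → ℝ, Continuous f → (∀ t, |f t| ≤ 1) →
      Filter.Tendsto (fun n => (∫ t in (0 : ℝ)..T, z t * f (ψ t)) -
        ∫ t in (0 : ℝ)..T, q n t * f (Ψ n t)) Filter.atTop (nhds 0) := by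
    intro f hf hf1
    have h1 := tendsto_integral_mul_comp hΨc hT.le hΨlim hz hzC hf hf1
    have h2 : Filter.Tendsto (fun n => ∫ t in (0 : ℝ)..T, (z t - q n t) * f (Ψ n t))
        Filter.atTop (nhds 0) := by
      refine squeeze_zero_norm (fun n => ?_) hlim
      exact (abs_integral_mul_le hmem ((hzi 0 T).sub (hqi n 0 T)) (hf.comp (hΨc n))
        fun s => hf1 _).trans (hq n)
    have h3 := (h1.const_sub (∫ t in (0 : ℝ)..T, z t * f (ψ t))).add h2
    rw [sub_self, add_zero] at h3
    refine h3.congr fun n => ?_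
    have e : ∫ t in (0 : ℝ)..T, (z t - q n t) * f (Ψ n t) =
        (∫ t in (0 : ℝ)..T, z t * f (Ψ n t)) - ∫ t in (0 : ℝ)..T, q n t * f (Ψ n t) := by
      have hfc : ContinuousOn (fun t => f (Ψ n t)) (uIcc 0 T) := (hf.comp (hΨc n)).continuousOn
      rw [← intervalIntegral.integral_sub ((hzi 0 T).mul_continuousOn hfc)
        ((hqi n 0 T).mul_continuousOn hfc)]
      simp only [sub_mul]
    rw [e]; ring
  have lP := hres Real.cos Real.continuous_cos Real.abs_cos_le_one
  have lQ := hres Real.sin Real.continuous_sin Real.abs_sin_le_one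
  -- `P` and `Q` are the errors of the end point, which tend to zero. The Gram determinants converge
  -- to a nonzero limit, so the correcting coefficients `c` and `d` also tend to zero.
  let P : ℕ → ℝ := fun n => X - ∫ t in (0 : ℝ)..T, q n t * Real.cos (Ψ n t)
  let Q : ℕ → ℝ := fun n => Y - ∫ t in (0 : ℝ)..T, q n t * Real.sin (Ψ n t)
  let c : ℕ → ℝ := fun n => gramCos T (Ψ n) (P n) (Q n)
  let d : ℕ → ℝ := fun n => gramSin T (Ψ n) (P n) (Q n)
  have lc : Filter.Tendsto c Filter.atTop (nhds 0) := by
    have := ((lS2.mul lP).sub (lCS.mul lQ)).div lD hD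
    simp only [mul_zero, sub_zero, zero_div] at this
    exact this
  have ld : Filter.Tendsto d Filter.atTop (nhds 0) := by
    have := ((lC2.mul lQ).sub (lCS.mul lP)).div lD hD
    simp only [mul_zero, sub_zero, zero_div] at this
    exact this
  let Z : ℕ → ℝ → ℝ := fun n t => q n t + c n * Real.cos (Ψ n t) + d n * Real.sin (Ψ n t)
  have hZs : ∀ n, ContDiff ℝ ((⊤ : ℕ∞) : WithTop ℕ∞) (Z n) := fun n =>
    ((hqs n).add (contDiff_const.mul (hΨs n).cos)).add (contDiff_const.mul (hΨs n).sin)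
  have hzq : ∀ n, IntervalIntegrable (fun t => |z t - q n t|) volume 0 T := fun n =>
    ((hzi 0 T).sub (hqi n 0 T)).abs
  have hvz := intervalIntegrable_speed hv hz hvC hzC 0 T
  have hbound : ∀ n, gramDet T (Ψ n) ≠ 0 → δ ≤ (∫ t in (0 : ℝ)..T, √(v t ^ 2 + z t ^ 2)) +
      3 * (1 / ((n : ℝ) + 1)) + T * (|c n| + |d n|) := by
    intro n hDn
    obtain ⟨g1, g2⟩ := gram_solve hDn (P n) (Q n)
    obtain ⟨x, hx0, hx⟩ := exists_primitive (f := fun t => Z n t * Real.cos (Ψ n t))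
      ((hZs n).continuous.mul (Real.continuous_cos.comp (hΨc n))) x₀
    obtain ⟨y, hy0, hy⟩ := exists_primitive (f := fun t => Z n t * Real.sin (Ψ n t))
      ((hZs n).continuous.mul (Real.continuous_sin.comp (hΨc n))) y₀
    have hxT : x T = x₀ + X := by
      have := intervalIntegral.integral_eq_sub_of_hasDerivAt (a := 0) (b := T) (fun t _ => hx t)
        (Continuous.intervalIntegrable
          ((hZs n).continuous.mul (Real.continuous_cos.comp (hΨc n))) _ _)
      simp only [Z] at this
      rw [integral_add_gram_mul_cos (hΨc n) (hqi n 0 T), g1, hx0] at this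
      simp only [P] at this
      linarith
    have hyT : y T = y₀ + Y := by
      have := intervalIntegral.integral_eq_sub_of_hasDerivAt (a := 0) (b := T) (fun t _ => hy t)
        (Continuous.intervalIntegrable
          ((hZs n).continuous.mul (Real.continuous_sin.comp (hΨc n))) _ _)
      simp only [Z] at this
      rw [integral_add_gram_mul_sin (hΨc n) (hqi n 0 T), g2, hy0] at this
      simp only [Q] at this
      linarith
    have hle := subRiemannianDist_le_integral (hVs n) (hZs n) (hΨd n) hx hy hT.le
    rw [hΨT, hxT, hyT, hx0, hy0, show Ψ n 0 = φ₀ by simp [Ψ]] at hle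
    have hle2 : δ ≤ ∫ r in (0 : ℝ)..T, √(V n r ^ 2 + Z n r ^ 2) :=
      (ENNReal.ofReal_le_ofReal_iff (intervalIntegral.integral_nonneg hT.le
        fun t _ => Real.sqrt_nonneg _)).1 (hd.trans hle)
    refine hle2.trans ?_
    have hVv : IntervalIntegrable (fun t => |V n t - v t|) volume 0 T :=
      ((hVi n 0 T).sub (hvi 0 T)).abs
    calc ∫ r in (0 : ℝ)..T, √(V n r ^ 2 + Z n r ^ 2)
        ≤ ∫ r in (0 : ℝ)..T, (√(v r ^ 2 + z r ^ 2) + |V n r - v r| + |z r - q n r| +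
            (|c n| + |d n|)) := by
          refine intervalIntegral.integral_mono_on hT.le (Continuous.intervalIntegrable
            (((hVs n).continuous.pow 2).add ((hZs n).continuous.pow 2)).sqrt _ _)
            (((hvz.add hVv).add (hzq n)).add intervalIntegrable_const) fun r _ => ?_
          refine (sqrt_sq_add_sq_le (v r) (z r) _ _).trans ?_
          have e1 : |c n * Real.cos (Ψ n r)| ≤ |c n| := by
            rw [abs_mul]
            exact mul_le_of_le_one_right (abs_nonneg _) (Real.abs_cos_le_one _)
          have e2 : |d n * Real.sin (Ψ n r)| ≤ |d n| := by
            rw [abs_mul]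
            exact mul_le_of_le_one_right (abs_nonneg _) (Real.abs_sin_le_one _)
          have e3 : |Z n r - z r| ≤ |z r - q n r| + (|c n| + |d n|) := by
            rw [show Z n r - z r = -(z r - q n r) + (c n * Real.cos (Ψ n r) +
              d n * Real.sin (Ψ n r)) by simp only [Z]; ring]
            refine (abs_add_le _ _).trans ?_
            rw [abs_neg]
            linarith [abs_add_le (c n * Real.cos (Ψ n r)) (d n * Real.sin (Ψ n r))]
          linarith
      _ = (∫ r in (0 : ℝ)..T, √(v r ^ 2 + z r ^ 2)) + (∫ r in (0 : ℝ)..T, |V n r - v r|) +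
            (∫ r in (0 : ℝ)..T, |z r - q n r|) + T * (|c n| + |d n|) := by
          rw [intervalIntegral.integral_add ((hvz.add hVv).add (hzq n)) intervalIntegrable_const,
            intervalIntegral.integral_add (hvz.add hVv) (hzq n),
            intervalIntegral.integral_add hvz hVv]
          simp [mul_add]
      _ ≤ _ := by linarith [hV n, hq n]
  have hfin : Filter.Tendsto (fun n : ℕ => (∫ t in (0 : ℝ)..T, √(v t ^ 2 + z t ^ 2)) +
      3 * (1 / ((n : ℝ) + 1)) + T * (|c n| + |d n|)) Filter.atTop
      (nhds (∫ t in (0 : ℝ)..T, √(v t ^ 2 + z t ^ 2))) := by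
    have := ((hlim.const_mul 3).const_add (∫ t in (0 : ℝ)..T, √(v t ^ 2 + z t ^ 2))).add
      ((lc.abs.add ld.abs).const_mul T)
    simpa using this
  refine ge_of_tendsto hfin ?_
  filter_upwards [lD.eventually_ne hD] with n hn
  exact hbound n hn

/-! ### Energy minimizers and their translational velocity. -/

/-- The energy of a curve with bounded measurable velocity is at least the squared distance, for
the time parameter that equals the distance. -/
theorem le_energy_of_le_subRiemannianDist {T : ℝ} (hT : 0 < T) {φ₀ x₀ y₀ C : ℝ}
    {v z ψ : ℝ → ℝ} (hv : Measurable v) (hz : Measurable z) (hvC : ∀ t, |v t| ≤ C)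
    (hzC : ∀ t, |z t| ≤ C) (hψ : ∀ t, ψ t = φ₀ + ∫ s in (0 : ℝ)..t, v s)
    (hD : gramDet T ψ ≠ 0)
    (hd : ENNReal.ofReal T ≤ subRiemannianDist (ofCoord φ₀ x₀ y₀) (ofCoord (ψ T)
      (x₀ + ∫ t in (0 : ℝ)..T, z t * Real.cos (ψ t))
      (y₀ + ∫ t in (0 : ℝ)..T, z t * Real.sin (ψ t)))) :
    T ≤ (∫ t in (0 : ℝ)..T, v t ^ 2) + ∫ t in (0 : ℝ)..T, z t ^ 2 := by
  have h := le_integral_of_le_subRiemannianDist hT hv hz hvC hzC hψ hD hd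
  have hsq : ∀ {f : ℝ → ℝ}, Measurable f → (∀ t, |f t| ≤ C) →
      IntervalIntegrable (fun t => f t ^ 2) volume 0 T := fun hf hC =>
    intervalIntegrable_of_bounded (hf.pow_const 2) (C := C ^ 2) (fun t => by
      rw [abs_pow]; exact pow_le_pow_left₀ (abs_nonneg _) (hC t) 2) 0 T
  have h1 := hsq hv hvC
  have h2 := hsq hz hzC
  -- From `n ≤ (1 + n²)/2` and length at least `T` one gets `T ≤ T/2 + E/2` for the energy `E`.
  have h3 : ∫ t in (0 : ℝ)..T, √(v t ^ 2 + z t ^ 2) ≤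
      ∫ t in (0 : ℝ)..T, (1 / 2 + 1 / 2 * (v t ^ 2 + z t ^ 2)) := by
    refine intervalIntegral.integral_mono_on hT.le
      (intervalIntegrable_speed hv hz hvC hzC 0 T) (intervalIntegrable_const.add ((h1.add h2).const_mul _)) fun t _ => ?_
    nlinarith [Real.sq_sqrt (add_nonneg (sq_nonneg (v t)) (sq_nonneg (z t))),
      sq_nonneg (√(v t ^ 2 + z t ^ 2) - 1)]
  rw [intervalIntegral.integral_add intervalIntegrable_const ((h1.add h2).const_mul _),
    intervalIntegral.integral_const_mul, intervalIntegral.integral_add h1 h2] at h3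
  simp only [intervalIntegral.integral_const, sub_zero, smul_eq_mul] at h3
  linarith

/-- The curve with angle `φ` and bounded measurable velocity `u, w` minimizes the energy among the
curves with the same end points. -/
structure IsEnergyMinimizer (T : ℝ) (φ u w : ℝ → ℝ) : Prop where
  pos : 0 < T
  measurable_fst : Measurable u
  measurable_snd : Measurable w
  sq_le : ∀ t, u t ^ 2 + w t ^ 2 ≤ 1
  continuous : Continuous φ
  angle : ∀ t, φ t = φ 0 + ∫ s in (0 : ℝ)..t, u s
  gram : gramDet T φ ≠ 0
  le_energy : ∀ (v z ψ : ℝ → ℝ) (C : ℝ), Measurable v → Measurable z → (∀ t, |v t| ≤ C) →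
    (∀ t, |z t| ≤ C) → (∀ t, ψ t = φ 0 + ∫ s in (0 : ℝ)..t, v s) → gramDet T ψ ≠ 0 →
    ψ T = φ T →
    ∫ t in (0 : ℝ)..T, z t * Real.cos (ψ t) = ∫ t in (0 : ℝ)..T, w t * Real.cos (φ t) →
    ∫ t in (0 : ℝ)..T, z t * Real.sin (ψ t) = ∫ t in (0 : ℝ)..T, w t * Real.sin (φ t) →
    T ≤ (∫ t in (0 : ℝ)..T, v t ^ 2) + ∫ t in (0 : ℝ)..T, z t ^ 2

theorem ae_eq_zero_of_integral_sq {f : ℝ → ℝ} {T : ℝ} (hT : 0 ≤ T)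
    (hf : IntervalIntegrable (fun t => f t ^ 2) volume 0 T)
    (h : ∫ t in (0 : ℝ)..T, f t ^ 2 ≤ 0) : ∀ᵐ t, t ∈ Ioc 0 T → f t = 0 := by
  have h0 : ∫ t in (0 : ℝ)..T, f t ^ 2 = 0 :=
    le_antisymm h (intervalIntegral.integral_nonneg hT fun t _ => sq_nonneg _)
  rw [intervalIntegral.integral_eq_zero_iff_of_le_of_nonneg_ae hT
    (Filter.Eventually.of_forall fun t => sq_nonneg _) hf] at h0
  filter_upwards [ae_imp_of_ae_restrict h0] with t ht hmem
  simpa using ht hmem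

namespace IsEnergyMinimizer

variable {T : ℝ} {φ u w : ℝ → ℝ}

theorem abs_fst_le (h : IsEnergyMinimizer T φ u w) (t : ℝ) : |u t| ≤ 1 := by
  rw [← sq_le_one_iff_abs_le_one]; nlinarith [h.sq_le t, sq_nonneg (w t)]

theorem abs_snd_le (h : IsEnergyMinimizer T φ u w) (t : ℝ) : |w t| ≤ 1 := by
  rw [← sq_le_one_iff_abs_le_one]; nlinarith [h.sq_le t, sq_nonneg (u t)]

theorem intervalIntegrable_sq {f : ℝ → ℝ} (hf : Measurable f) {C : ℝ} (hC : ∀ t, |f t| ≤ C)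
    (a b : ℝ) : IntervalIntegrable (fun t => f t ^ 2) volume a b :=
  intervalIntegrable_of_bounded (hf.pow_const 2) (C := C ^ 2) (fun t => by
    rw [abs_pow]; exact pow_le_pow_left₀ (abs_nonneg _) (hC t) 2) a b

theorem energy_le (h : IsEnergyMinimizer T φ u w) :
    (∫ t in (0 : ℝ)..T, u t ^ 2) + ∫ t in (0 : ℝ)..T, w t ^ 2 ≤ T := by
  have h1 := intervalIntegrable_sq h.measurable_fst h.abs_fst_le 0 T
  have h2 := intervalIntegrable_sq h.measurable_snd h.abs_snd_le 0 T
  rw [← intervalIntegral.integral_add h1 h2]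
  have := intervalIntegral.integral_mono_on h.pos.le (h1.add h2) (intervalIntegrable_const (c := 1))
    fun t _ => h.sq_le t
  simpa using this

/-- The translational velocity is a combination of `cos φ` and `sin φ`. -/
theorem exists_snd_eq (h : IsEnergyMinimizer T φ u w) : ∃ a b : ℝ,
    a = gramCos T φ (∫ t in (0 : ℝ)..T, w t * Real.cos (φ t))
      (∫ t in (0 : ℝ)..T, w t * Real.sin (φ t)) ∧
    b = gramSin T φ (∫ t in (0 : ℝ)..T, w t * Real.cos (φ t))
      (∫ t in (0 : ℝ)..T, w t * Real.sin (φ t)) ∧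
    (∀ᵐ t, t ∈ Ioc 0 T → w t = a * Real.cos (φ t) + b * Real.sin (φ t)) ∧
    T ≤ ∫ t in (0 : ℝ)..T, (u t ^ 2 + w t ^ 2) := by
  set X := ∫ t in (0 : ℝ)..T, w t * Real.cos (φ t) with hX
  set Y := ∫ t in (0 : ℝ)..T, w t * Real.sin (φ t) with hY
  -- `a cos φ + b sin φ` is the orthogonal projection of `w` in `L²(0, T)` to the span of `cos φ`
  -- and `sin φ`. It produces the same displacement, so by minimality its energy is not smaller, and
  -- Pythagoras makes the difference vanish almost everywhere.
  obtain ⟨g1, g2⟩ := gram_solve h.gram X Y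
  set a := gramCos T φ X Y
  set b := gramSin T φ X Y
  have cφ := h.continuous
  have hw := intervalIntegrable_of_bounded h.measurable_snd h.abs_snd_le 0 T
  have hw2 := intervalIntegrable_sq h.measurable_snd h.abs_snd_le 0 T
  have hu2 := intervalIntegrable_sq h.measurable_fst h.abs_fst_le 0 T
  have z1 := integral_add_gram_mul_cos cφ (intervalIntegrable_const (c := (0 : ℝ))) (T := T) a b
  have z2 := integral_add_gram_mul_sin cφ (intervalIntegrable_const (c := (0 : ℝ))) (T := T) a b
  have z3 := integral_add_gram_sq cφ (intervalIntegrable_const (c := (0 : ℝ))) (T := T)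
    (intervalIntegrable_const (c := (0 : ℝ) ^ 2)) a b
  have w1 := integral_add_gram_mul_cos cφ hw (-a) (-b)
  have w2 := integral_add_gram_mul_sin cφ hw (-a) (-b)
  have w3 := integral_add_gram_sq cφ hw hw2 (-a) (-b)
  rw [w1, w2] at w3
  rw [z1, z2] at z3
  simp only [zero_add, zero_mul, intervalIntegral.integral_zero, g1, g2, ne_eq,
    OfNat.ofNat_ne_zero, not_false_eq_true, zero_pow] at z1 z2 z3
  have hmin := h.le_energy u (fun t => a * Real.cos (φ t) + b * Real.sin (φ t)) φ
    (1 + |a| + |b|) h.measurable_fst (Continuous.measurable (by fun_prop))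
    (fun t => (h.abs_fst_le t).trans (by linarith [abs_nonneg a, abs_nonneg b]))
    (fun t => by
      refine (abs_add_le _ _).trans ?_
      rw [abs_mul, abs_mul]
      have e1 := mul_le_of_le_one_right (abs_nonneg a) (Real.abs_cos_le_one (φ t))
      have e2 := mul_le_of_le_one_right (abs_nonneg b) (Real.abs_sin_le_one (φ t))
      linarith) h.angle h.gram rfl z1 z2
  have hen := h.energy_le
  refine ⟨a, b, rfl, rfl, ?_, ?_⟩
  · have hdiff : IntervalIntegrable
        (fun t => (w t + -a * Real.cos (φ t) + -b * Real.sin (φ t)) ^ 2) volume 0 T := by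
      have hc : Continuous fun t => -a * Real.cos (φ t) + -b * Real.sin (φ t) := by fun_prop
      have e : (fun t => (w t + -a * Real.cos (φ t) + -b * Real.sin (φ t)) ^ 2) = fun t =>
          w t ^ 2 + (w t * (2 * (-a * Real.cos (φ t) + -b * Real.sin (φ t))) +
            (-a * Real.cos (φ t) + -b * Real.sin (φ t)) ^ 2) := by
        funext t; ring
      rw [e]
      exact hw2.add ((hw.mul_continuousOn (continuous_const.mul hc).continuousOn).add
        ((hc.pow 2).intervalIntegrable _ _))
    have hz := ae_eq_zero_of_integral_sq h.pos.le hdiff (by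
      rw [w3]
      rw [z3] at hmin
      linear_combination hmin + hen + a * g1 + b * g2)
    filter_upwards [hz] with t ht hmem
    linarith [ht hmem]
  · rw [intervalIntegral.integral_add hu2 hw2]
    have : ∫ t in (0 : ℝ)..T, w t ^ 2 ≥
        ∫ t in (0 : ℝ)..T, (a * Real.cos (φ t) + b * Real.sin (φ t)) ^ 2 := by
      have hpos : 0 ≤ ∫ t in (0 : ℝ)..T, (w t + -a * Real.cos (φ t) + -b * Real.sin (φ t)) ^ 2 :=
        intervalIntegral.integral_nonneg h.pos.le fun t _ => sq_nonneg _
      rw [w3] at hpos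
      rw [z3]
      linear_combination hpos + a * g1 + b * g2
    linarith

end IsEnergyMinimizer

/-! ### First variation of the energy and the Euler-Lagrange equation. -/

theorem hasDerivAt_mul_of_zero {k P : ℝ → ℝ} {P' : ℝ} (hk : ContinuousAt k 0)
    (hP : HasDerivAt P P' 0) (h0 : P 0 = 0) : HasDerivAt (fun h => k h * P h) (k 0 * P') 0 := by
  rw [hasDerivAt_iff_tendsto_slope] at hP ⊢
  refine ((hk.tendsto.mono_left nhdsWithin_le_nhds).mul hP).congr fun h => ?_
  simp only [slope_def_field, h0]
  ring

/-- Differentiation of `∫ w f(φ + h η)` with respect to `h`. -/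
theorem hasDerivAt_integral_mul_comp {T C : ℝ} {φ η w f f' : ℝ → ℝ} (hφ : Continuous φ)
    (hη : Continuous η) (hw : Measurable w) (hC : ∀ t, |w t| ≤ C)
    (hf : ∀ z, HasDerivAt f (f' z) z) (hf' : Continuous f') (hf1 : ∀ z, |f' z| ≤ 1) :
    HasDerivAt (fun h => ∫ t in (0 : ℝ)..T, w t * f (φ t + h * η t))
      (∫ t in (0 : ℝ)..T, w t * (f' (φ t) * η t)) 0 := by
  have hfc : Continuous f := continuous_iff_continuousAt.2 fun z => (hf z).continuousAt
  have hwi := intervalIntegrable_of_bounded hw hC 0 T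
  have := (intervalIntegral.hasDerivAt_integral_of_dominated_loc_of_deriv_le (μ := volume)
    (a := 0) (b := T) (x₀ := (0 : ℝ))
    (F := fun h t => w t * f (φ t + h * η t))
    (F' := fun h t => w t * (f' (φ t + h * η t) * η t)) (s := univ)
    (bound := fun t => C * |η t|) Filter.univ_mem
    (Filter.Eventually.of_forall fun h => (hw.mul (Continuous.measurable (by fun_prop :
      Continuous fun t => f (φ t + h * η t)))).aestronglyMeasurable)
    (hwi.mul_continuousOn (Continuous.continuousOn (by fun_prop)))
    ((hw.mul (Continuous.measurable (by fun_prop :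
      Continuous fun t => f' (φ t + 0 * η t) * η t))).aestronglyMeasurable)
    (Filter.Eventually.of_forall fun t _ h _ => ?_)
    (Continuous.intervalIntegrable (by fun_prop) _ _)
    (Filter.Eventually.of_forall fun t _ h _ => ?_)).2
  · simpa using this
  · rw [Real.norm_eq_abs, abs_mul, abs_mul]
    have e1 := mul_le_of_le_one_left (abs_nonneg (η t)) (hf1 (φ t + h * η t))
    exact mul_le_mul (hC t) e1 (by positivity) ((abs_nonneg _).trans (hC t))
  · have h1 : HasDerivAt (fun h => φ t + h * η t) (η t) h := by
      simpa using ((hasDerivAt_id h).mul_const (η t)).const_add (φ t)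
    exact ((hf _).comp h h1).const_mul (w t)

/-- The inverse of the Gram matrix is symmetric. In the first variation this moves the coefficients
onto factors `P` and `Q` that vanish at zero. -/
theorem gram_symm (T : ℝ) (ψ : ℝ → ℝ) (p q p' q' : ℝ) :
    gramCos T ψ p q * p' + gramSin T ψ p q * q' = gramCos T ψ p' q' * p + gramSin T ψ p' q' * q := by
  unfold gramCos gramSin
  ring

namespace IsEnergyMinimizer

variable {T : ℝ} {φ u w : ℝ → ℝ}

/-- The vanishing of the first variation of the energy. -/
theorem first_variation (h : IsEnergyMinimizer T φ u w) {ξ η : ℝ → ℝ} (hξ : Measurable ξ) {C : ℝ}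
    (hC : ∀ t, |ξ t| ≤ C) (hη : ∀ t, η t = ∫ s in (0 : ℝ)..t, ξ s) (hηT : η T = 0) {a b : ℝ}
    (ha : a = gramCos T φ (∫ t in (0 : ℝ)..T, w t * Real.cos (φ t))
      (∫ t in (0 : ℝ)..T, w t * Real.sin (φ t)))
    (hb : b = gramSin T φ (∫ t in (0 : ℝ)..T, w t * Real.cos (φ t))
      (∫ t in (0 : ℝ)..T, w t * Real.sin (φ t))) :
    (∫ t in (0 : ℝ)..T, u t * ξ t) + a * (∫ t in (0 : ℝ)..T, w t * (Real.sin (φ t) * η t)) -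
      b * (∫ t in (0 : ℝ)..T, w t * (Real.cos (φ t) * η t)) = 0 := by
  set X := ∫ t in (0 : ℝ)..T, w t * Real.cos (φ t) with hX
  set Y := ∫ t in (0 : ℝ)..T, w t * Real.sin (φ t) with hY
  have cφ := h.continuous
  have hw := intervalIntegrable_of_bounded h.measurable_snd h.abs_snd_le
  have hu := intervalIntegrable_of_bounded h.measurable_fst h.abs_fst_le
  have hξi := intervalIntegrable_of_bounded hξ hC
  have hw2 := intervalIntegrable_sq h.measurable_snd h.abs_snd_le 0 T
  have hu2 := intervalIntegrable_sq h.measurable_fst h.abs_fst_le 0 T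
  have hξ2 := intervalIntegrable_sq hξ hC 0 T
  have huξ : IntervalIntegrable (fun t => u t * ξ t) volume 0 T :=
    intervalIntegrable_of_bounded (h.measurable_fst.mul hξ) (C := 1 * C) (fun t => by
      rw [Pi.mul_apply, abs_mul]
      exact mul_le_mul (h.abs_fst_le t) (hC t) (abs_nonneg _) zero_le_one) 0 T
  have cη : Continuous η := by
    rw [show η = fun t => ∫ s in (0 : ℝ)..t, ξ s from funext hη]
    exact intervalIntegral.continuous_primitive hξi 0
  let Ψ : ℝ → ℝ → ℝ := fun r t => φ t + r * η t
  have cΨ : ∀ r, Continuous (Ψ r) := fun r => by fun_prop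
  have hΨ0 : Ψ 0 = φ := by funext t; simp [Ψ]
  have hΨlim : ∀ t ∈ Icc 0 T, Filter.Tendsto (fun r => Ψ r t) (nhds 0) (nhds (φ t)) := by
    intro t _
    have : Continuous fun r => Ψ r t := by fun_prop
    have := this.tendsto 0
    rwa [hΨ0] at this
  obtain ⟨lC2, lCS, lS2, lD⟩ := tendsto_gram cΨ h.pos.le hΨlim
  -- The displacement lost when the angle is varied to `φ + r η` with `w` kept; the Gram correction
  -- restores it.
  let P : ℝ → ℝ := fun r => X - ∫ t in (0 : ℝ)..T, w t * Real.cos (Ψ r t)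
  let Q : ℝ → ℝ := fun r => Y - ∫ t in (0 : ℝ)..T, w t * Real.sin (Ψ r t)
  have hP0 : P 0 = 0 := by simp only [P, hΨ0]; exact sub_self _
  have hQ0 : Q 0 = 0 := by simp only [Q, hΨ0]; exact sub_self _
  have hP : HasDerivAt P (∫ t in (0 : ℝ)..T, w t * (Real.sin (φ t) * η t)) 0 := by
    have := (hasDerivAt_integral_mul_comp (T := T) cφ cη h.measurable_snd h.abs_snd_le
      (fun z => Real.hasDerivAt_cos z) (by fun_prop) (fun z => by
        rw [abs_neg]; exact Real.abs_sin_le_one z)).const_sub X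
    refine this.congr_deriv ?_
    rw [← intervalIntegral.integral_neg]
    congr 1
    funext t
    ring
  have hQ : HasDerivAt Q (-∫ t in (0 : ℝ)..T, w t * (Real.cos (φ t) * η t)) 0 :=
    (hasDerivAt_integral_mul_comp (T := T) cφ cη h.measurable_snd h.abs_snd_le
      (fun z => Real.hasDerivAt_sin z) (by fun_prop) Real.abs_cos_le_one).const_sub Y
  have lX : Filter.Tendsto (fun r => 2 * X - P r) (nhds 0) (nhds (2 * X)) := by
    simpa [hP0] using hP.continuousAt.tendsto.const_sub (2 * X)
  have lY : Filter.Tendsto (fun r => 2 * Y - Q r) (nhds 0) (nhds (2 * Y)) := by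
    simpa [hQ0] using hQ.continuousAt.tendsto.const_sub (2 * Y)
  let kP : ℝ → ℝ := fun r => gramCos T (Ψ r) (2 * X - P r) (2 * Y - Q r)
  let kQ : ℝ → ℝ := fun r => gramSin T (Ψ r) (2 * X - P r) (2 * Y - Q r)
  have kP0 : kP 0 = 2 * a := by
    simp only [kP, hΨ0, hP0, hQ0, ha, gramCos]; ring
  have kQ0 : kQ 0 = 2 * b := by
    simp only [kQ, hΨ0, hP0, hQ0, hb, gramSin]; ring
  have ckP : ContinuousAt kP 0 := by
    have := ((lS2.mul lX).sub (lCS.mul lY)).div lD h.gram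
    have e : ((∫ t in (0 : ℝ)..T, Real.sin (φ t) ^ 2) * (2 * X) -
        (∫ t in (0 : ℝ)..T, Real.cos (φ t) * Real.sin (φ t)) * (2 * Y)) / gramDet T φ = 2 * a := by
      rw [ha, gramCos]
      ring
    rw [e] at this
    rw [ContinuousAt, kP0]
    exact this
  have ckQ : ContinuousAt kQ 0 := by
    have := ((lC2.mul lY).sub (lCS.mul lX)).div lD h.gram
    have e : ((∫ t in (0 : ℝ)..T, Real.cos (φ t) ^ 2) * (2 * Y) -
        (∫ t in (0 : ℝ)..T, Real.cos (φ t) * Real.sin (φ t)) * (2 * X)) / gramDet T φ = 2 * b := by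
      rw [hb, gramSin]
      ring
    rw [e] at this
    rw [ContinuousAt, kQ0]
    exact this
  set A := ∫ t in (0 : ℝ)..T, u t * ξ t with hA
  set B := ∫ t in (0 : ℝ)..T, ξ t ^ 2 with hB
  -- Where the Gram determinant is nonzero, this is the change of energy of the corrected variation,
  -- rewritten by `gram_symm`. It is nonnegative because the original energy is at most `T`.
  let F : ℝ → ℝ := fun r => r * (2 * A) + r ^ 2 * B + kP r * P r + kQ r * Q r
  have hFd : HasDerivAt F (2 * A + 2 * a * (∫ t in (0 : ℝ)..T, w t * (Real.sin (φ t) * η t)) +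
      2 * b * (-∫ t in (0 : ℝ)..T, w t * (Real.cos (φ t) * η t))) 0 := by
    -- Only continuity of `kP` at zero is needed, since `P` vanishes there; the Gram integrals need
    -- not be differentiated.
    have h1 := hasDerivAt_mul_of_zero ckP hP hP0
    have h2 := hasDerivAt_mul_of_zero ckQ hQ hQ0
    rw [kP0] at h1
    rw [kQ0] at h2
    have h3 : HasDerivAt (fun r : ℝ => r * (2 * A) + r ^ 2 * B) (2 * A) 0 := by
      refine (((hasDerivAt_id (0 : ℝ)).mul_const (2 * A)).add
        ((hasDerivAt_pow 2 (0 : ℝ)).mul_const B)).congr_deriv ?_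
      simp
    exact (h3.add h1).add h2
  have hmin : IsLocalMin F 0 := by
    have hF0 : F 0 = 0 := by simp [F, hP0, hQ0]
    filter_upwards [lD.eventually_ne h.gram] with r hr
    rw [hF0]
    obtain ⟨g1, g2⟩ := gram_solve hr (P r) (Q r)
    set c := gramCos T (Ψ r) (P r) (Q r)
    set d := gramSin T (Ψ r) (P r) (Q r)
    have z1 := integral_add_gram_mul_cos (cΨ r) (hw 0 T) c d
    have z2 := integral_add_gram_mul_sin (cΨ r) (hw 0 T) c d
    rw [g1] at z1
    rw [g2] at z2
    have z3 := integral_add_gram_sq (cΨ r) (hw 0 T) hw2 c d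
    have e1 : (∫ t in (0 : ℝ)..T, w t * Real.cos (Ψ r t)) = X - P r := by simp [P]
    have e2 : (∫ t in (0 : ℝ)..T, w t * Real.sin (Ψ r t)) = Y - Q r := by simp [Q]
    rw [e1, sub_add_cancel] at z1
    rw [e2, sub_add_cancel] at z2
    rw [z1, z2, e1, e2] at z3
    have hv2 : ∫ t in (0 : ℝ)..T, (u t + r * ξ t) ^ 2 =
        (∫ t in (0 : ℝ)..T, u t ^ 2) + r * (2 * A) + r ^ 2 * B := by
      rw [hA, hB, ← intervalIntegral.integral_const_mul, ← intervalIntegral.integral_const_mul,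
        ← intervalIntegral.integral_const_mul,
        ← intervalIntegral.integral_add hu2 ((huξ.const_mul 2).const_mul r),
        ← intervalIntegral.integral_add (hu2.add ((huξ.const_mul 2).const_mul r))
          (hξ2.const_mul _)]
      congr 1
      funext t
      ring
    have hC0 : 0 ≤ C := (abs_nonneg _).trans (hC 0)
    have := h.le_energy (fun t => u t + r * ξ t)
      (fun t => w t + c * Real.cos (Ψ r t) + d * Real.sin (Ψ r t)) (Ψ r)
      (1 + |r| * C + |c| + |d|) (h.measurable_fst.add (hξ.const_mul r))
      ((h.measurable_snd.add (Continuous.measurable (by fun_prop))).add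
        (Continuous.measurable (by fun_prop))) (fun t => by
        refine (abs_add_le _ _).trans ?_
        rw [abs_mul]
        have e1 := h.abs_fst_le t
        have e2 := mul_le_mul_of_nonneg_left (hC t) (abs_nonneg r)
        linarith [abs_nonneg c, abs_nonneg d]) (fun t => by
        refine (abs_add_three _ _ _).trans ?_
        rw [abs_mul, abs_mul]
        have e1 := mul_le_of_le_one_right (abs_nonneg c) (Real.abs_cos_le_one (Ψ r t))
        have e2 := mul_le_of_le_one_right (abs_nonneg d) (Real.abs_sin_le_one (Ψ r t))
        have e3 := mul_nonneg (abs_nonneg r) hC0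
        linarith [h.abs_snd_le t]) (fun t => by
        rw [intervalIntegral.integral_add (hu 0 t) ((hξi 0 t).const_mul r),
          intervalIntegral.integral_const_mul, ← hη, ← add_assoc, ← h.angle])
      hr (by simp [Ψ, hηT]) z1 z2
    rw [hv2, z3] at this
    have hen := h.energy_le
    have hs := gram_symm T (Ψ r) (P r) (Q r) (2 * X - P r) (2 * Y - Q r)
    change c * (2 * X - P r) + d * (2 * Y - Q r) = kP r * P r + kQ r * Q r at hs
    simp only [F]
    linear_combination this + hen + hs
  have := hmin.hasDerivAt_eq_zero hFd
  linarith

/-- The rotational velocity satisfies the integrated Euler-Lagrange equation. -/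
theorem exists_fst_eq (h : IsEnergyMinimizer T φ u w) : ∃ a b k : ℝ,
    (∀ᵐ t, t ∈ Ioc 0 T → w t = a * Real.cos (φ t) + b * Real.sin (φ t)) ∧
    (∀ᵐ t, t ∈ Ioc 0 T → u t = k - ∫ s in (0 : ℝ)..t, (a * Real.cos (φ s) + b * Real.sin (φ s)) *
      (b * Real.cos (φ s) - a * Real.sin (φ s))) ∧
    T ≤ ∫ t in (0 : ℝ)..T, (u t ^ 2 + w t ^ 2) := by
  obtain ⟨a, b, ha, hb, hae, hT⟩ := h.exists_snd_eq
  have cφ := h.continuous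
  set m : ℝ → ℝ := fun s => (a * Real.cos (φ s) + b * Real.sin (φ s)) *
    (b * Real.cos (φ s) - a * Real.sin (φ s)) with hm
  have cm : Continuous m := by fun_prop
  set N : ℝ → ℝ := fun t => ∫ s in (0 : ℝ)..t, m s with hN
  have dN : ∀ t, HasDerivAt N (m t) t := fun t => (cm.integral_hasStrictDerivAt 0 t).hasDerivAt
  have cN : Continuous N := continuous_iff_continuousAt.2 fun t => (dN t).continuousAt
  have hT0 := h.pos
  have hu := intervalIntegrable_of_bounded h.measurable_fst h.abs_fst_le
  have hw := intervalIntegrable_of_bounded h.measurable_snd h.abs_snd_le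
  -- The du Bois-Reymond argument: `k` is the mean of `u + N`, so `ξ = u + N - k` is an admissible
  -- variation. The first variation, integrated by parts, says that `u + N` is orthogonal to `ξ`;
  -- constants are too, whence `∫ ξ² = 0`.
  let k : ℝ := (∫ t in (0 : ℝ)..T, (u t + N t)) / T
  let ξ : ℝ → ℝ := (Ioc 0 T).indicator fun t => u t + N t - k
  have mξ : Measurable ξ :=
    ((h.measurable_fst.add cN.measurable).sub_const k).indicator measurableSet_Ioc
  obtain ⟨M, hM⟩ := isCompact_Icc.exists_bound_of_continuousOn (s := Icc 0 T) cN.continuousOn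
  have hM0 : 0 ≤ M := (norm_nonneg _).trans (hM 0 (left_mem_Icc.2 hT0.le))
  have hξC : ∀ t, |ξ t| ≤ 1 + M + |k| := by
    intro t
    by_cases ht : t ∈ Ioc 0 T
    · simp only [ξ, indicator_of_mem ht]
      have h1 := hM t (Ioc_subset_Icc_self ht)
      rw [Real.norm_eq_abs] at h1
      have h2 := abs_sub (u t + N t) k
      have h3 := abs_add_le (u t) (N t)
      linarith [h.abs_fst_le t]
    · simp only [ξ, indicator_of_notMem ht, abs_zero]
      positivity
  have hξi := intervalIntegrable_of_bounded mξ hξC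
  have hξeq : ∀ f : ℝ → ℝ, ∫ t in (0 : ℝ)..T, f t * ξ t =
      ∫ t in (0 : ℝ)..T, f t * (u t + N t - k) := fun f => by
    refine intervalIntegral.integral_congr_ae (Filter.Eventually.of_forall fun t ht => ?_)
    rw [uIoc_of_le hT0.le] at ht
    simp only [ξ, indicator_of_mem ht]
  have hNi := cN.intervalIntegrable (μ := volume) 0 T
  have hξ0 : ∫ t in (0 : ℝ)..T, ξ t = 0 := by
    have := hξeq fun _ => 1
    simp only [one_mul] at this
    rw [this, intervalIntegral.integral_sub ((hu 0 T).add hNi) intervalIntegrable_const]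
    simp [k]
    field_simp
    ring
  set η : ℝ → ℝ := fun t => ∫ s in (0 : ℝ)..t, ξ s with hη
  have cη : Continuous η := intervalIntegral.continuous_primitive hξi 0
  have hvar := h.first_variation mξ hξC (η := η) (fun t => rfl) hξ0 ha hb
  have e1 : a * (∫ t in (0 : ℝ)..T, w t * (Real.sin (φ t) * η t)) -
      b * (∫ t in (0 : ℝ)..T, w t * (Real.cos (φ t) * η t)) =
      -∫ t in (0 : ℝ)..T, m t * η t := by
    have i1 : IntervalIntegrable (fun t => w t * (Real.sin (φ t) * η t)) volume 0 T :=
      (hw 0 T).mul_continuousOn (Continuous.continuousOn (by fun_prop))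
    have i2 : IntervalIntegrable (fun t => w t * (Real.cos (φ t) * η t)) volume 0 T :=
      (hw 0 T).mul_continuousOn (Continuous.continuousOn (by fun_prop))
    rw [← intervalIntegral.integral_const_mul, ← intervalIntegral.integral_const_mul,
      ← intervalIntegral.integral_sub (i1.const_mul a) (i2.const_mul b),
      ← intervalIntegral.integral_neg]
    refine intervalIntegral.integral_congr_ae ?_
    filter_upwards [hae] with t ht hmem
    rw [uIoc_of_le hT0.le] at hmem
    rw [ht hmem]
    simp only [hm]
    ring
  have acN : AbsolutelyContinuousOnInterval N 0 T :=
    (cm.intervalIntegrable 0 T).absolutelyContinuousOnInterval_intervalIntegral (by simp)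
  have acη : AbsolutelyContinuousOnInterval η 0 T :=
    (hξi 0 T).absolutelyContinuousOnInterval_intervalIntegral (by simp)
  have hparts := acN.integral_deriv_mul_eq_sub acη
  have e2 : ∫ t in (0 : ℝ)..T, deriv N t * η t + N t * deriv η t =
      (∫ t in (0 : ℝ)..T, m t * η t) + ∫ t in (0 : ℝ)..T, N t * ξ t := by
    have i1 : IntervalIntegrable (fun t => m t * η t) volume 0 T :=
      (cm.mul cη).intervalIntegrable 0 T
    have i2 : IntervalIntegrable (fun t => N t * ξ t) volume 0 T :=
      (hξi 0 T).continuousOn_mul cN.continuousOn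
    rw [← intervalIntegral.integral_add i1 i2]
    refine intervalIntegral.integral_congr_ae ?_
    filter_upwards [(hξi 0 T).ae_hasDerivAt_integral] with t ht hmem
    rw [(dN t).deriv, (ht (uIoc_subset_uIcc hmem) 0 (by simp)).deriv]
  have hηT : η T = 0 := hξ0
  have hη0 : η 0 = 0 := by simp [hη]
  rw [e2, hηT, hη0, mul_zero, mul_zero, sub_zero] at hparts
  have i3 : IntervalIntegrable (fun t => u t * ξ t) volume 0 T :=
    intervalIntegrable_of_bounded (h.measurable_fst.mul mξ) (C := 1 * (1 + M + |k|)) (fun t => by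
      rw [Pi.mul_apply, abs_mul]
      exact mul_le_mul (h.abs_fst_le t) (hξC t) (abs_nonneg _) zero_le_one) 0 T
  have i4 : IntervalIntegrable (fun t => N t * ξ t) volume 0 T :=
    (hξi 0 T).continuousOn_mul cN.continuousOn
  have hsq : ∫ t in (0 : ℝ)..T, ξ t ^ 2 = 0 := by
    have e3 : ∫ t in (0 : ℝ)..T, ξ t ^ 2 =
        ∫ t in (0 : ℝ)..T, (u t * ξ t + N t * ξ t - k * ξ t) := by
      refine intervalIntegral.integral_congr_ae (Filter.Eventually.of_forall fun t ht => ?_)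
      rw [uIoc_of_le hT0.le] at ht
      simp only [ξ, indicator_of_mem ht]
      ring
    rw [e3, intervalIntegral.integral_sub (i3.add i4) ((hξi 0 T).const_mul k),
      intervalIntegral.integral_add i3 i4, intervalIntegral.integral_const_mul, hξ0]
    linarith
  have hz := ae_eq_zero_of_integral_sq hT0.le (intervalIntegrable_sq mξ hξC 0 T) hsq.le
  refine ⟨a, b, k, hae, ?_, hT⟩
  filter_upwards [hz] with t ht hmem
  have := ht hmem
  simp only [ξ, indicator_of_mem hmem] at this
  change u t = k - N t
  linarith

end IsEnergyMinimizer

/-- If `v` agrees almost everywhere on `[0, T]` with a continuous function `f`, a primitive of `v`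
is differentiable with derivative `f` inside. -/
theorem hasDerivAt_of_ae_eq {F v f : ℝ → ℝ} {T : ℝ} (hF : ∀ t, F t = F 0 + ∫ s in (0 : ℝ)..t, v s)
    (hf : Continuous f) (hae : ∀ᵐ t, t ∈ Ioc 0 T → v t = f t) {t : ℝ} (ht : t ∈ Ioo 0 T) :
    HasDerivAt F (f t) t := by
  refine (((hf.integral_hasStrictDerivAt 0 t).hasDerivAt).const_add (F 0)).congr_of_eventuallyEq ?_
  filter_upwards [isOpen_Ioo.mem_nhds ht] with s hs
  rw [hF s]
  congr 1
  refine intervalIntegral.integral_congr_ae ?_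
  filter_upwards [hae] with r hr hmem
  rw [uIoc_of_le hs.1.le] at hmem
  exact hr ⟨hmem.1, hmem.2.trans hs.2.le⟩

/-- Velocities of energy minimizers have the form of the geodesic field. -/
theorem IsEnergyMinimizer.exists_hasDerivAt {T : ℝ} {φ u w x y : ℝ → ℝ}
    (h : IsEnergyMinimizer T φ u w)
    (hx : ∀ t, x t = x 0 + ∫ s in (0 : ℝ)..t, w s * Real.cos (φ s))
    (hy : ∀ t, y t = y 0 + ∫ s in (0 : ℝ)..t, w s * Real.sin (φ s)) :
    ∃ κ a b : ℝ, ∀ t ∈ Ioo 0 T, HasDerivAt φ (κ + a * y t - b * x t) t ∧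
      HasDerivAt x ((a * Real.cos (φ t) + b * Real.sin (φ t)) * Real.cos (φ t)) t ∧
      HasDerivAt y ((a * Real.cos (φ t) + b * Real.sin (φ t)) * Real.sin (φ t)) t ∧
      (κ + a * y t - b * x t) ^ 2 + (a * Real.cos (φ t) + b * Real.sin (φ t)) ^ 2 = 1 := by
  obtain ⟨a, b, k, hw, hu, hT⟩ := h.exists_fst_eq
  have cφ := h.continuous
  have hT0 := h.pos
  have hwi := intervalIntegrable_of_bounded h.measurable_snd h.abs_snd_le
  set U : ℝ → ℝ := fun t => k - ∫ s in (0 : ℝ)..t, (a * Real.cos (φ s) + b * Real.sin (φ s)) *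
      (b * Real.cos (φ s) - a * Real.sin (φ s)) with hU
  set W : ℝ → ℝ := fun t => a * Real.cos (φ t) + b * Real.sin (φ t) with hW
  have cW : Continuous W := by fun_prop
  have dU : ∀ t, HasDerivAt U (-(W t * (b * Real.cos (φ t) - a * Real.sin (φ t)))) t := fun t =>
    ((Continuous.integral_hasStrictDerivAt (f := fun s => W s * (b * Real.cos (φ s) -
      a * Real.sin (φ s))) (by fun_prop) 0 t).hasDerivAt).const_sub k
  have cU : Continuous U := continuous_iff_continuousAt.2 fun t => (dU t).continuousAt
  have cx : Continuous x := by
    rw [show x = fun t => x 0 + ∫ s in (0 : ℝ)..t, w s * Real.cos (φ s) from funext hx]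
    exact continuous_const.add (intervalIntegral.continuous_primitive (fun p q =>
      (hwi p q).mul_continuousOn (Continuous.continuousOn (by fun_prop))) 0)
  have cy : Continuous y := by
    rw [show y = fun t => y 0 + ∫ s in (0 : ℝ)..t, w s * Real.sin (φ s) from funext hy]
    exact continuous_const.add (intervalIntegral.continuous_primitive (fun p q =>
      (hwi p q).mul_continuousOn (Continuous.continuousOn (by fun_prop))) 0)
  have dφ : ∀ t ∈ Ioo 0 T, HasDerivAt φ (U t) t := fun t ht => hasDerivAt_of_ae_eq h.angle cU hu ht
  have dx : ∀ t ∈ Ioo 0 T, HasDerivAt x (W t * Real.cos (φ t)) t := fun t ht =>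
    hasDerivAt_of_ae_eq (f := fun t => W t * Real.cos (φ t)) hx (by fun_prop)
      (by filter_upwards [hw] with s hs hm; rw [hs hm]) ht
  have dy : ∀ t ∈ Ioo 0 T, HasDerivAt y (W t * Real.sin (φ t)) t := fun t ht =>
    hasDerivAt_of_ae_eq (f := fun t => W t * Real.sin (φ t)) hy (by fun_prop)
      (by filter_upwards [hw] with s hs hm; rw [hs hm]) ht
  -- Conservation of the Hamiltonian: with `h = b cos φ - a sin φ` one has `U' = -W h` and `W' = U
  -- h`.
  have hE : ∀ t ∈ Icc 0 T, U t ^ 2 + W t ^ 2 = U 0 ^ 2 + W 0 ^ 2 := fun t ht =>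
    eq_of_deriv_zero_off_finset (F := fun t => U t ^ 2 + W t ^ 2) ∅ ht.1
      (Continuous.continuousOn (by fun_prop)) fun s hs _ => by
        have hs' : s ∈ Ioo 0 T := ⟨hs.1, hs.2.trans_le ht.2⟩
        refine (((dU s).fun_pow 2).fun_add (((((dφ s hs').cos.const_mul a).fun_add
          ((dφ s hs').sin.const_mul b))).fun_pow 2)).congr_deriv ?_
        simp only [hW]
        ring
  -- This integral of motion expresses `U` through the position, which turns the Euler-Lagrange
  -- equation into the first-order field equation.
  have hκ : ∀ t ∈ Icc 0 T, U t + b * x t - a * y t = U 0 + b * x 0 - a * y 0 := fun t ht =>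
    eq_of_deriv_zero_off_finset (F := fun t => U t + b * x t - a * y t) ∅ ht.1
      (Continuous.continuousOn (by fun_prop)) fun s hs _ => by
        have hs' : s ∈ Ioo 0 T := ⟨hs.1, hs.2.trans_le ht.2⟩
        refine (((dU s).fun_add ((dx s hs').const_mul b)).fun_sub
          ((dy s hs').const_mul a)).congr_deriv ?_
        ring
  -- The energy is at least and at most `T`, and its density is constant.
  have hE1 : U 0 ^ 2 + W 0 ^ 2 = 1 := by
    have e : ∫ t in (0 : ℝ)..T, (u t ^ 2 + w t ^ 2) = T * (U 0 ^ 2 + W 0 ^ 2) := by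
      have : ∫ t in (0 : ℝ)..T, (u t ^ 2 + w t ^ 2) =
          ∫ t in (0 : ℝ)..T, (U 0 ^ 2 + W 0 ^ 2) := by
        refine intervalIntegral.integral_congr_ae ?_
        filter_upwards [hu, hw] with t h1 h2 hm
        rw [uIoc_of_le hT0.le] at hm
        rw [h1 hm, h2 hm]
        exact hE t (Ioc_subset_Icc_self hm)
      rw [this, intervalIntegral.integral_const, sub_zero, smul_eq_mul]
    have h1 := h.energy_le
    rw [← intervalIntegral.integral_add (intervalIntegrable_sq h.measurable_fst h.abs_fst_le 0 T)
      (intervalIntegrable_sq h.measurable_snd h.abs_snd_le 0 T), e] at h1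
    rw [e] at hT
    exact mul_left_cancel₀ hT0.ne' (by linarith)
  refine ⟨U 0 + b * x 0 - a * y 0, a, b, fun t ht => ?_⟩
  have e : U 0 + b * x 0 - a * y 0 + a * y t - b * x t = U t := by
    linarith [hκ t (Ioo_subset_Icc_self ht)]
  rw [e]
  exact ⟨dφ t ht, dx t ht, dy t ht, (hE t (Ioo_subset_Icc_self ht)).trans hE1⟩

/-! ### The degenerate case of constant angle. -/

/-- The Gram determinant vanishes only for constant angles, if the angle varies little. -/
theorem eq_of_gramDet_eq_zero {T : ℝ} (hT : 0 < T) {φ : ℝ → ℝ} (cφ : Continuous φ)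
    (h : gramDet T φ = 0) {t : ℝ} (ht : t ∈ Icc 0 T) (hφ : |φ t - φ 0| < Real.pi) :
    φ t = φ 0 := by
  have key : ∀ c d : ℝ, ∫ s in (0 : ℝ)..T, (c * Real.cos (φ s) + d * Real.sin (φ s)) ^ 2 = 0 →
      ∀ s ∈ Icc 0 T, c * Real.cos (φ s) + d * Real.sin (φ s) = 0 := by
    intro c d h0 s hs
    by_contra hne
    have := intervalIntegral.integral_pos hT
      (f := fun s => (c * Real.cos (φ s) + d * Real.sin (φ s)) ^ 2)
      (Continuous.continuousOn (by fun_prop)) (fun s _ => sq_nonneg _) ⟨s, hs, by positivity⟩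
    exact this.ne' h0
  have hexp : ∀ c d : ℝ, ∫ s in (0 : ℝ)..T, (c * Real.cos (φ s) + d * Real.sin (φ s)) ^ 2 =
      c ^ 2 * (∫ s in (0 : ℝ)..T, Real.cos (φ s) ^ 2) +
      2 * c * d * (∫ s in (0 : ℝ)..T, Real.cos (φ s) * Real.sin (φ s)) +
      d ^ 2 * (∫ s in (0 : ℝ)..T, Real.sin (φ s) ^ 2) := by
    intro c d
    rw [← intervalIntegral.integral_const_mul, ← intervalIntegral.integral_const_mul,
      ← intervalIntegral.integral_const_mul, ← intervalIntegral.integral_add,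
      ← intervalIntegral.integral_add]
    · congr 1
      funext s
      ring
    all_goals exact Continuous.intervalIntegrable (by fun_prop) _ _
  -- A kernel vector of the degenerate Gram matrix: the corresponding combination of `cos φ` and
  -- `sin φ` has zero norm, so it vanishes identically.
  have hcd : ∃ c d : ℝ, (c ≠ 0 ∨ d ≠ 0) ∧
      ∫ s in (0 : ℝ)..T, (c * Real.cos (φ s) + d * Real.sin (φ s)) ^ 2 = 0 := by
    unfold gramDet at h
    by_cases hD : ∫ s in (0 : ℝ)..T, Real.sin (φ s) ^ 2 = 0
    · exact ⟨0, 1, Or.inr one_ne_zero, by simpa using hD⟩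
    · refine ⟨_, -∫ s in (0 : ℝ)..T, Real.cos (φ s) * Real.sin (φ s), Or.inl hD, ?_⟩
      rw [hexp]
      linear_combination (∫ s in (0 : ℝ)..T, Real.sin (φ s) ^ 2) * h
  obtain ⟨c, d, hne, h0⟩ := hcd
  have h1 := key c d h0 t ht
  have h2 := key c d h0 0 (left_mem_Icc.2 hT.le)
  have hs : Real.sin (φ t - φ 0) = 0 := by
    rw [Real.sin_sub]
    rcases hne with hc | hd
    · refine (mul_eq_zero.1 ?_).resolve_left hc
      linear_combination Real.sin (φ t) * h2 - Real.sin (φ 0) * h1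
    · refine (mul_eq_zero.1 ?_).resolve_left hd
      linear_combination Real.cos (φ 0) * h1 - Real.cos (φ t) * h2
  rw [abs_lt] at hφ
  linarith [(Real.sin_eq_zero_iff_of_lt_of_lt hφ.1 hφ.2).1 hs]

/-- Shortest curves with constant angle are straight lines. -/
theorem exists_hasDerivAt_of_const_angle {T : ℝ} (hT : 0 < T) {φ w x y : ℝ → ℝ}
    (hφ : ∀ t ∈ Icc 0 T, φ t = φ 0) (hw : Measurable w) (hw1 : ∀ t, |w t| ≤ 1)
    (hx : ∀ t, x t = x 0 + ∫ s in (0 : ℝ)..t, w s * Real.cos (φ s))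
    (hy : ∀ t, y t = y 0 + ∫ s in (0 : ℝ)..t, w s * Real.sin (φ s))
    (hd : ENNReal.ofReal T ≤ subRiemannianDist (ofCoord (φ 0) (x 0) (y 0))
      (ofCoord (φ T) (x T) (y T))) :
    ∃ κ a b : ℝ, ∀ t ∈ Ioo 0 T, HasDerivAt φ (κ + a * y t - b * x t) t ∧
      HasDerivAt x ((a * Real.cos (φ t) + b * Real.sin (φ t)) * Real.cos (φ t)) t ∧
      HasDerivAt y ((a * Real.cos (φ t) + b * Real.sin (φ t)) * Real.sin (φ t)) t ∧
      (κ + a * y t - b * x t) ^ 2 + (a * Real.cos (φ t) + b * Real.sin (φ t)) ^ 2 = 1 := by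
  have hwi := intervalIntegrable_of_bounded hw hw1
  set r : ℝ → ℝ := fun t => ∫ s in (0 : ℝ)..t, w s with hr
  have hr0 : r 0 = 0 := by simp [hr]
  have hrl : ∀ s t, s ≤ t → |r t - r s| ≤ t - s := fun s t hst => by
    have e : r t - r s = ∫ q in s..t, w q :=
      intervalIntegral.integral_interval_sub_left (hwi 0 t) (hwi 0 s)
    rw [e]
    have := intervalIntegral.norm_integral_le_of_norm_le_const (f := w) (a := s) (b := t) (C := 1)
      fun q _ => hw1 q
    rwa [one_mul, abs_of_nonneg (sub_nonneg.2 hst)] at this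
  have hx' : ∀ t ∈ Icc 0 T, x t = x 0 + r t * Real.cos (φ 0) := fun t ht => by
    rw [hx t, hr, ← intervalIntegral.integral_mul_const]
    congr 1
    refine intervalIntegral.integral_congr fun s hs => ?_
    rw [uIcc_of_le ht.1] at hs
    simp only [hφ s ⟨hs.1, hs.2.trans ht.2⟩]
  have hy' : ∀ t ∈ Icc 0 T, y t = y 0 + r t * Real.sin (φ 0) := fun t ht => by
    rw [hy t, hr, ← intervalIntegral.integral_mul_const]
    congr 1
    refine intervalIntegral.integral_congr fun s hs => ?_
    rw [uIcc_of_le ht.1] at hs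
    simp only [hφ s ⟨hs.1, hs.2.trans ht.2⟩]
  have hTm : T ∈ Icc 0 T := right_mem_Icc.2 hT.le
  -- The segment traversed with constant velocity `r T / T` has length `|r T|`. As `r` is
  -- `1`-Lipschitz, this forces `r t = ± t`.
  have hrT : T ≤ |r T| := by
    let q := r T / T
    have hqT : T * q = r T := mul_div_cancel₀ _ hT.ne'
    have := subRiemannianDist_le_integral (v := fun _ => 0) (w := fun _ => q)
      (φ := fun _ => φ 0) (x := fun t => x 0 + t * (q * Real.cos (φ 0)))
      (y := fun t => y 0 + t * (q * Real.sin (φ 0))) contDiff_const contDiff_const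
      (fun t => hasDerivAt_const _ _)
      (fun t => by simpa using ((hasDerivAt_id t).mul_const (q * Real.cos (φ 0))).const_add (x 0))
      (fun t => by simpa using ((hasDerivAt_id t).mul_const (q * Real.sin (φ 0))).const_add (y 0))
      hT.le
    simp only [zero_mul, add_zero, ← mul_assoc, hqT, intervalIntegral.integral_const,
      zero_pow two_ne_zero, zero_add, Real.sqrt_sq_eq_abs, sub_zero, smul_eq_mul] at this
    rw [← hx' T hTm, ← hy' T hTm] at this
    rw [hφ T hTm] at hd
    have h1 := (ENNReal.ofReal_le_ofReal_iff (by positivity)).1 (hd.trans this)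
    rwa [← abs_of_pos hT, ← abs_mul, abs_of_pos hT, hqT] at h1
  obtain ⟨σ, hσ, hσT⟩ : ∃ σ : ℝ, σ ^ 2 = 1 ∧ T ≤ σ * r T := by
    rcases le_abs.1 hrT with h1 | h1
    · exact ⟨1, by norm_num, by linarith⟩
    · exact ⟨-1, by norm_num, by linarith⟩
  have hσa : |σ| = 1 := by
    rw [← sq_eq_sq₀ (abs_nonneg σ) zero_le_one, sq_abs, hσ, one_pow]
  have hrt : ∀ t ∈ Icc 0 T, r t = σ * t := fun t ht => by
    have h1 := hrl 0 t ht.1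
    have h2 := hrl t T ht.2
    rw [← one_mul |_|, ← hσa, ← abs_mul] at h1 h2
    have h3 := (le_abs_self _).trans h1
    have h4 := (le_abs_self _).trans h2
    rw [hr0] at h3
    have h5 : σ * r t = t := by linarith
    linear_combination σ * h5 - r t * hσ
  -- Here `a` and `b` make the translational velocity equal to `σ`, and `κ` makes the angular
  -- velocity vanish along the line.
  refine ⟨σ * Real.sin (φ 0) * x 0 - σ * Real.cos (φ 0) * y 0, σ * Real.cos (φ 0),
    σ * Real.sin (φ 0), fun t ht => ?_⟩
  have htm := Ioo_subset_Icc_self ht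
  have hev : ∀ᶠ s in nhds t, s ∈ Icc 0 T := by
    filter_upwards [isOpen_Ioo.mem_nhds ht] with s hs using Ioo_subset_Icc_self hs
  have hcs := Real.sin_sq_add_cos_sq (φ 0)
  have e1 : σ * Real.sin (φ 0) * x 0 - σ * Real.cos (φ 0) * y 0 + σ * Real.cos (φ 0) * y t -
      σ * Real.sin (φ 0) * x t = 0 := by
    rw [hx' t htm, hy' t htm]; ring
  have e2 : σ * Real.cos (φ 0) * Real.cos (φ 0) + σ * Real.sin (φ 0) * Real.sin (φ 0) = σ := by
    linear_combination σ * hcs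
  rw [e1, hφ t htm, e2]
  refine ⟨(hasDerivAt_const t (φ 0)).congr_of_eventuallyEq (hev.mono hφ), ?_, ?_, ?_⟩
  · refine HasDerivAt.congr_of_eventuallyEq (f := fun s => x 0 + s * (σ * Real.cos (φ 0))) ?_
      (hev.mono fun s hs => by rw [hx' s hs, hrt s hs]; ring)
    simpa using ((hasDerivAt_id t).mul_const (σ * Real.cos (φ 0))).const_add (x 0)
  · refine HasDerivAt.congr_of_eventuallyEq (f := fun s => y 0 + s * (σ * Real.sin (φ 0))) ?_
      (hev.mono fun s hs => by rw [hy' s hs, hrt s hs]; ring)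
    simpa using ((hasDerivAt_id t).mul_const (σ * Real.sin (φ 0))).const_add (y 0)
  · rw [hσ]; norm_num

/-! ### From local to global: geodesics follow one geodesic field. -/

/-- At time `t`, the velocity of `g` is that of the geodesic field with parameters `κ, a, b`, and
has unit length. -/
structure HasFieldVelocity (g : ℝ → SE2) (κ a b t : ℝ) : Prop where
  velocity : HasLeftVelocity g (hor (κ + a * toMat (g t) 1 2 - b * toMat (g t) 0 2)
    (a * toMat (g t) 0 0 + b * toMat (g t) 1 0)) t
  sq_add_sq : (κ + a * toMat (g t) 1 2 - b * toMat (g t) 0 2) ^ 2 +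
    (a * toMat (g t) 0 0 + b * toMat (g t) 1 0) ^ 2 = 1

/-- Short shortest curves have the velocity of a geodesic field. -/
theorem exists_hasFieldVelocity {g : ℝ → SE2} {T : ℝ} (hT0 : 0 < T) (hT : T ≤ 1 / 2)
    (hd : ∀ s t, 0 ≤ s → s ≤ t → t ≤ T → subRiemannianDist (g s) (g t) = ENNReal.ofReal (t - s)) :
    ∃ κ a b : ℝ, ∀ t ∈ Ioo 0 T, HasFieldVelocity g κ a b t := by
  obtain ⟨φ, x, y, hg, h1, h2⟩ := exists_coord_of_dist_eq hT0.le hT hd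
  obtain ⟨u, w, hu, hw, huw, cφ, iφ, ix, iy⟩ := exists_velocity h1 h2
  have hx : ∀ t, x t = x 0 + ∫ s in (0 : ℝ)..t, w s * Real.cos (φ s) := fun t => by rw [ix]; ring
  have hy : ∀ t, y t = y 0 + ∫ s in (0 : ℝ)..t, w s * Real.sin (φ s) := fun t => by rw [iy]; ring
  have hφ : ∀ t, φ t = φ 0 + ∫ s in (0 : ℝ)..t, u s := fun t => by rw [iφ]; ring
  have hdT : ENNReal.ofReal T ≤ subRiemannianDist (ofCoord (φ 0) (x 0) (y 0))
      (ofCoord (φ T) (x T) (y T)) := by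
    rw [← hg 0 (left_mem_Icc.2 hT0.le), ← hg T (right_mem_Icc.2 hT0.le),
      hd 0 T le_rfl hT0.le le_rfl, sub_zero]
  obtain ⟨κ, a, b, hκ⟩ : ∃ κ a b : ℝ, ∀ t ∈ Ioo 0 T, HasDerivAt φ (κ + a * y t - b * x t) t ∧
      HasDerivAt x ((a * Real.cos (φ t) + b * Real.sin (φ t)) * Real.cos (φ t)) t ∧
      HasDerivAt y ((a * Real.cos (φ t) + b * Real.sin (φ t)) * Real.sin (φ t)) t ∧
      (κ + a * y t - b * x t) ^ 2 + (a * Real.cos (φ t) + b * Real.sin (φ t)) ^ 2 = 1 := by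
    by_cases hD : gramDet T φ = 0
    · have hw1 : ∀ t, |w t| ≤ 1 := fun t => by
        rw [← sq_le_one_iff_abs_le_one]
        nlinarith [huw t, sq_nonneg (u t)]
      refine exists_hasDerivAt_of_const_angle hT0 (fun t ht => eq_of_gramDet_eq_zero hT0 cφ hD ht ?_)
        hw hw1 hx hy hdT
      have := h1 0 t ht.1
      have h3 : |φ t - φ 0| ≤ t := abs_le_of_sq_le_sq
        (by nlinarith [sq_nonneg (x t - x 0), sq_nonneg (y t - y 0)]) ht.1
      linarith [ht.2, Real.pi_gt_three]
    · have hmin : IsEnergyMinimizer T φ u w :=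
        { pos := hT0
          measurable_fst := hu
          measurable_snd := hw
          sq_le := huw
          continuous := cφ
          angle := hφ
          gram := hD
          le_energy := fun v z ψ C hv hz hvC hzC hψ hψD eT ec es => by
            refine le_energy_of_le_subRiemannianDist (x₀ := x 0) (y₀ := y 0) hT0 hv hz hvC hzC hψ
              hψD ?_
            rwa [ec, es, eT, ← hx, ← hy] }
      exact hmin.exists_hasDerivAt hx hy
  refine ⟨κ, a, b, fun t ht => ?_⟩
  obtain ⟨dφ, dx, dy, hs⟩ := hκ t ht
  have hgt := hg t (Ioo_subset_Icc_self ht)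
  have hev : g =ᶠ[nhds t] fun s => ofCoord (φ s) (x s) (y s) := by
    filter_upwards [isOpen_Ioo.mem_nhds ht] with s hs using hg s (Ioo_subset_Icc_self hs)
  refine ⟨?_, ?_⟩
  · have h3 := hasLeftVelocity_ofCoord dφ dx dy
    intro i j
    have h4 := (h3 i j).congr_of_eventuallyEq (hev.fun_comp fun h => toMat h i j)
    have e : toMat (g t) 1 2 = y t ∧ toMat (g t) 0 2 = x t ∧ toMat (g t) 0 0 = Real.cos (φ t) ∧
        toMat (g t) 1 0 = Real.sin (φ t) := by
      rw [hgt]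
      simp [mat]
    rw [e.1, e.2.1, e.2.2.1, e.2.2.2, hgt]
    exact h4
  · rw [hgt]
    simpa [mat] using hs

/-- Geodesics have, locally, the velocity of a geodesic field. -/
theorem IsGeodesic.eventually_hasFieldVelocity {g : ℝ → SE2} (hg : IsGeodesic g) (t₀ : ℝ) :
    ∃ p : ℝ × ℝ × ℝ, ∀ᶠ t in nhds t₀, HasFieldVelocity g p.1 p.2.1 p.2.2 t := by
  obtain ⟨ε, hε, h⟩ := hg t₀
  -- The bound `1 / 4` keeps the length `2 δ` of the interval around `t₀` below `1 / 2`.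
  obtain ⟨δ, hδ0, hδ⟩ := exists_between (lt_min hε (by norm_num : (0 : ℝ) < 1 / 4))
  obtain ⟨hδε, hδ4⟩ := lt_min_iff.1 hδ
  obtain ⟨κ, a, b, hκ⟩ := exists_hasFieldVelocity (g := fun r => g (r + (t₀ - δ))) (T := 2 * δ)
    (by linarith) (by linarith) (fun s t h0 hst ht => by
      rw [h _ ⟨by linarith, by linarith⟩ _ ⟨by linarith, by linarith⟩, abs_of_nonneg (by linarith)]
      congr 1
      ring)
  refine ⟨(κ, a, b), ?_⟩
  filter_upwards [Ioo_mem_nhds (by linarith : t₀ - δ < t₀) (by linarith : t₀ < t₀ + δ)] with t ht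
  obtain ⟨h1, h2⟩ := hκ (t - (t₀ - δ)) ⟨by linarith [ht.1], by linarith [ht.2]⟩
  simp only [sub_add_cancel] at h1 h2
  refine ⟨fun i j => ?_, h2⟩
  have := HasDerivAt.comp_sub_const t (t₀ - δ) (h1 i j)
  simpa only [sub_add_cancel] using this

/-- The parameters of the geodesic field are determined by the velocity of a curve on an interval. -/
theorem HasFieldVelocity.eq {g : ℝ → SE2} {κ a b κ' a' b' t : ℝ}
    (h : ∀ᶠ s in nhds t, HasFieldVelocity g κ a b s)
    (h' : ∀ᶠ s in nhds t, HasFieldVelocity g κ' a' b' s) : κ = κ' ∧ a = a' ∧ b = b' := by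
  have hcs : ∀ s, toMat (g s) 1 0 ^ 2 + toMat (g s) 0 0 ^ 2 = 1 := fun s => by
    obtain ⟨φ, x, y, e⟩ := exists_coord (g s)
    rw [e]
    simp [mat]
  have hev : ∀ᶠ s in nhds t,
      (κ - κ') + (a - a') * toMat (g s) 1 2 - (b - b') * toMat (g s) 0 2 = 0 ∧
      (a - a') * toMat (g s) 0 0 + (b - b') * toMat (g s) 1 0 = 0 := by
    filter_upwards [h, h'] with s hs hs'
    obtain ⟨p1, p2, p3, p4⟩ := hasLeftVelocity_iff.1 hs.velocity
    obtain ⟨q1, q2, q3, q4⟩ := hasLeftVelocity_iff.1 hs'.velocity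
    have r1 := p1.unique q1
    have r2 := p2.unique q2
    have r3 := p3.unique q3
    have r4 := p4.unique q4
    have e := hcs s
    constructor
    · linear_combination -(κ - κ' + (a - a') * toMat (g s) 1 2 - (b - b') * toMat (g s) 0 2) * e -
        toMat (g s) 1 0 * r1 + toMat (g s) 0 0 * r2
    · linear_combination -((a - a') * toMat (g s) 0 0 + (b - b') * toMat (g s) 1 0) * e +
        toMat (g s) 0 0 * r3 + toMat (g s) 1 0 * r4
  have ht := h.self_of_nhds
  obtain ⟨p1, p2, p3, p4⟩ := hasLeftVelocity_iff.1 ht.velocity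
  have hsq := ht.sq_add_sq
  set U := κ + a * toMat (g t) 1 2 - b * toMat (g t) 0 2
  set W := a * toMat (g t) 0 0 + b * toMat (g t) 1 0
  have d1 := (((p4.const_mul (a - a')).const_add (κ - κ')).fun_sub (p3.const_mul (b - b'))).unique
    ((hasDerivAt_const t (0 : ℝ)).congr_of_eventuallyEq (hev.mono fun s hs => hs.1))
  have d2 := ((p1.const_mul (a - a')).fun_add (p2.const_mul (b - b'))).unique
    ((hasDerivAt_const t (0 : ℝ)).congr_of_eventuallyEq (hev.mono fun s hs => hs.2))
  obtain ⟨e1, e2⟩ := hev.self_of_nhds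
  have e := hcs t
  -- Differentiating the two relations in `hev` gives this expression multiplied by `W` and by `-U`.
  -- Unit speed, `U² + W² = 1`, excludes that both factors vanish.
  have d3 : (a - a') * toMat (g t) 1 0 - (b - b') * toMat (g t) 0 0 = 0 := by
    linear_combination -((a - a') * toMat (g t) 1 0 - (b - b') * toMat (g t) 0 0) * hsq +
      W * d1 - U * d2
  have ha : a - a' = 0 := by
    linear_combination -(a - a') * e + toMat (g t) 1 0 * d3 + toMat (g t) 0 0 * e2
  have hb : b - b' = 0 := by
    linear_combination -(b - b') * e - toMat (g t) 0 0 * d3 + toMat (g t) 1 0 * e2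
  rw [ha, hb] at e1
  exact ⟨by linarith, by linarith, by linarith⟩

/-- Every geodesic through the unit is an integral curve of a geodesic field. -/
theorem IsGeodesic.exists_isFieldCurve {g : ℝ → SE2} (hg : IsGeodesic g) (h0 : g 0 = 1) :
    ∃ α β, IsFieldCurve α β g := by
  choose p hp using hg.eventually_hasFieldVelocity
  have hloc : IsLocallyConstant p := by
    rw [IsLocallyConstant.iff_eventually_eq]
    intro t
    filter_upwards [(hp t).eventually_nhds] with s hs
    obtain ⟨e1, e2, e3⟩ := HasFieldVelocity.eq (hp s) hs
    exact Prod.ext e1 (Prod.ext e2 e3)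
  have hvel : ∀ t, HasFieldVelocity g (p 0).1 (p 0).2.1 (p 0).2.2 t := fun t => by
    have := (hp t).self_of_nhds
    rwa [hloc.apply_eq_of_preconnectedSpace t 0] at this
  generalize p 0 = q at hvel
  obtain ⟨κ, a, b⟩ := q
  have hsq := (hvel 0).sq_add_sq
  rw [h0, ← ofCoord_zero] at hsq
  simp only [toMat_ofCoord] at hsq
  have hsq' : κ ^ 2 + a ^ 2 = 1 := by simpa [mat] using hsq
  have hn : ‖(⟨κ, a⟩ : ℂ)‖ = 1 := by
    rw [← sq_eq_sq₀ (norm_nonneg _) zero_le_one, Complex.sq_norm, Complex.normSq_mk]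
    linarith
  have hne : (⟨κ, a⟩ : ℂ) ≠ 0 := by
    rw [← norm_ne_zero_iff, hn]
    exact one_ne_zero
  -- Unit speed at the unit of the group reads `κ² + a² = 1`, so `κ = cos α` and `a = sin α` for
  -- this `α`.
  refine ⟨Complex.arg ⟨κ, a⟩, b, isFieldCurve_iff.2 fun t => ?_⟩
  have hv := (hvel t).velocity
  rw [Complex.cos_arg hne, Complex.sin_arg, hn, div_one, div_one, mul_comm _ a]
  exact hv

end SE2Geo

theorem mainTheorem12 :
    (∀ α β : ℝ, ∃! g : ℝ → SE2Geo.SE2, g 0 = 1 ∧ SE2Geo.IsFieldCurve α β g) ∧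
    (∀ g : ℝ → SE2Geo.SE2, g 0 = 1 →
      (SE2Geo.IsGeodesic g ↔ ∃ α β : ℝ, SE2Geo.IsFieldCurve α β g)) ∧
    (∀ (α β : ℝ) (g : ℝ → SE2Geo.SE2), g 0 = 1 → SE2Geo.IsFieldCurve α β g →
      ∃ φ x y ω : ℝ → ℝ,
        (∀ t, SE2Geo.toMat (g t) = SE2Geo.mat (φ t) (x t) (y t)) ∧
        φ 0 = 0 ∧ x 0 = 0 ∧ y 0 = 0 ∧
        (∀ t, Real.sin (ω t / 2) = Real.sin α * Real.cos (φ t) + β * Real.sin (φ t)) ∧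
        (∀ t, Real.cos (ω t / 2) = Real.cos α + y t * Real.sin α - β * x t) ∧
        (∀ t, HasDerivAt φ (Real.cos (ω t / 2)) t) ∧
        (∀ t, HasDerivAt x (Real.sin (ω t / 2) * Real.cos (φ t)) t) ∧
        (∀ t, HasDerivAt y (Real.sin (ω t / 2) * Real.sin (φ t)) t) ∧
        Differentiable ℝ ω ∧
        (∀ t, HasDerivAt (deriv ω) (-Real.sin (ω t)) t) ∧
        ω 0 = 2 * α ∧ deriv ω 0 = 2 * β) := by
  refine ⟨SE2Geo.existsUnique_fieldCurve, fun g h0 =>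
    ⟨fun hg => hg.exists_isFieldCurve h0, fun ⟨_, _, hg⟩ => hg.isGeodesic h0⟩,
    fun _ _ _ h0 hg => hg.pendulum h0⟩
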